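/- **Setting.** Let $N$ be a (nonempty) complex manifold with complex structure $I_0$, and let $(g_0, I_0, \omega_0)$ be a real-analytic Kähler structure on $N$: $g_0$ is a real-analytic Riemannian metric, $\omega_0$ is a nondegenerate $2$-form, $\omega_0(u,v) = g_0(I_0u,v)$, and $I_0$ is parallel for the Levi-Civita connection of $g_0$. Let $f : N \hookrightarrow M$ be a complexification of $N$, i.e. a real-analytic embedding into a complex manifold $(M,J)$ such that $T_pN \oplus J(T_pN) = T_pM$ for every $p \in N$. Denote by $g_0^c$, $I_0^c$, $\omega_0^c$ the holomorphic extensions of $g_0$, $I_0$, $\omega_0$ to a neighbourhood of $N$ in $M$, that is, the holomorphic (in particular complex-linear, respectively complex-bilinear) tensor fields near $N$ whose pullbacks by $f$ are $g_0$, $I_0$, $\omega_0$. Let $\overline N$ denote $N$ with the complex structure $-I_0$. Some open neighbourhood of $N$ in $M$ is identified, by a biholomorphism $\varphi$ onto an open subset of $N \times \overline N$ with $\varphi(f(x)) = (x,x)$, with a neighbourhood of the diagonal. The canonical foliations $\mathcal F_1$, $\mathcal F_2$ of $M$ near $N$ are the pullbacks by $\varphi$ of the vertical foliation (leaves $\{z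 = \text{const}\}$, where $z$ is the first projection) and of the horizontal foliation (leaves $\{w = \text{const}\}$, where $w$ is the second projection), respectively. **Definitions.** On a complex manifold $(M,J)$: * A *complex symplectic structure* is a closed nondegenerate $(2,0)$-form. A *holomorphic metric* is a holomorphic nondegenerate symmetric complex bilinear form on $TM$. A *complex Lagrangian foliation* is a holomorphic foliation whose leaves are isotropic and half-dimensional. A *complex bi-Lagrangian structure* $(\omega, \mathcal F_1, \mathcal F_2)$ is a complex symplectic structure $\omega$ with an ordered pair of transverse complex Lagrangian foliations. * A *holomorphic bicomplex structure* is given by a complex-linear holomorphic integrable almost complex structure $I$ and a complex-linear holomorphic integrable para-complex structure $F$ ($F^2 = 1$, $\operatorname{tr} F = 0$, with involutive $\pm 1$-eigendistributions) such that $IJ = JI = F$. It is determined by $F$. * A *holomorphic bicomplex Kähler structure* $(g,F,\omega)$ consists of a holomorphic metric $g$, a para-complex structure $F$ defining a holomorphic bicomplex structure, and a complex symplectic structure $\omega$, such that $\omega(u,v) = g(Fu,v)$ for all $u,v$ and $F$ is parallel for the Levi-Civita connection of $g$. The complex bi-Lagrangian structure associated to it is $(\omega, \mathcal F_1, \mathcal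 F_2)$, where the tangent distributions of $\mathcal F_1$ and $\mathcal F_2$ are the $+1$ and $-1$ eigendistributions of $F$. **Theorem.** The holomorphic extensions $g_0^c, I_0^c, \omega_0^c$ and the identification $\varphi$ exist on some open neighbourhoods of $N$ in $M$. Put $I := I_0^c$, $ig := g_0^c$ (that is, $g = -i\,g_0^c$), $\omega := \omega_0^c$ and $F := IJ$. Then, for any choice of such extensions and of such an identification, in a sufficiently small open neighbourhood of $N$ in $M$ the triple $(g, F, \omega)$ is a holomorphic bicomplex Kähler structure. Moreover $(\omega, \mathcal F_1, \mathcal F_2)$ is there a complex bi-Lagrangian structure, and it is the one associated to $(g,F,\omega)$: the tangent distributions of the canonical foliations $\mathcal F_1$ and $\mathcal F_2$ are respectively the $+1$ and $-1$ eigendistributions of $F$. -/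

import Mathlib

open Set Bundle VectorField
open scoped Manifold ContDiff Topology

noncomputable section

/-! ### Complex manifolds and tensor fields

A complex manifold `M` modelled on the finite-dimensional complex vector space `E` is a charted
space with `IsManifold 𝓘(ℂ, E) ω M`. Its holomorphic tangent space at `x` is
`TangentSpace 𝓘(ℂ, E) x`; the tangent space at `x` of the underlying real-analytic manifold is
`TangentSpace 𝓘(ℝ, E) x`. Both are the same additive group, and multiplication by `i` on the
first is the almost complex structure on the second. -/

/-- The real-analytic (or `C^n`) manifold underlying a complex manifold. -/
instance isManifold_real_of_complex {E : Type*} [NormedAddCommGroup E] [NormedSpace ℂ E]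
    {n : ℕ∞ω} {M : Type*} [TopologicalSpace M] [ChartedSpace E M] [IsManifold 𝓘(ℂ, E) n M] :
    IsManifold 𝓘(ℝ, E) n M := by
  refine isManifold_of_contDiffOn 𝓘(ℝ, E) n M ?_
  intro e e' he he'
  have h := (contDiffGroupoid n 𝓘(ℂ, E)).compatible he he'
  rw [contDiffGroupoid, mem_groupoid_of_pregroupoid] at h
  exact h.1.restrict_scalars ℝ

section Tensors

variable (𝕜 : Type*) [NontriviallyNormedField 𝕜] (E : Type*) [NormedAddCommGroup E]
  [NormedSpace 𝕜 E] (M : Type*) [TopologicalSpace M] [ChartedSpace E M]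

/-- Vector fields (no regularity imposed). -/
abbrev VecField : Type _ := ∀ x : M, TangentSpace 𝓘(𝕜, E) x

/-- Fields of endomorphisms of the tangent bundle (no regularity imposed). -/
abbrev EndField : Type _ := ∀ x : M, TangentSpace 𝓘(𝕜, E) x →L[𝕜] TangentSpace 𝓘(𝕜, E) x

/-- Fields of bilinear forms on the tangent bundle (no regularity imposed). -/
abbrev BilinField : Type _ :=
  ∀ x : M, TangentSpace 𝓘(𝕜, E) x →L[𝕜] TangentSpace 𝓘(𝕜, E) x →L[𝕜] 𝕜

/-- Connections on the tangent bundle: `cov X x v` is `(∇_v X)(x)`. -/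
abbrev TangentConnection : Type _ := VecField 𝕜 E M → EndField 𝕜 E M

variable {𝕜 E M}

/-- A bilinear form is nondegenerate at every point of `V`. -/
def NondegenerateOn (V : Set M) (b : BilinField 𝕜 E M) : Prop :=
  ∀ x ∈ V, ∀ u, (∀ v, b x u v = 0) → u = 0

/-- Alternating at every point of `V`. -/
def AlternatingOn (V : Set M) (b : BilinField 𝕜 E M) : Prop :=
  ∀ x ∈ V, ∀ u, b x u u = 0

/-- Symmetric at every point of `V`. -/
def SymmetricOn (V : Set M) (b : BilinField 𝕜 E M) : Prop :=
  ∀ x ∈ V, ∀ u v, b x u v = b x v u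

variable [IsManifold 𝓘(𝕜, E) 1 M]

/-- The vector field `X` is differentiable at `x` (complex-differentiable when `𝕜 = ℂ`). -/
def VecField.DiffAt (X : VecField 𝕜 E M) (x : M) : Prop :=
  MDifferentiableAt 𝓘(𝕜, E) (𝓘(𝕜, E).prod 𝓘(𝕜, E))
    (fun y => (TotalSpace.mk' E y (X y) : TangentBundle 𝓘(𝕜, E) M)) x

/-- The two-form `b` is closed on `V`, i.e. `db = 0` there, where
`db(X,Y,Z) = X b(Y,Z) - Y b(X,Z) + Z b(X,Y) - b([X,Y],Z) + b([X,Z],Y) - b([Y,Z],X)`. -/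
def ClosedTwoFormOn (V : Set M) (b : BilinField 𝕜 E M) : Prop :=
  ∀ x ∈ V, ∀ X Y Z : VecField 𝕜 E M, X.DiffAt x → Y.DiffAt x → Z.DiffAt x →
    mvfderiv 𝓘(𝕜, E) (fun y => b y (Y y) (Z y)) x (X x)
      - mvfderiv 𝓘(𝕜, E) (fun y => b y (X y) (Z y)) x (Y x)
      + mvfderiv 𝓘(𝕜, E) (fun y => b y (X y) (Y y)) x (Z x)
      - b x (mlieBracket 𝓘(𝕜, E) X Y x) (Z x)
      + b x (mlieBracket 𝓘(𝕜, E) X Z x) (Y x)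
      - b x (mlieBracket 𝓘(𝕜, E) Y Z x) (X x) = 0

/-- `cov` is the Levi-Civita connection of `g` on the open set `V`: a torsion-free connection with
`∇g = 0`. When `g` is a (differentiable) metric, the Koszul formula shows that these conditions
determine `cov X` at the points of `V` where `X` is differentiable, and that the connection is as
regular as the first derivatives of `g` (so it is holomorphic when `𝕜 = ℂ` and `g` is
holomorphic). -/
structure IsLeviCivitaOn (V : Set M) (g : BilinField 𝕜 E M) (cov : TangentConnection 𝕜 E M) :
    Prop where
  isCovariantDerivative : IsCovariantDerivativeOn E cov V
  torsion_free : ∀ x ∈ V, ∀ X Y : VecField 𝕜 E M, X.DiffAt x → Y.DiffAt x →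
    cov Y x (X x) - cov X x (Y x) = mlieBracket 𝓘(𝕜, E) X Y x
  metric : ∀ x ∈ V, ∀ X Y : VecField 𝕜 E M, X.DiffAt x → Y.DiffAt x → ∀ v,
    mvfderiv 𝓘(𝕜, E) (fun y => g y (X y) (Y y)) x v =
      g x (cov X x v) (Y x) + g x (X x) (cov Y x v)

/-- The endomorphism field `A` is parallel on `V`: `∇A = 0`, i.e. `∇_v (A X) = A (∇_v X)`. -/
def ParallelOn (V : Set M) (cov : TangentConnection 𝕜 E M) (A : EndField 𝕜 E M) : Prop :=
  ∀ x ∈ V, ∀ X : VecField 𝕜 E M, X.DiffAt x → ∀ v,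
    cov (fun y => A y (X y)) x v = A x (cov X x v)

end Tensors

section Complex

variable {E : Type*} [NormedAddCommGroup E] [NormedSpace ℂ E]
  {M : Type*} [TopologicalSpace M] [ChartedSpace E M]

/-- A real tangent vector seen as a holomorphic tangent vector (the usual complex-linear
identification of `(TM, J)` with the holomorphic tangent bundle). -/
def toHol {x : M} (u : TangentSpace 𝓘(ℝ, E) x) : TangentSpace 𝓘(ℂ, E) x := u

/-- A complex-linear endomorphism field seen as a real endomorphism field. -/
def EndField.toReal (A : EndField ℂ E M) : EndField ℝ E M :=
  fun x =>
    let B : E →L[ℂ] E := A x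
    B.restrictScalars ℝ

variable (E M) in
/-- The almost complex structure of a complex manifold, as a complex-linear endomorphism field:
multiplication by `i` in each tangent space. -/
def complexStructureHol : EndField ℂ E M :=
  fun _ => Complex.I • ContinuousLinearMap.id ℂ _

variable (E M) in
/-- The almost complex structure of a complex manifold, as a real endomorphism field. -/
def complexStructure : EndField ℝ E M := (complexStructureHol E M).toReal

variable [IsManifold 𝓘(ℂ, E) ω M]

/-- The Nijenhuis tensor of the endomorphism field `A` (for an almost complex structure) vanishes
on `V`: `[AX, AY] - A[AX, Y] - A[X, AY] - [X, Y] = 0`. -/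
def NijenhuisVanishesOn (V : Set M) (A : EndField ℝ E M) : Prop :=
  ∀ x ∈ V, ∀ X Y : VecField ℝ E M, X.DiffAt x → Y.DiffAt x →
    mlieBracket 𝓘(ℝ, E) (fun y => A y (X y)) (fun y => A y (Y y)) x
      - A x (mlieBracket 𝓘(ℝ, E) (fun y => A y (X y)) Y x)
      - A x (mlieBracket 𝓘(ℝ, E) X (fun y => A y (Y y)) x)
      - mlieBracket 𝓘(ℝ, E) X Y x = 0

/-- The eigendistribution `{u | A u = c u}` of an endomorphism field. -/
def eigendistribution (A : EndField ℝ E M) (c : ℝ) (x : M) :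
    Submodule ℝ (TangentSpace 𝓘(ℝ, E) x) :=
  (A x - c • ContinuousLinearMap.id ℝ (TangentSpace 𝓘(ℝ, E) x)).ker

/-- The distribution `D` is involutive on the open set `V`. -/
def InvolutiveOn (V : Set M) (D : ∀ x : M, Submodule ℝ (TangentSpace 𝓘(ℝ, E) x)) : Prop :=
  ∀ x ∈ V, ∀ X Y : VecField ℝ E M, X.DiffAt x → Y.DiffAt x →
    (∀ᶠ y in 𝓝 x, X y ∈ D y) → (∀ᶠ y in 𝓝 x, Y y ∈ D y) →
    mlieBracket 𝓘(ℝ, E) X Y x ∈ D x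

/-- Holomorphic field of bilinear forms on the open set `V`. -/
def HolomorphicBilinOn (V : Set M) (b : BilinField ℂ E M) : Prop :=
  ContMDiffOn 𝓘(ℂ, E) (𝓘(ℂ, E).prod 𝓘(ℂ, E →L[ℂ] E →L[ℂ] ℂ)) ω
    (fun x => (TotalSpace.mk' (E →L[ℂ] E →L[ℂ] ℂ) x (b x) :
      TotalSpace (E →L[ℂ] E →L[ℂ] ℂ)
        (fun x : M => TangentSpace 𝓘(ℂ, E) x →L[ℂ] TangentSpace 𝓘(ℂ, E) x →L[ℂ] ℂ))) V

/-- Holomorphic field of endomorphisms on the open set `V`. -/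
def HolomorphicEndOn (V : Set M) (A : EndField ℂ E M) : Prop :=
  ContMDiffOn 𝓘(ℂ, E) (𝓘(ℂ, E).prod 𝓘(ℂ, E →L[ℂ] E)) ω
    (fun x => (TotalSpace.mk' (E →L[ℂ] E) x (A x) :
      TotalSpace (E →L[ℂ] E)
        (fun x : M => TangentSpace 𝓘(ℂ, E) x →L[ℂ] TangentSpace 𝓘(ℂ, E) x))) V

/-- A holomorphic (Riemannian) metric on the open set `V`. -/
structure IsHolomorphicMetricOn (V : Set M) (g : BilinField ℂ E M) : Prop where
  holomorphic : HolomorphicBilinOn V g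
  symm : SymmetricOn V g
  nondegenerate : NondegenerateOn V g

/-- A complex symplectic structure on the open set `V`: a closed nondegenerate `(2,0)`-form
(it is then holomorphic, which is recorded here). -/
structure IsComplexSymplecticOn (V : Set M) (b : BilinField ℂ E M) : Prop where
  holomorphic : HolomorphicBilinOn V b
  alternating : AlternatingOn V b
  closed : ClosedTwoFormOn V b
  nondegenerate : NondegenerateOn V b

/-- `(I, J, F)` is a holomorphic bicomplex structure on the open subset `V` of the complex manifold
`M`, where `J` is the complex structure of `M`: `I` is an integrable almost complex structure,
`F` is an integrable para-complex structure, both are complex-linear and holomorphic, and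
`F = IJ = JI`. -/
structure IsHolomorphicBicomplexOn (V : Set M) (I F : EndField ℂ E M) : Prop where
  holomorphic_I : HolomorphicEndOn V I
  holomorphic_F : HolomorphicEndOn V F
  sq_I : ∀ x ∈ V, ∀ u, I x (I x u) = -u
  sq_F : ∀ x ∈ V, ∀ u, F x (F x u) = u
  comp_IJ : ∀ x ∈ V, ∀ u, I x (complexStructureHol E M x u) = F x u
  comp_JI : ∀ x ∈ V, ∀ u, complexStructureHol E M x (I x u) = F x u
  integrable_I : NijenhuisVanishesOn V I.toReal
  trace_F : ∀ x ∈ V, LinearMap.trace ℝ (TangentSpace 𝓘(ℝ, E) x) (F.toReal x) = 0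
  involutive_pos : InvolutiveOn V (eigendistribution F.toReal 1)
  involutive_neg : InvolutiveOn V (eigendistribution F.toReal (-1))

/-- `(g, F, b)` is a holomorphic bicomplex Kähler structure on the open set `V`: `g` is a
holomorphic metric, `F` is a para-complex structure defining a holomorphic bicomplex structure
(the almost complex structure `I` is determined by `F = IJ`), `b` is a complex symplectic
structure, `b(u, v) = g(Fu, v)`, and `F` is parallel for the Levi-Civita connection of `g`. -/
structure IsBicomplexKahlerOn (V : Set M) (g : BilinField ℂ E M) (F : EndField ℂ E M)
    (b : BilinField ℂ E M) : Prop where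
  metric : IsHolomorphicMetricOn V g
  bicomplex : ∃ I : EndField ℂ E M, IsHolomorphicBicomplexOn V I F
  symplectic : IsComplexSymplecticOn V b
  compatible : ∀ x ∈ V, ∀ u v, b x u v = g x (F x u) v
  parallel : ∃ cov : TangentConnection ℂ E M, IsLeviCivitaOn V g cov ∧ ParallelOn V cov F

/-- `D` is the tangent distribution of a holomorphic foliation of the open set `V`: near each point
of `V` there is a holomorphic submersion to some `ℂ^k` whose level sets are the plaques. A
foliation is determined by its tangent distribution (the leaves are the maximal connected integral
manifolds), and foliations are represented by their tangent distributions throughout. -/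
def IsHolomorphicFoliationOn (V : Set M) (D : ∀ x : M, Submodule ℝ (TangentSpace 𝓘(ℝ, E) x)) :
    Prop :=
  ∀ x ∈ V, ∃ (W : Set M) (k : ℕ) (s : M → Fin k → ℂ), IsOpen W ∧ x ∈ W ∧ W ⊆ V ∧
    ContMDiffOn 𝓘(ℂ, E) 𝓘(ℂ, Fin k → ℂ) ω s W ∧
    ∀ y ∈ W, Function.Surjective (mvfderiv 𝓘(ℂ, E) s y) ∧
      ∀ u : TangentSpace 𝓘(ℝ, E) y, u ∈ D y ↔ mvfderiv 𝓘(ℂ, E) s y (toHol u) = 0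

/-- A foliation with complex Lagrangian leaves: the leaves are half-dimensional and isotropic. -/
structure IsComplexLagrangianFoliationOn (V : Set M) (b : BilinField ℂ E M)
    (D : ∀ x : M, Submodule ℝ (TangentSpace 𝓘(ℝ, E) x)) : Prop where
  foliation : IsHolomorphicFoliationOn V D
  half_dim : ∀ x ∈ V, 2 * Module.finrank ℝ (D x) = Module.finrank ℝ E
  isotropic : ∀ x ∈ V, ∀ u ∈ D x, ∀ v ∈ D x, b x (toHol u) (toHol v) = 0

/-- A complex bi-Lagrangian structure on the open set `V`: a complex symplectic structure and an
ordered pair of transverse complex Lagrangian foliations. -/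
structure IsComplexBiLagrangianOn (V : Set M) (b : BilinField ℂ E M)
    (D₁ D₂ : ∀ x : M, Submodule ℝ (TangentSpace 𝓘(ℝ, E) x)) : Prop where
  symplectic : IsComplexSymplecticOn V b
  lagrangian₁ : IsComplexLagrangianFoliationOn V b D₁
  lagrangian₂ : IsComplexLagrangianFoliationOn V b D₂
  transverse : ∀ x ∈ V, IsCompl (D₁ x) (D₂ x)

/-- `(g, I, b)`, with `g` a Riemannian metric and `I` the almost complex structure of the complex
manifold, is a Kähler structure: `b` is an almost symplectic structure (a nondegenerate two-form),
`b(u, v) = g(Iu, v)`, and `I` is parallel for the Levi-Civita connection of `g`. (By the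
compatibility condition `b` is exactly as regular as `g`.) -/
structure IsKahler (g b : BilinField ℝ E M) : Prop where
  alternating : AlternatingOn univ b
  nondegenerate : NondegenerateOn univ b
  compatible : ∀ x u v, b x u v = g x (complexStructure E M x u) v
  parallel : ∃ cov : TangentConnection ℝ E M,
    IsLeviCivitaOn univ g cov ∧ ParallelOn univ cov (complexStructure E M)

end Complex

section Complexification

variable {E : Type*} [NormedAddCommGroup E] [NormedSpace ℂ E]
  {N : Type*} [TopologicalSpace N] [ChartedSpace E N]
  {E' : Type*} [NormedAddCommGroup E'] [NormedSpace ℂ E']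
  {M : Type*} [TopologicalSpace M] [ChartedSpace E' M]

variable (E E') in
/-- The differential of a map between the underlying real manifolds. -/
abbrev realDeriv (f : N → M) (x : N) : TangentSpace 𝓘(ℝ, E) x →L[ℝ] TangentSpace 𝓘(ℝ, E') (f x) :=
  mfderiv 𝓘(ℝ, E) 𝓘(ℝ, E') f x

variable (E E') in
/-- `f : N → M` is a complexification: a real-analytic embedding whose image is maximal totally
real, `T_pN ⊕ J(T_pN) = T_pM`. -/
structure IsComplexification (f : N → M) : Prop where
  isEmbedding : Manifold.IsSmoothEmbedding 𝓘(ℝ, E) 𝓘(ℝ, E') ω f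
  totally_real : ∀ p : N,
    IsCompl (realDeriv E E' f p).range
      ((realDeriv E E' f p).range.map
        (complexStructure E' M (f p) :
          TangentSpace 𝓘(ℝ, E') (f p) →ₗ[ℝ] TangentSpace 𝓘(ℝ, E') (f p)))

/-- On the open neighbourhood `U` of `f(N)`, the bilinear form field `bc` is a holomorphic
extension of `b`: it is holomorphic and `f^* bc = b`. -/
structure IsHolomorphicExtensionBilin [IsManifold 𝓘(ℂ, E') ω M] (f : N → M) (b : BilinField ℝ E N)
    (U : Set M) (bc : BilinField ℂ E' M) : Prop where
  holomorphic : HolomorphicBilinOn U bc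
  pullback : ∀ (x : N) (u v : TangentSpace 𝓘(ℝ, E) x),
    bc (f x) (toHol (realDeriv E E' f x u)) (toHol (realDeriv E E' f x v)) = ((b x u v : ℝ) : ℂ)

/-- On the open neighbourhood `U` of `f(N)`, the endomorphism field `Ac` is a holomorphic
extension of `A`: it is holomorphic and `f^* Ac = A`. -/
structure IsHolomorphicExtensionEnd [IsManifold 𝓘(ℂ, E') ω M] (f : N → M) (A : EndField ℝ E N)
    (U : Set M) (Ac : EndField ℂ E' M) : Prop where
  holomorphic : HolomorphicEndOn U Ac
  pullback : ∀ (x : N) (u : TangentSpace 𝓘(ℝ, E) x),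
    Ac (f x) (toHol (realDeriv E E' f x u)) = toHol (realDeriv E E' f x (A x u))

variable (E E') in
/-- The differential of a map `φ` from `M` to `N × N`, componentwise. -/
abbrev realDerivFst (φ : M → N × N) (x : M) :
    TangentSpace 𝓘(ℝ, E') x →L[ℝ] TangentSpace 𝓘(ℝ, E) (φ x).1 :=
  mfderiv 𝓘(ℝ, E') 𝓘(ℝ, E) (fun y => (φ y).1) x

variable (E E') in
/-- See `realDerivFst`. -/
abbrev realDerivSnd (φ : M → N × N) (x : M) :
    TangentSpace 𝓘(ℝ, E') x →L[ℝ] TangentSpace 𝓘(ℝ, E) (φ x).2 :=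
  mfderiv 𝓘(ℝ, E') 𝓘(ℝ, E) (fun y => (φ y).2) x

variable (E E') in
/-- `φ` identifies the open neighbourhood `U` of `f(N)` in `M` with an open neighbourhood of the
diagonal in the canonical complexification `N × N̄` (the product `N × N` with the complex structure
`I₀ ⊕ -I₀`): `φ ∘ f` is the diagonal embedding and, on `U`, `φ` is a biholomorphism onto an open
subset of `N × N̄`. -/
structure IsCanonicalIdentification (f : N → M) (U : Set M) (φ : M → N × N) : Prop where
  isOpen : IsOpen U
  range_subset : range f ⊆ U
  diagonal : ∀ x : N, φ (f x) = (x, x)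
  injOn : InjOn φ U
  localDiffeo : IsLocalDiffeomorphOn 𝓘(ℝ, E') (𝓘(ℝ, E).prod 𝓘(ℝ, E)) ω φ U
  holomorphic_fst : ∀ x ∈ U, ∀ u, realDerivFst E E' φ x (complexStructure E' M x u) =
    complexStructure E N (φ x).1 (realDerivFst E E' φ x u)
  antiholomorphic_snd : ∀ x ∈ U, ∀ u, realDerivSnd E E' φ x (complexStructure E' M x u) =
    -complexStructure E N (φ x).2 (realDerivSnd E E' φ x u)

variable (E E') in
/-- The first canonical foliation: the pullback under `φ` of the vertical foliation of `N × N̄`,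
with leaves `{z = constant}` where `z` is the first projection. -/
def canonicalFoliation₁ (φ : M → N × N) (x : M) : Submodule ℝ (TangentSpace 𝓘(ℝ, E') x) :=
  (realDerivFst E E' φ x).ker

variable (E E') in
/-- The second canonical foliation: the pullback under `φ` of the horizontal foliation of `N × N̄`,
with leaves `{w = constant}` where `w` is the second projection. -/
def canonicalFoliation₂ (φ : M → N × N) (x : M) : Submodule ℝ (TangentSpace 𝓘(ℝ, E') x) :=
  (realDerivSnd E E' φ x).ker

end Complexification

end

/-! Everything is local along `f(N)` and follows by analytic continuation from a totally real
subspace.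

Fix a conjugation σ of the model space `E` and let Δ = {(z, σ z)} ⊂ `E × E`, so that `E × E` = Δ ⊕
iΔ. A real-analytic map on `E` extends holomorphically off Δ, by complexifying its power series, and
a holomorphic map vanishing on Δ vanishes nearby. Extending `f`, read in a chart κ of `N`, gives a
holomorphic map whose differential is invertible because `f(N)` is maximal totally real. Its inverse
yields a holomorphic chart Ψ of `M` in which `f` becomes z ↦ (z, σ z)
(`IsComplexification.exists_isDiagonalChart`).

In such a chart an identity between holomorphic tensors need only be checked on Δ and on vectors
tangent to Δ, where it is an identity on `N`. On Δ the structure I₀ sends (u, σ u) to (iu, -iσ u).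
Hence I₀ᶜ = diag(i, -i) and F = i I₀ᶜ = diag(-1, 1), with constant coefficients: the +1 eigenspace
is {u₁ = 0} and the -1 eigenspace is {u₂ = 0}. For the same reason φ reads κ(φ₁) = q₁, σ κ(φ₂) = q₂,
so its vertical and horizontal foliations have exactly these tangent spaces. Symmetry of g, skewness
of ω, the relation ω = g(F·,·) and dω = 0 also continue from `N`; there dω₀ = 0 because I₀ is
parallel (`IsKahler.inChart_closed`). Nondegeneracy is an open condition, and holds on `N` since g₀
is positive definite (`IsDiagonalChart.exists_isAdaptedOn`).

From these coordinate identities the conclusion is algebra. Constant coefficients give integrability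
of I and F. The Koszul formula gives the Levi-Civita connection, and closedness of ω with constancy
of F makes F commute with the Christoffel symbols, so F is parallel (`christoffel_comm`). On an
eigenspace of F the form ω is a multiple of g, hence both skew and symmetric, hence zero: the
foliations are Lagrangian.

Existence is also local: coefficients are extended in diagonal charts, and local identifications are
read off from them. Continuation makes the germs along `f(N)` unique, so the local pieces glue
(`exists_glue_germs`). The glued identification is injective near `f(N)` because its local inverses
glue as well. -/

noncomputable section

set_option linter.unusedSectionVars false

section

/-! ### Conjugations and the totally real subspace `{(z, σ z)}` of `E × E` -/

/-- A complex-antilinear involution of a complex vector space. -/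
structure Conjugation (E : Type*) [NormedAddCommGroup E] [NormedSpace ℂ E] where
  /-- The underlying real-linear map. -/
  map : E →L[ℝ] E
  map_I : ∀ z, map (Complex.I • z) = -(Complex.I • map z)
  map_map : ∀ z, map (map z) = z

/-- Coordinatewise conjugation in a complex basis. If κ is a holomorphic chart of `N`, then σ ∘ κ is
a holomorphic chart of `N̄`, so that z ↦ (z, σ z) is the diagonal of `N × N̄` in holomorphic
coordinates. -/
theorem exists_conjugation (E : Type*) [NormedAddCommGroup E] [NormedSpace ℂ E]
    [FiniteDimensional ℂ E] : Nonempty (Conjugation E) := by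
  let e : E ≃L[ℂ] (Fin (Module.finrank ℂ E) → ℂ) :=
    ContinuousLinearEquiv.ofFinrankEq (by simp)
  let er : E →L[ℝ] (Fin (Module.finrank ℂ E) → ℂ) :=
    ContinuousLinearMap.restrictScalars ℝ (e : E →L[ℂ] (Fin (Module.finrank ℂ E) → ℂ))
  let es : (Fin (Module.finrank ℂ E) → ℂ) →L[ℝ] E :=
    ContinuousLinearMap.restrictScalars ℝ (e.symm : (Fin (Module.finrank ℂ E) → ℂ) →L[ℂ] E)
  let c : (Fin (Module.finrank ℂ E) → ℂ) →L[ℝ] (Fin (Module.finrank ℂ E) → ℂ) :=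
    ContinuousLinearMap.pi fun i =>
      (Complex.conjCLE : ℂ →L[ℝ] ℂ).comp (ContinuousLinearMap.proj i)
  refine ⟨⟨es.comp (c.comp er), fun z => ?_, fun z => ?_⟩⟩
  · have h1 : c (er (Complex.I • z)) = -(Complex.I • c (er z)) := by
      ext i
      simp [c, er]
    have h2 : es (-(Complex.I • c (er z))) = -(Complex.I • es (c (er z))) := by
      change e.symm _ = -(Complex.I • e.symm _)
      rw [map_neg, map_smul]
    simpa [h1] using h2
  · have h1 : ∀ y, c (c y) = y := by
      intro y
      ext i
      simp [c]
    have h2 : ∀ y, er (es y) = y := fun y => e.apply_symm_apply y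
    have h3 : es (er z) = z := e.symm_apply_apply z
    simp [h1, h2, h3]

namespace Conjugation

variable {E : Type*} [NormedAddCommGroup E] [NormedSpace ℂ E] (σ : Conjugation E)
  {F : Type*} [NormedAddCommGroup F] [NormedSpace ℂ F]

/-- The totally real embedding `z ↦ (z, σ z)`. -/
def diag : E →L[ℝ] E × E := (ContinuousLinearMap.id ℝ E).prod σ.map

@[simp] theorem diag_fst (z : E) : (σ.diag z).1 = z := rfl

@[simp] theorem diag_snd (z : E) : (σ.diag z).2 = σ.map z := rfl

/-- The real part of a vector of `E × E` relative to `σ.diag`. -/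
def re : E × E →L[ℝ] E :=
  (1 / 2 : ℝ) • (ContinuousLinearMap.fst ℝ E E + σ.map.comp (ContinuousLinearMap.snd ℝ E E))

/-- The imaginary part of a vector of `E × E` relative to `σ.diag`. -/
def im : E × E →L[ℝ] E :=
  -σ.re.comp ((Complex.I • ContinuousLinearMap.id ℂ (E × E)).restrictScalars ℝ)

theorem re_apply (w : E × E) : σ.re w = (1 / 2 : ℝ) • (w.1 + σ.map w.2) := rfl

theorem im_apply (w : E × E) : σ.im w = -σ.re (Complex.I • w) := rfl

/-- The antilinear involution (z, w) ↦ (σ w, σ z) fixes exactly the image of `σ.diag`; this is the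
splitting into its +1 and -1 eigenspaces. -/
theorem diag_re_add_diag_im (w : E × E) :
    σ.diag (σ.re w) + Complex.I • σ.diag (σ.im w) = w := by
  have e : ∀ z : E, (1 / 2 : ℝ) • z = (1 / 2 : ℂ) • z := fun z => by
    rw [← Complex.coe_smul]; norm_num
  ext
  · simp only [im_apply, re_apply, e, Prod.fst_add, diag_fst, Prod.smul_fst, Prod.smul_snd, σ.map_I]
    match_scalars
    all_goals ring_nf
    all_goals norm_num
  · simp only [Prod.snd_add, diag_snd, Prod.smul_snd]
    simp only [im_apply, re_apply, Prod.smul_fst, Prod.smul_snd, σ.map_I, map_smul, map_add, map_neg, σ.map_map]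
    simp only [e]
    match_scalars
    all_goals ring_nf
    all_goals norm_num

theorem re_diag (z : E) : σ.re (σ.diag z) = z := by
  simp only [re_apply, diag_fst, diag_snd, σ.map_map, ← two_smul ℝ z, smul_smul]
  norm_num

theorem im_diag (z : E) : σ.im (σ.diag z) = 0 := by
  simp [im_apply, re_apply, σ.map_I, σ.map_map]

theorem re_I_smul (w : E × E) : σ.re (Complex.I • w) = -σ.im w := by
  rw [im_apply, neg_neg]

theorem im_I_smul (w : E × E) : σ.im (Complex.I • w) = σ.re w := by
  rw [im_apply, smul_smul, Complex.I_mul_I, neg_one_smul, map_neg, neg_neg]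

theorem continuousLinearMap_I {V W : Type*} [NormedAddCommGroup V] [NormedSpace ℂ V]
    [NormedAddCommGroup W] [NormedSpace ℂ W] (L : V →L[ℝ] W)
    (h : ∀ v, L (Complex.I • v) = Complex.I • L v) (c : ℂ) (v : V) : L (c • v) = c • L v := by
  have e : c • v = c.re • v + c.im • Complex.I • v := by
    conv_lhs => rw [← Complex.re_add_im c, add_smul, mul_smul, Complex.coe_smul, Complex.coe_smul]
  have e' : c • L v = c.re • L v + c.im • Complex.I • L v := by
    conv_lhs => rw [← Complex.re_add_im c, add_smul, mul_smul, Complex.coe_smul, Complex.coe_smul]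
  rw [e, e', map_add, map_smul, map_smul, h]

/-- A real-linear map commuting with `i` is complex-linear. -/
def _root_.ContinuousLinearMap.toComplex {V W : Type*} [NormedAddCommGroup V] [NormedSpace ℂ V]
    [NormedAddCommGroup W] [NormedSpace ℂ W] (L : V →L[ℝ] W)
    (h : ∀ v, L (Complex.I • v) = Complex.I • L v) : V →L[ℂ] W where
  toFun := L
  map_add' := L.map_add
  map_smul' := continuousLinearMap_I L h
  cont := L.continuous

/-- The complex-linear extension to `E × E` of a real-linear map on `E`. -/
def complexify (L : E →L[ℝ] F) : E × E →L[ℂ] F :=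
  (L.comp σ.re + ((Complex.I • ContinuousLinearMap.id ℂ F).restrictScalars ℝ).comp
    (L.comp σ.im)).toComplex (by
      intro w
      have : Complex.I • Complex.I • L (σ.im w) = - L (σ.im w) := by
        rw [smul_smul, Complex.I_mul_I, neg_one_smul]
      simp [re_I_smul, im_I_smul, this, add_comm])

theorem complexify_apply (L : E →L[ℝ] F) (w : E × E) :
    σ.complexify L w = L (σ.re w) + Complex.I • L (σ.im w) := rfl

@[simp] theorem complexify_diag (L : E →L[ℝ] F) (z : E) : σ.complexify L (σ.diag z) = L z := by
  simp [complexify_apply, re_diag, im_diag]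

theorem ext_diag {L L' : E × E →L[ℂ] F} (h : ∀ z, L (σ.diag z) = L' (σ.diag z)) (w : E × E) :
    L w = L' w := by
  rw [← σ.diag_re_add_diag_im w]
  simp [h]

/-- Uniqueness of holomorphic continuation from the totally real subspace `{(z, σ z)}`. -/
theorem eqOn_zero_of_diag [CompleteSpace F] {S : Set (E × E)} (z₀ : E) (hS : S ∈ 𝓝 (σ.diag z₀)) :
    ∃ S' ∈ 𝓝 (σ.diag z₀), S' ⊆ S ∧ ∀ h : E × E → F, (∀ q ∈ S, DifferentiableAt ℂ h q) →
      (∀ z, σ.diag z ∈ S → h (σ.diag z) = 0) → ∀ q ∈ S', h q = 0 := by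
  obtain ⟨R, hR, hRS⟩ := Metric.mem_nhds_iff.1 hS
  -- For q near the centre, the complex line ℓ below meets Δ at all real parameters and passes
  -- through q at t = i. The weight 2 keeps the disc |t| < 2, which contains i, inside the ball of
  -- radius R.
  have hcont : Continuous fun w : E × E => ‖σ.diag (σ.re w)‖ + 2 * ‖σ.diag (σ.im w)‖ := by fun_prop
  have hmem : {q : E × E | ‖σ.diag (σ.re (q - σ.diag z₀))‖ + 2 * ‖σ.diag (σ.im (q - σ.diag z₀))‖ < R}
      ∈ 𝓝 (σ.diag z₀) := by
    have hc : Continuous fun q : E × E =>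
        ‖σ.diag (σ.re (q - σ.diag z₀))‖ + 2 * ‖σ.diag (σ.im (q - σ.diag z₀))‖ :=
      hcont.comp (continuous_id.sub continuous_const)
    refine (isOpen_lt hc continuous_const).mem_nhds ?_
    simpa using hR
  -- The neighbourhood is fixed before `h`, so one neighbourhood serves all coefficients of a tensor
  -- simultaneously.
  refine ⟨_, Filter.inter_mem hmem hS, inter_subset_right, fun h hd h0 q hq => ?_⟩
  set w := q - σ.diag z₀ with hw
  let ℓ : ℂ → E × E := fun t => σ.diag z₀ + (σ.diag (σ.re w) + t • σ.diag (σ.im w))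
  have hℓ : ∀ t ∈ Metric.ball (0 : ℂ) 2, ℓ t ∈ S := by
    intro t ht
    apply hRS
    rw [mem_ball_iff_norm, add_sub_cancel_left]
    have ht' : ‖t‖ ≤ 2 := by simpa using (mem_ball_zero_iff.1 ht).le
    calc ‖σ.diag (σ.re w) + t • σ.diag (σ.im w)‖
        ≤ ‖σ.diag (σ.re w)‖ + ‖t‖ * ‖σ.diag (σ.im w)‖ := by
          rw [← norm_smul]; exact norm_add_le _ _
      _ ≤ ‖σ.diag (σ.re w)‖ + 2 * ‖σ.diag (σ.im w)‖ := by gcongr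
      _ < R := hq.1
  have hdiff : DifferentiableOn ℂ (h ∘ ℓ) (Metric.ball 0 2) := fun t ht =>
    ((hd _ (hℓ t ht)).comp t (by fun_prop)).differentiableWithinAt
  have hzero : EqOn (h ∘ ℓ) 0 (Metric.ball 0 2) := by
    refine (hdiff.analyticOnNhd Metric.isOpen_ball).eqOn_zero_of_preconnected_of_frequently_eq_zero
      (convex_ball _ _).isPreconnected (Metric.mem_ball_self two_pos) ?_
    have hreal : ∀ t : ℝ, |t| < 2 → (h ∘ ℓ) t = 0 := by
      intro t ht
      have e : ℓ t = σ.diag (z₀ + σ.re w + t • σ.im w) := by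
        simp only [ℓ, map_add, map_smul, Complex.coe_smul, add_assoc]
      have hm : ℓ t ∈ S := hℓ t (by simpa using ht)
      rw [Function.comp_apply, e]
      rw [e] at hm
      exact h0 _ hm
    -- Zeros at the real points 1/(n+1) accumulate at 0, which suffices for the one-variable
    -- identity theorem.
    have htend : Filter.Tendsto (fun n : ℕ => ((1 / ((n : ℝ) + 1) : ℝ) : ℂ)) Filter.atTop
        (𝓝[≠] (0 : ℂ)) := by
      refine tendsto_nhdsWithin_iff.2 ⟨?_, Filter.Eventually.of_forall fun n => ?_⟩
      · rw [← Complex.ofReal_zero]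
        exact (Complex.continuous_ofReal.tendsto _).comp tendsto_one_div_add_atTop_nhds_zero_nat
      · rw [mem_compl_singleton_iff, Complex.ofReal_ne_zero]; positivity
    refine htend.frequently (Filter.Frequently.of_forall fun n => hreal _ ?_)
    rw [abs_of_pos (by positivity), div_lt_iff₀ (by positivity)]
    have : (0 : ℝ) ≤ n := by positivity
    linarith
  have := hzero (x := Complex.I) (by simp)
  have e : ℓ Complex.I = q := by
    simp only [ℓ, σ.diag_re_add_diag_im]
    rw [hw]; abel
  simpa [e] using this

end Conjugation

end

/-! ### Holomorphic extension of real-analytic maps off the totally real subspace -/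

section

namespace Conjugation

variable {E : Type*} [NormedAddCommGroup E] [NormedSpace ℂ E] (σ : Conjugation E)
  {F : Type*} [NormedAddCommGroup F] [NormedSpace ℂ F]

/-- The complex-linear extensions to `E × E` of the real coordinates of a basis. -/
def coord [FiniteDimensional ℝ E] {ι : Type*} (b : Module.Basis ι ℝ E) (i : ι) : E × E →L[ℂ] ℂ :=
  σ.complexify (Complex.ofRealCLM.comp (LinearMap.toContinuousLinearMap (b.coord i)))

@[simp] theorem coord_diag [FiniteDimensional ℝ E] {ι : Type*} (b : Module.Basis ι ℝ E) (i : ι)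
    (z : E) : σ.coord b i (σ.diag z) = ((b.repr z i : ℝ) : ℂ) := by
  simp [coord]

/-- The complex-multilinear extension to `E × E` of a real multilinear map on `E`. -/
def extendMultilinear [FiniteDimensional ℝ E] {ι : Type*} [Fintype ι] (b : Module.Basis ι ℝ E)
    {n : ℕ} (p : E [×n]→L[ℝ] F) : (E × E) [×n]→L[ℂ] F :=
  ∑ s : Fin n → ι, ((ContinuousMultilinearMap.mkPiAlgebra ℂ (Fin n) ℂ).compContinuousLinearMap
    (fun k => σ.coord b (s k))).smulRight (p fun k => b (s k))

theorem extendMultilinear_apply [FiniteDimensional ℝ E] {ι : Type*} [Fintype ι]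
    (b : Module.Basis ι ℝ E) {n : ℕ} (p : E [×n]→L[ℝ] F) (w : Fin n → E × E) :
    σ.extendMultilinear b p w =
      ∑ s : Fin n → ι, (∏ k, σ.coord b (s k) (w k)) • p fun k => b (s k) := by
  simp [extendMultilinear]

/-- On Δ the forms `σ.coord b i` take the real values of the coordinates, so the defining sum is the
expansion of `p` in the basis. -/
theorem extendMultilinear_diag [FiniteDimensional ℝ E] {ι : Type*} [Fintype ι]
    (b : Module.Basis ι ℝ E) {n : ℕ} (p : E [×n]→L[ℝ] F) (z : Fin n → E) :
    σ.extendMultilinear b p (fun k => σ.diag (z k)) = p z := by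
  classical
  rw [extendMultilinear_apply]
  conv_rhs => rw [show z = fun k => ∑ i, b.repr (z k) i • b i from
    funext fun k => (b.sum_repr (z k)).symm]
  rw [ContinuousMultilinearMap.map_sum]
  refine Finset.sum_congr rfl fun s _ => ?_
  rw [ContinuousMultilinearMap.map_smul_univ]
  simp only [coord_diag]
  rw [← Complex.ofReal_prod, Complex.coe_smul]

/-- The loss is geometric in the degree, which is what keeps the radius of convergence positive.
Each slot contributes the number of basis vectors, a bound for the coordinate forms and a bound for
the basis vectors. -/
theorem norm_extendMultilinear_le [FiniteDimensional ℝ E] {ι : Type*} [Fintype ι]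
    (b : Module.Basis ι ℝ E) : ∃ C : ℝ, 0 ≤ C ∧ ∀ (n : ℕ) (p : E [×n]→L[ℝ] F),
      ‖σ.extendMultilinear b p‖ ≤ C ^ n * ‖p‖ := by
  set C := ∑ i, ‖σ.coord b i‖ with hC
  set D := ∑ i, ‖b i‖ with hD
  have hC0 : 0 ≤ C := Finset.sum_nonneg fun _ _ => norm_nonneg _
  have hD0 : 0 ≤ D := Finset.sum_nonneg fun _ _ => norm_nonneg _
  have hCi : ∀ i, ‖σ.coord b i‖ ≤ C := fun i =>
    Finset.single_le_sum (f := fun i => ‖σ.coord b i‖) (fun _ _ => norm_nonneg _) (Finset.mem_univ i)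
  have hDi : ∀ i, ‖b i‖ ≤ D := fun i =>
    Finset.single_le_sum (f := fun i => ‖b i‖) (fun _ _ => norm_nonneg _) (Finset.mem_univ i)
  refine ⟨Fintype.card ι * C * D, by positivity, fun n p => ?_⟩
  refine ContinuousMultilinearMap.opNorm_le_bound (by positivity) fun w => ?_
  rw [extendMultilinear_apply]
  calc ‖∑ s : Fin n → ι, (∏ k, σ.coord b (s k) (w k)) • p fun k => b (s k)‖
      ≤ ∑ s : Fin n → ι, ‖(∏ k, σ.coord b (s k) (w k)) • p fun k => b (s k)‖ := norm_sum_le _ _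
    _ ≤ ∑ _s : Fin n → ι, (∏ k, C * ‖w k‖) * (‖p‖ * ∏ _k : Fin n, D) := by
        refine Finset.sum_le_sum fun s _ => ?_
        rw [norm_smul, norm_prod]
        gcongr with k _
        · exact (ContinuousLinearMap.le_opNorm _ _).trans (by gcongr; exact hCi _)
        · exact (p.le_opNorm _).trans (by gcongr; exact hDi _)
    _ = (Fintype.card ι * C * D) ^ n * ‖p‖ * ∏ k, ‖w k‖ := by
        simp [Finset.prod_mul_distrib, mul_pow]
        ring

/-- Real-analytic functions extend holomorphically from the totally real subspace. -/
theorem exists_holomorphic_extension [FiniteDimensional ℂ E] [CompleteSpace F] {h : E → F} {z₀ : E}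
    (hh : AnalyticAt ℝ h z₀) :
    ∃ H : E × E → F, AnalyticAt ℂ H (σ.diag z₀) ∧ ∀ᶠ z in 𝓝 z₀, H (σ.diag z) = h z := by
  have : FiniteDimensional ℝ E := FiniteDimensional.complexToReal E
  let b := Module.finBasis ℝ E
  obtain ⟨p, r, hp⟩ := hh
  let P : FormalMultilinearSeries ℂ (E × E) F := fun n => σ.extendMultilinear b (p n)
  obtain ⟨C, hC, hCb⟩ := σ.norm_extendMultilinear_le (F := F) b
  obtain ⟨A, a, hA, ha, hAa⟩ := p.le_mul_pow_of_radius_pos (hp.r_pos.trans_le hp.r_le)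
  have hrad : 0 < P.radius := by
    -- Any positive radius ρ with C a ρ ≤ 1 would do; adding 1 covers the case C a = 0.
    let ρ : NNReal := ⟨1 / (C * a + 1), by positivity⟩
    have hρ : (0 : ENNReal) < ρ := by
      rw [ENNReal.coe_pos]
      exact (show (0 : ℝ) < 1 / (C * a + 1) by positivity)
    refine hρ.trans_le (P.le_radius_of_bound A fun n => ?_)
    calc ‖P n‖ * (1 / (C * a + 1)) ^ n ≤ (C ^ n * (A * a ^ n)) * (1 / (C * a + 1)) ^ n := by
          gcongr
          exact (hCb n _).trans (by gcongr; exact hAa n)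
      _ = A * (C * a / (C * a + 1)) ^ n := by rw [div_pow, div_pow, mul_pow, one_pow]; ring
      _ ≤ A * 1 := by
          gcongr
          refine pow_le_one₀ (by positivity) ?_
          rw [div_le_one (by positivity)]
          linarith
      _ = A := mul_one A
  refine ⟨fun w => P.sum (w - σ.diag z₀), ?_, ?_⟩
  · have h0 : AnalyticAt ℂ P.sum (σ.diag z₀ - σ.diag z₀) := by
      rw [sub_self]
      exact (P.hasFPowerSeriesOnBall hrad).analyticAt
    exact AnalyticAt.fun_comp h0 (by fun_prop)
  -- The two series agree term by term on Δ, so their sums agree wherever the series of `h`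
  -- represents it.
  · filter_upwards [Metric.eball_mem_nhds z₀ hp.r_pos] with z hz
    have hz' : z - z₀ ∈ Metric.eball (0 : E) r := by
      rw [Metric.mem_eball, edist_zero_right, ← edist_eq_enorm_sub]
      exact hz
    have := hp.sum hz'
    rw [add_sub_cancel] at this
    rw [this, ← map_sub]
    exact tsum_congr fun n => σ.extendMultilinear_diag b (p n) fun _ => z - z₀

end Conjugation

end

section

/-! ### Gluing germs along a subset -/

/-- Local sections around the points of the range of `f` whose germs agree along this range glue
to a section having the same germs. -/
theorem exists_glue_germs {X ι : Type*} [TopologicalSpace X] [SecondCountableTopology X]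
    [RegularSpace X] {Y : X → Type*} [∀ x, Inhabited (Y x)] (f : ι → X) (s : ι → ∀ x, Y x)
    (W : ι → Set X) (hW : ∀ i, W i ∈ 𝓝 (f i))
    (h : ∀ i k, f k ∈ W i → ∀ᶠ x in 𝓝 (f k), s i x = s k x) :
    ∃ t : ∀ x, Y x, ∀ i, ∀ᶠ x in 𝓝 (f i), t x = s i x := by
  classical
  rcases isEmpty_or_nonempty ι with hι | hι
  · exact ⟨fun _ => default, fun i => isEmptyElim i⟩
  choose C hC hCc hCW using fun i => exists_mem_nhds_isClosed_subset (hW i)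
  obtain ⟨T, hT, hTU⟩ := TopologicalSpace.isOpen_iUnion_countable (fun i => interior (C i))
    fun i => isOpen_interior
  have hmem : ∀ i, ∃ j ∈ T, f i ∈ interior (C j) := fun i => by
    have : f i ∈ ⋃ i, interior (C i) := mem_iUnion.2 ⟨i, mem_interior_iff_mem_nhds.2 (hC i)⟩
    rw [← hTU] at this
    simpa using this
  obtain ⟨e, he⟩ := hT.exists_eq_range ⟨_, (hmem hι.some).choose_spec.1⟩
  have hmem' : ∀ i, ∃ n, f i ∈ interior (C (e n)) := fun i => by
    obtain ⟨j, hj, hij⟩ := hmem i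
    rw [he] at hj
    obtain ⟨n, rfl⟩ := hj
    exact ⟨n, hij⟩
  -- At x the section of least index whose closed set contains x is used. Near `f i` only the
  -- finitely many indices up to `n₀` compete: a closed set missing `f i` is avoided nearby, and any
  -- other one carries a section with the same germ as `s i`.
  refine ⟨fun x => if hx : ∃ n, x ∈ C (e n) then s (e (Nat.find hx)) x else default, fun i => ?_⟩
  obtain ⟨n₀, hn₀⟩ := hmem' i
  have h1 : ∀ k ∈ Finset.range (n₀ + 1), ∀ᶠ x in 𝓝 (f i), x ∈ C (e k) → s (e k) x = s i x := by
    intro k _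
    by_cases hk : f i ∈ C (e k)
    · exact (h _ _ (hCW _ hk)).mono fun x hx _ => hx
    · filter_upwards [(hCc (e k)).isOpen_compl.mem_nhds hk] with x hx hx'
      exact absurd hx' hx
  filter_upwards [(Finset.eventually_all _).2 h1, isOpen_interior.mem_nhds hn₀] with x hx hx0
  have hx' : ∃ n, x ∈ C (e n) := ⟨n₀, interior_subset hx0⟩
  rw [dif_pos hx']
  exact hx _ (Finset.mem_range_succ_iff.2 (Nat.find_min' hx' (interior_subset hx0)))
    (Nat.find_spec hx')

end

section

/-! ### Restriction of scalars on manifolds -/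

section RestrictScalars

variable {E : Type*} [NormedAddCommGroup E] [NormedSpace ℂ E]
  {M : Type*} [TopologicalSpace M] [ChartedSpace E M]
  {E' : Type*} [NormedAddCommGroup E'] [NormedSpace ℂ E']
  {M' : Type*} [TopologicalSpace M'] [ChartedSpace E' M']

theorem HasMFDerivAt.restrictScalars_real {f : M → M'} {x : M} {L : E →L[ℂ] E'}
    (h : HasMFDerivAt 𝓘(ℂ, E) 𝓘(ℂ, E') f x L) :
    HasMFDerivAt 𝓘(ℝ, E) 𝓘(ℝ, E') f x (L.restrictScalars ℝ) :=
  ⟨h.1, h.2.restrictScalars ℝ⟩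

/-- The Cauchy–Riemann criterion: through it the pointwise conditions on the differential of φ
become holomorphy of its coordinate expression. -/
theorem HasMFDerivAt.of_real {f : M → M'} {x : M} {L : E →L[ℂ] E'}
    (h : HasMFDerivAt 𝓘(ℝ, E) 𝓘(ℝ, E') f x (L.restrictScalars ℝ)) :
    HasMFDerivAt 𝓘(ℂ, E) 𝓘(ℂ, E') f x L :=
  ⟨h.1, HasFDerivWithinAt.of_restrictScalars ℝ h.2 rfl⟩

theorem MDifferentiableAt.restrictScalars_real {f : M → M'} {x : M}
    (h : MDifferentiableAt 𝓘(ℂ, E) 𝓘(ℂ, E') f x) : MDifferentiableAt 𝓘(ℝ, E) 𝓘(ℝ, E') f x :=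
  (HasMFDerivAt.restrictScalars_real h.hasMFDerivAt).mdifferentiableAt

theorem mfderiv_real_apply {f : M → M'} {x : M}
    (h : MDifferentiableAt 𝓘(ℂ, E) 𝓘(ℂ, E') f x) (u : TangentSpace 𝓘(ℝ, E) x) :
    (mfderiv 𝓘(ℝ, E) 𝓘(ℝ, E') f x u : E') = mfderiv 𝓘(ℂ, E) 𝓘(ℂ, E') f x (toHol u) := by
  rw [(HasMFDerivAt.restrictScalars_real h.hasMFDerivAt).mfderiv]
  rfl

theorem ContMDiffAt.restrictScalars_real {n : ℕ∞ω} {f : M → M'} {x : M}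
    (h : ContMDiffAt 𝓘(ℂ, E) 𝓘(ℂ, E') n f x) : ContMDiffAt 𝓘(ℝ, E) 𝓘(ℝ, E') n f x :=
  ⟨h.1, ContDiffWithinAt.restrict_scalars ℝ h.2⟩

theorem ContMDiffOn.restrictScalars_real {n : ℕ∞ω} {f : M → M'} {s : Set M}
    (h : ContMDiffOn 𝓘(ℂ, E) 𝓘(ℂ, E') n f s) : ContMDiffOn 𝓘(ℝ, E) 𝓘(ℝ, E') n f s :=
  fun x hx => ⟨(h x hx).1, ContDiffWithinAt.restrict_scalars ℝ (h x hx).2⟩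

end RestrictScalars

/-! ### Charts with values in a normed space -/

section ModelChart

variable (𝕜 : Type*) [RCLike 𝕜] {E : Type*} [NormedAddCommGroup E] [NormedSpace 𝕜 E]
  {M : Type*} [TopologicalSpace M] [ChartedSpace E M]
  {W : Type*} [NormedAddCommGroup W] [NormedSpace 𝕜 W]

/-- `Ψ` is an analytic diffeomorphism of an open subset of `M` onto an open subset of the normed
space `W`. -/
structure IsModelChart (Ψ : OpenPartialHomeomorph M W) : Prop where
  contMDiffOn : ContMDiffOn 𝓘(𝕜, E) 𝓘(𝕜, W) ω Ψ Ψ.source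
  contMDiffOn_symm : ContMDiffOn 𝓘(𝕜, W) 𝓘(𝕜, E) ω Ψ.symm Ψ.target

/-- The differential of a chart at the point with coordinates `q`. -/
def chartD (Ψ : OpenPartialHomeomorph M W) (q : W) : TangentSpace 𝓘(𝕜, E) (Ψ.symm q) →L[𝕜] W :=
  mvfderiv 𝓘(𝕜, E) Ψ (Ψ.symm q)

/-- The differential of the inverse of a chart at the point with coordinates `q`. -/
def chartDInv (Ψ : OpenPartialHomeomorph M W) (q : W) :
    W →L[𝕜] TangentSpace 𝓘(𝕜, E) (Ψ.symm q) :=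
  (mfderiv 𝓘(𝕜, W) 𝓘(𝕜, E) Ψ.symm q).comp
    (NormedSpace.fromTangentSpace (𝕜 := 𝕜) q).symm.toContinuousLinearMap

/-- The expression of a vector field in a chart. -/
def VecField.inChart (Ψ : OpenPartialHomeomorph M W) (X : VecField 𝕜 E M) (q : W) : W :=
  chartD 𝕜 Ψ q (X (Ψ.symm q))

variable {𝕜} {Ψ : OpenPartialHomeomorph M W}

namespace IsModelChart

variable (hΨ : IsModelChart 𝕜 (E := E) Ψ) {q : W} (hq : q ∈ Ψ.target)
include hΨ hq

theorem contMDiffAt : ContMDiffAt 𝓘(𝕜, E) 𝓘(𝕜, W) ω Ψ (Ψ.symm q) :=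
  hΨ.contMDiffOn.contMDiffAt (Ψ.open_source.mem_nhds (Ψ.map_target hq))

theorem contMDiffAt_symm : ContMDiffAt 𝓘(𝕜, W) 𝓘(𝕜, E) ω Ψ.symm q :=
  hΨ.contMDiffOn_symm.contMDiffAt (Ψ.open_target.mem_nhds hq)

theorem mdifferentiableAt : MDifferentiableAt 𝓘(𝕜, E) 𝓘(𝕜, W) Ψ (Ψ.symm q) :=
  (hΨ.contMDiffAt hq).mdifferentiableAt (by simp)

theorem mdifferentiableAt_symm : MDifferentiableAt 𝓘(𝕜, W) 𝓘(𝕜, E) Ψ.symm q :=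
  (hΨ.contMDiffAt_symm hq).mdifferentiableAt (by simp)

theorem eventually_right_inv : ∀ᶠ q' in 𝓝 q, Ψ (Ψ.symm q') = q' :=
  Filter.eventually_of_mem (Ψ.open_target.mem_nhds hq) fun _ h => Ψ.right_inv h

theorem eventually_left_inv : ∀ᶠ y in 𝓝 (Ψ.symm q), Ψ.symm (Ψ y) = y :=
  Filter.eventually_of_mem (Ψ.open_source.mem_nhds (Ψ.map_target hq)) fun _ h => Ψ.left_inv h

theorem mfderiv_comp_mfderiv_symm :
    (mfderiv 𝓘(𝕜, E) 𝓘(𝕜, W) Ψ (Ψ.symm q)).comp (mfderiv 𝓘(𝕜, W) 𝓘(𝕜, E) Ψ.symm q) =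
      ContinuousLinearMap.id 𝕜 (TangentSpace 𝓘(𝕜, W) q) := by
  have h1 : HasMFDerivAt 𝓘(𝕜, W) 𝓘(𝕜, W) (Ψ ∘ Ψ.symm) q _ :=
    (hΨ.mdifferentiableAt hq).hasMFDerivAt.comp q (hΨ.mdifferentiableAt_symm hq).hasMFDerivAt
  have h2 : HasMFDerivAt 𝓘(𝕜, W) 𝓘(𝕜, W) (Ψ ∘ Ψ.symm) q
      (ContinuousLinearMap.id 𝕜 (TangentSpace 𝓘(𝕜, W) q)) :=
    (hasMFDerivAt_id q).congr_of_eventuallyEq (hΨ.eventually_right_inv hq)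
  exact hasMFDerivAt_unique h1 h2

/-- Stated between the model spaces, because the maps compose only after identifying the tangent
spaces at `Ψ (Ψ.symm q)` and at `q`. -/
theorem mfderiv_symm_comp_mfderiv :
    (mfderiv 𝓘(𝕜, W) 𝓘(𝕜, E) Ψ.symm q : W →L[𝕜] E).comp
      (mfderiv 𝓘(𝕜, E) 𝓘(𝕜, W) Ψ (Ψ.symm q) : E →L[𝕜] W) = ContinuousLinearMap.id 𝕜 E := by
  have hs : MDifferentiableAt 𝓘(𝕜, W) 𝓘(𝕜, E) Ψ.symm (Ψ (Ψ.symm q)) := by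
    rw [Ψ.right_inv hq]; exact hΨ.mdifferentiableAt_symm hq
  have h1 : HasMFDerivAt 𝓘(𝕜, E) 𝓘(𝕜, E) (Ψ.symm ∘ Ψ) (Ψ.symm q) _ :=
    hs.hasMFDerivAt.comp (Ψ.symm q) (hΨ.mdifferentiableAt hq).hasMFDerivAt
  have h2 : HasMFDerivAt 𝓘(𝕜, E) 𝓘(𝕜, E) (Ψ.symm ∘ Ψ) (Ψ.symm q)
      (ContinuousLinearMap.id 𝕜 (TangentSpace 𝓘(𝕜, E) (Ψ.symm q))) :=
    (hasMFDerivAt_id _).congr_of_eventuallyEq (hΨ.eventually_left_inv hq)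
  have h3 := hasMFDerivAt_unique h1 h2
  have e : (mfderiv 𝓘(𝕜, W) 𝓘(𝕜, E) Ψ.symm (Ψ (Ψ.symm q)) : W →L[𝕜] E) =
      mfderiv 𝓘(𝕜, W) 𝓘(𝕜, E) Ψ.symm q := by rw [Ψ.right_inv hq]
  rw [← e]
  exact h3

theorem chartD_chartDInv (w : W) : chartD 𝕜 Ψ q (chartDInv 𝕜 (E := E) Ψ q w) = w :=
  DFunLike.congr_fun (hΨ.mfderiv_comp_mfderiv_symm hq) w

theorem chartDInv_chartD (u : TangentSpace 𝓘(𝕜, E) (Ψ.symm q)) :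
    chartDInv 𝕜 Ψ q (chartD 𝕜 Ψ q u) = u :=
  DFunLike.congr_fun (hΨ.mfderiv_symm_comp_mfderiv hq) u

end IsModelChart
end ModelChart

end

/-! ### Vector fields, brackets and derivatives in a chart -/

section

theorem mlieBracket_modelSpace {𝕜 W : Type*} [NontriviallyNormedField 𝕜] [NormedAddCommGroup W]
    [NormedSpace 𝕜 W] (X Y : ∀ q : W, TangentSpace 𝓘(𝕜, W) q)
    (q : W) : mlieBracket 𝓘(𝕜, W) X Y q = lieBracket 𝕜 X Y q := by
  rw [← mlieBracketWithin_univ, mlieBracketWithin_eq_lieBracketWithin]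
  exact congrFun lieBracketWithin_univ q

section ModelChart

variable {𝕜 : Type*} [RCLike 𝕜] {E : Type*} [NormedAddCommGroup E] [NormedSpace 𝕜 E]
  {M : Type*} [TopologicalSpace M] [ChartedSpace E M] [IsManifold 𝓘(𝕜, E) ω M]
  {W : Type*} [NormedAddCommGroup W] [NormedSpace 𝕜 W] {Ψ : OpenPartialHomeomorph M W}

namespace IsModelChart

variable (hΨ : IsModelChart 𝕜 (E := E) Ψ)
include hΨ

theorem contMDiffOn_mvfderiv :
    ContMDiffOn (𝓘(𝕜, E).prod 𝓘(𝕜, E)) 𝓘(𝕜, W) ω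
      (fun p : TangentBundle 𝓘(𝕜, E) M => mvfderiv 𝓘(𝕜, E) Ψ p.1 p.2)
      (π E (TangentSpace 𝓘(𝕜, E)) ⁻¹' Ψ.source) := by
  have h1 := hΨ.contMDiffOn.contMDiffOn_tangentMapWithin (m := ω) (by simp)
    Ψ.open_source.uniqueMDiffOn
  have h2 := (contMDiff_snd_tangentBundle_modelSpace (n := ω) W 𝓘(𝕜, W)).comp_contMDiffOn h1
  refine h2.congr fun p hp => ?_
  have : mfderivWithin 𝓘(𝕜, E) 𝓘(𝕜, W) Ψ Ψ.source p.1 = mfderiv 𝓘(𝕜, E) 𝓘(𝕜, W) Ψ p.1 :=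
    mfderivWithin_of_mem_nhds (Ψ.open_source.mem_nhds hp)
  change _ = mfderivWithin 𝓘(𝕜, E) 𝓘(𝕜, W) Ψ Ψ.source p.1 p.2
  rw [this]
  rfl

theorem contMDiffOn_mfderiv_symm :
    ContMDiffOn (𝓘(𝕜, W).prod 𝓘(𝕜, W)) (𝓘(𝕜, E).prod 𝓘(𝕜, E)) ω
      (fun p : TangentBundle 𝓘(𝕜, W) W =>
        (TotalSpace.mk' E (Ψ.symm p.1) (chartDInv 𝕜 Ψ p.1 p.2) : TangentBundle 𝓘(𝕜, E) M))
      (π W (TangentSpace 𝓘(𝕜, W)) ⁻¹' Ψ.target) := by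
  have h1 := hΨ.contMDiffOn_symm.contMDiffOn_tangentMapWithin (m := ω) (by simp)
    Ψ.open_target.uniqueMDiffOn
  refine h1.congr fun p hp => ?_
  have : mfderivWithin 𝓘(𝕜, W) 𝓘(𝕜, E) Ψ.symm Ψ.target p.1 =
      mfderiv 𝓘(𝕜, W) 𝓘(𝕜, E) Ψ.symm p.1 :=
    mfderivWithin_of_mem_nhds (Ψ.open_target.mem_nhds hp)
  change _ = (TotalSpace.mk' E (Ψ.symm p.1)
    (mfderivWithin 𝓘(𝕜, W) 𝓘(𝕜, E) Ψ.symm Ψ.target p.1 p.2) : TangentBundle 𝓘(𝕜, E) M)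
  rw [this]
  rfl

variable {q : W} (hq : q ∈ Ψ.target)
include hq

theorem contMDiffAt_mvfderiv (v : TangentSpace 𝓘(𝕜, E) (Ψ.symm q)) :
    ContMDiffAt (𝓘(𝕜, E).prod 𝓘(𝕜, E)) 𝓘(𝕜, W) ω
      (fun p : TangentBundle 𝓘(𝕜, E) M => mvfderiv 𝓘(𝕜, E) Ψ p.1 p.2)
      (TotalSpace.mk' E (Ψ.symm q) v) :=
  hΨ.contMDiffOn_mvfderiv.contMDiffAt
    ((Ψ.open_source.preimage (FiberBundle.continuous_proj _ _)).mem_nhds (Ψ.map_target hq))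

theorem contMDiffAt_mfderiv_symm (w : W) :
    ContMDiffAt (𝓘(𝕜, W).prod 𝓘(𝕜, W)) (𝓘(𝕜, E).prod 𝓘(𝕜, E)) ω
      (fun p : TangentBundle 𝓘(𝕜, W) W =>
        (TotalSpace.mk' E (Ψ.symm p.1) (chartDInv 𝕜 Ψ p.1 p.2) : TangentBundle 𝓘(𝕜, E) M))
      (TotalSpace.mk' W q w) :=
  hΨ.contMDiffOn_mfderiv_symm.contMDiffAt
    ((Ψ.open_target.preimage (FiberBundle.continuous_proj _ _)).mem_nhds hq)

/-- Vector fields along the chart that are analytic in coordinates. -/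
theorem contMDiffAt_chartDInv {w : W → W} (hw : ContDiffAt 𝕜 ω w q) :
    ContMDiffAt 𝓘(𝕜, W) (𝓘(𝕜, E).prod 𝓘(𝕜, E)) ω
      (fun y => (TotalSpace.mk' E (Ψ.symm y) (chartDInv 𝕜 Ψ y (w y)) :
        TangentBundle 𝓘(𝕜, E) M)) q :=
  ContMDiffAt.comp (g := fun p : TangentBundle 𝓘(𝕜, W) W =>
      (TotalSpace.mk' E (Ψ.symm p.1) (chartDInv 𝕜 Ψ p.1 p.2) : TangentBundle 𝓘(𝕜, E) M))
    (f := fun y => (TotalSpace.mk' W y (w y) : TangentBundle 𝓘(𝕜, W) W)) q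
    (hΨ.contMDiffAt_mfderiv_symm hq (w q))
    ((contMDiffAt_vectorSpace_iff_contDiffAt (V := w)).2 hw)

theorem mdifferentiableAt_chartDInv {w : W → W} (hw : DifferentiableAt 𝕜 w q) :
    MDifferentiableAt 𝓘(𝕜, W) (𝓘(𝕜, E).prod 𝓘(𝕜, E))
      (fun y => (TotalSpace.mk' E (Ψ.symm y) (chartDInv 𝕜 Ψ y (w y)) :
        TangentBundle 𝓘(𝕜, E) M)) q := by
  have h1 : MDifferentiableAt 𝓘(𝕜, W) (𝓘(𝕜, W).prod 𝓘(𝕜, W))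
      (fun y => (TotalSpace.mk' W y (w y) : TangentBundle 𝓘(𝕜, W) W)) q := by
    rw [mdifferentiableAt_totalSpace]
    refine ⟨mdifferentiableAt_id, ?_⟩
    convert! hw.mdifferentiableAt with y
    simp
  exact MDifferentiableAt.comp (g := fun p : TangentBundle 𝓘(𝕜, W) W =>
      (TotalSpace.mk' E (Ψ.symm p.1) (chartDInv 𝕜 Ψ p.1 p.2) : TangentBundle 𝓘(𝕜, E) M)) q
    ((hΨ.contMDiffAt_mfderiv_symm hq (w q)).mdifferentiableAt (by simp)) h1

theorem differentiableAt_inChart {X : VecField 𝕜 E M} (hX : X.DiffAt (Ψ.symm q)) :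
    DifferentiableAt 𝕜 (X.inChart 𝕜 Ψ) q := by
  rw [← mdifferentiableAt_iff_differentiableAt]
  have h1 : MDifferentiableAt 𝓘(𝕜, W) (𝓘(𝕜, E).prod 𝓘(𝕜, E))
      (fun y => (TotalSpace.mk' E (Ψ.symm y) (X (Ψ.symm y)) : TangentBundle 𝓘(𝕜, E) M)) q :=
    MDifferentiableAt.comp (g := fun y => (TotalSpace.mk' E y (X y) : TangentBundle 𝓘(𝕜, E) M)) q
      hX (hΨ.mdifferentiableAt_symm hq)
  have h2 := (hΨ.contMDiffAt_mvfderiv hq (X (Ψ.symm q))).mdifferentiableAt (by simp)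
  exact MDifferentiableAt.comp
    (f := fun y => (TotalSpace.mk' E (Ψ.symm y) (X (Ψ.symm y)) : TangentBundle 𝓘(𝕜, E) M))
    (g := fun p : TangentBundle 𝓘(𝕜, E) M => mvfderiv 𝓘(𝕜, E) Ψ p.1 p.2) q h2 h1

theorem eventually_chartDInv_inChart (X : VecField 𝕜 E M) :
    ∀ᶠ y in 𝓝 (Ψ.symm q), (TotalSpace.mk' E y (X y) : TangentBundle 𝓘(𝕜, E) M) =
      TotalSpace.mk' E (Ψ.symm (Ψ y)) (chartDInv 𝕜 Ψ (Ψ y) (X.inChart 𝕜 Ψ (Ψ y))) := by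
  filter_upwards [Ψ.open_source.mem_nhds (Ψ.map_target hq)] with y hy
  rw [VecField.inChart, hΨ.chartDInv_chartD (Ψ.map_source hy), Ψ.left_inv hy]

theorem diffAt_of_inChart {X : VecField 𝕜 E M} (hX : DifferentiableAt 𝕜 (X.inChart 𝕜 Ψ) q) :
    X.DiffAt (Ψ.symm q) := by
  have h1 := hΨ.mdifferentiableAt_chartDInv hq hX
  rw [← Ψ.right_inv hq] at h1
  exact (MDifferentiableAt.comp (Ψ.symm q) h1 (hΨ.mdifferentiableAt hq)).congr_of_eventuallyEq
    (hΨ.eventually_chartDInv_inChart hq X)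

theorem inverse_mfderiv_symm :
    (mfderiv 𝓘(𝕜, W) 𝓘(𝕜, E) Ψ.symm q).inverse = mfderiv 𝓘(𝕜, E) 𝓘(𝕜, W) Ψ (Ψ.symm q) :=
  ContinuousLinearMap.inverse_eq (hΨ.mfderiv_symm_comp_mfderiv hq) (hΨ.mfderiv_comp_mfderiv_symm hq)

theorem mpullback_symm_eventuallyEq (X : VecField 𝕜 E M) :
    mpullback 𝓘(𝕜, W) 𝓘(𝕜, E) Ψ.symm X =ᶠ[𝓝 q] X.inChart 𝕜 Ψ := by
  filter_upwards [Ψ.open_target.mem_nhds hq] with y hy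
  rw [mpullback_apply, hΨ.inverse_mfderiv_symm hy]
  rfl

/-- Brackets are natural under pullback by `Ψ.symm`, and on a vector space the bracket is the
commutator of derivatives. -/
theorem chartD_mlieBracket [CompleteSpace E] [CompleteSpace W] {X Y : VecField 𝕜 E M}
    (hX : X.DiffAt (Ψ.symm q)) (hY : Y.DiffAt (Ψ.symm q)) :
    chartD 𝕜 Ψ q (mlieBracket 𝓘(𝕜, E) X Y (Ψ.symm q)) =
      fderiv 𝕜 (Y.inChart 𝕜 Ψ) q (X.inChart 𝕜 Ψ q) -
        fderiv 𝕜 (X.inChart 𝕜 Ψ) q (Y.inChart 𝕜 Ψ q) := by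
  have : IsManifold 𝓘(𝕜, E) (minSmoothness 𝕜 2) M := IsManifold.of_le (n := ω) (by simp)
  have h1 := mpullback_mlieBracket (I := 𝓘(𝕜, W)) (I' := 𝓘(𝕜, E)) (n := ω) hX hY
    (hΨ.contMDiffAt_symm hq) (by simp)
  rw [mpullback_apply, hΨ.inverse_mfderiv_symm hq,
    (hΨ.mpullback_symm_eventuallyEq hq X).mlieBracket_vectorField_eq
      (hΨ.mpullback_symm_eventuallyEq hq Y)] at h1
  exact h1.trans (mlieBracket_modelSpace _ _ q)

theorem mvfderiv_apply {F : Type*} [NormedAddCommGroup F] [NormedSpace 𝕜 F] {h : M → F}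
    (hh : DifferentiableAt 𝕜 (h ∘ Ψ.symm) q) (v : TangentSpace 𝓘(𝕜, E) (Ψ.symm q)) :
    mvfderiv 𝓘(𝕜, E) h (Ψ.symm q) v = fderiv 𝕜 (h ∘ Ψ.symm) q (chartD 𝕜 Ψ q v) := by
  have h0 : HasMFDerivAt 𝓘(𝕜, W) 𝓘(𝕜, F) (h ∘ Ψ.symm) (Ψ (Ψ.symm q))
      (fderiv 𝕜 (h ∘ Ψ.symm) q) := by
    rw [Ψ.right_inv hq]
    exact hh.hasFDerivAt.hasMFDerivAt
  have h1 : HasMFDerivAt 𝓘(𝕜, E) 𝓘(𝕜, F) h (Ψ.symm q) _ :=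
    (h0.comp (Ψ.symm q) (hΨ.mdifferentiableAt hq).hasMFDerivAt).congr_of_eventuallyEq
      ((hΨ.eventually_left_inv hq).mono fun y hy => by simp [hy])
  rw [mvfderiv, h1.mfderiv]
  rfl

end IsModelChart
end ModelChart

end

/-! ### Analyticity of tensor fields in terms of their coefficients -/

section

/-- On a finite-dimensional source a linear map amounts to its values on a basis. -/
theorem contMDiffAt_clm_of_apply {𝕜 D B E F : Type*} [NontriviallyNormedField 𝕜]
    [CompleteSpace 𝕜] [NormedAddCommGroup D] [NormedSpace 𝕜 D] [TopologicalSpace B]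
    [ChartedSpace D B] [NormedAddCommGroup E] [NormedSpace 𝕜 E]
    [FiniteDimensional 𝕜 E] [NormedAddCommGroup F] [NormedSpace 𝕜 F] {n : ℕ∞ω}
    {f : B → E →L[𝕜] F} {x : B} (h : ∀ y, ContMDiffAt 𝓘(𝕜, D) 𝓘(𝕜, F) n (fun x => f x y) x) :
    ContMDiffAt 𝓘(𝕜, D) 𝓘(𝕜, E →L[𝕜] F) n f x := by
  let d := Module.finrank 𝕜 E
  have hd : d = Module.finrank 𝕜 (Fin d → 𝕜) := (Module.finrank_fin_fun 𝕜).symm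
  let e₁ := ContinuousLinearEquiv.ofFinrankEq hd
  let e₂ := (e₁.arrowCongr (1 : F ≃L[𝕜] F)).trans (ContinuousLinearEquiv.piRing (Fin d))
  rw [← Function.id_comp f, ← e₂.symm_comp_self]
  exact e₂.symm.contDiff.contMDiff.contMDiffAt.comp x (contMDiffAt_pi_space.mpr fun i => h _)

theorem contDiffAt_clm_of_apply {𝕜 D E F : Type*} [NontriviallyNormedField 𝕜] [CompleteSpace 𝕜]
    [NormedAddCommGroup D] [NormedSpace 𝕜 D] [NormedAddCommGroup E] [NormedSpace 𝕜 E]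
    [FiniteDimensional 𝕜 E] [NormedAddCommGroup F] [NormedSpace 𝕜 F] {n : ℕ∞ω}
    {f : D → E →L[𝕜] F} {x : D} (h : ∀ y, ContDiffAt 𝕜 n (fun x => f x y) x) :
    ContDiffAt 𝕜 n f x :=
  contMDiffAt_iff_contDiffAt.1 (contMDiffAt_clm_of_apply fun y => contMDiffAt_iff_contDiffAt.2 (h y))

section HomBundle

variable {𝕜 B F₁ F₂ : Type*} [NontriviallyNormedField 𝕜] [CompleteSpace 𝕜] {n : ℕ∞ω}
  {E₁ : B → Type*} {E₂ : B → Type*}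
  [∀ x, AddCommGroup (E₁ x)] [∀ x, Module 𝕜 (E₁ x)] [NormedAddCommGroup F₁] [NormedSpace 𝕜 F₁]
  [TopologicalSpace (TotalSpace F₁ E₁)] [∀ x, TopologicalSpace (E₁ x)] [∀ x, AddCommGroup (E₂ x)]
  [∀ x, Module 𝕜 (E₂ x)] [NormedAddCommGroup F₂] [NormedSpace 𝕜 F₂]
  [TopologicalSpace (TotalSpace F₂ E₂)] [∀ x, TopologicalSpace (E₂ x)]
  {EB : Type*}
  [NormedAddCommGroup EB] [NormedSpace 𝕜 EB] [TopologicalSpace B] [ChartedSpace EB B]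
  [FiberBundle F₁ E₁] [VectorBundle 𝕜 F₁ E₁]
  [FiberBundle F₂ E₂] [VectorBundle 𝕜 F₂ E₂]
  [∀ x, IsTopologicalAddGroup (E₂ x)] [∀ x, ContinuousSMul 𝕜 (E₂ x)]
  [∀ x, IsTopologicalAddGroup (E₁ x)] [∀ x, ContinuousSMul 𝕜 (E₁ x)]
  [ContMDiffVectorBundle n F₁ E₁ 𝓘(𝕜, EB)]

/-- A field of linear maps is smooth at a point if it maps smooth sections to smooth sections. -/
theorem contMDiffAt_hom_of_apply [FiniteDimensional 𝕜 F₁]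
    {φ : ∀ x, E₁ x →L[𝕜] E₂ x} {x₀ : B}
    (h : ∀ X : ∀ x, E₁ x,
      ContMDiffAt 𝓘(𝕜, EB) (𝓘(𝕜, EB).prod 𝓘(𝕜, F₁)) n (fun x => TotalSpace.mk' F₁ x (X x)) x₀ →
      ContMDiffAt 𝓘(𝕜, EB) (𝓘(𝕜, EB).prod 𝓘(𝕜, F₂)) n
        (fun x => TotalSpace.mk' F₂ x (φ x (X x))) x₀) :
    ContMDiffAt 𝓘(𝕜, EB) (𝓘(𝕜, EB).prod 𝓘(𝕜, F₁ →L[𝕜] F₂)) n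
      (fun x => (TotalSpace.mk' (F₁ →L[𝕜] F₂) x (φ x) :
        TotalSpace (F₁ →L[𝕜] F₂) (fun x => E₁ x →L[𝕜] E₂ x))) x₀ := by
  rw [contMDiffAt_hom_bundle]
  refine ⟨contMDiffAt_id, ?_⟩
  let e := trivializationAt F₁ E₁ x₀
  have key : ∀ c : F₁, ContMDiffAt 𝓘(𝕜, EB) 𝓘(𝕜, F₂) n (fun x =>
      ContinuousLinearMap.inCoordinates F₁ E₁ F₂ E₂ x₀ x x₀ x (φ x) c) x₀ := by
    intro c
    -- Test sections with constant components in the trivialization: their images give the columns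
    -- of the matrix of `φ`.
    have hX : ContMDiffAt 𝓘(𝕜, EB) (𝓘(𝕜, EB).prod 𝓘(𝕜, F₁)) n
        (fun x => TotalSpace.mk' F₁ x (e.symmL 𝕜 x c)) x₀ := by
      rw [contMDiffAt_totalSpace]
      refine ⟨contMDiffAt_id, (contMDiffAt_const (c := c)).congr_of_eventuallyEq ?_⟩
      filter_upwards [e.open_baseSet.mem_nhds (FiberBundle.mem_baseSet_trivializationAt' x₀)]
        with x hx
      change (e ⟨x, e.symmL 𝕜 x c⟩).2 = c
      rw [e.symmL_apply hx, e.mk_symm hx]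
      simp [Bundle.Trivialization.apply_symm_apply', hx]
    have h1 := (contMDiffAt_totalSpace.1 (h _ hX)).2
    refine h1.congr_of_eventuallyEq ?_
    filter_upwards [(trivializationAt F₂ E₂ x₀).open_baseSet.mem_nhds
      (FiberBundle.mem_baseSet_trivializationAt' x₀)] with x hx
    simp [ContinuousLinearMap.inCoordinates, Bundle.Trivialization.coe_linearMapAt_of_mem _ hx, e]
  exact contMDiffAt_clm_of_apply key

end HomBundle

section Tensor

variable {𝕜 : Type*} [RCLike 𝕜] {E : Type*} [NormedAddCommGroup E] [NormedSpace 𝕜 E]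
  {M : Type*} [TopologicalSpace M] [ChartedSpace E M] [IsManifold 𝓘(𝕜, E) ω M]
  {W : Type*} [NormedAddCommGroup W] [NormedSpace 𝕜 W] {Ψ : OpenPartialHomeomorph M W}

/-- The vector field `X` is analytic at `x`. -/
def VecField.AnalyticAt (X : VecField 𝕜 E M) (x : M) : Prop :=
  ContMDiffAt 𝓘(𝕜, E) (𝓘(𝕜, E).prod 𝓘(𝕜, E)) ω
    (fun y => (TotalSpace.mk' E y (X y) : TangentBundle 𝓘(𝕜, E) M)) x

/-- The bilinear form field `b` is analytic at `x`. -/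
def BilinField.AnalyticAt (b : BilinField 𝕜 E M) (x : M) : Prop :=
  ContMDiffAt 𝓘(𝕜, E) (𝓘(𝕜, E).prod 𝓘(𝕜, E →L[𝕜] E →L[𝕜] 𝕜)) ω
    (fun x => (TotalSpace.mk' (E →L[𝕜] E →L[𝕜] 𝕜) x (b x) :
      TotalSpace (E →L[𝕜] E →L[𝕜] 𝕜)
        (fun x : M => TangentSpace 𝓘(𝕜, E) x →L[𝕜] TangentSpace 𝓘(𝕜, E) x →L[𝕜] 𝕜))) x

/-- The endomorphism field `A` is analytic at `x`. -/
def EndField.AnalyticAt (A : EndField 𝕜 E M) (x : M) : Prop :=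
  ContMDiffAt 𝓘(𝕜, E) (𝓘(𝕜, E).prod 𝓘(𝕜, E →L[𝕜] E)) ω
    (fun x => (TotalSpace.mk' (E →L[𝕜] E) x (A x) :
      TotalSpace (E →L[𝕜] E)
        (fun x : M => TangentSpace 𝓘(𝕜, E) x →L[𝕜] TangentSpace 𝓘(𝕜, E) x))) x

theorem BilinField.analyticAt_of_apply [FiniteDimensional 𝕜 E] {b : BilinField 𝕜 E M} {x : M}
    (h : ∀ X Y : VecField 𝕜 E M, X.AnalyticAt x → Y.AnalyticAt x →
      ContMDiffAt 𝓘(𝕜, E) 𝓘(𝕜, 𝕜) ω (fun y => b y (X y) (Y y)) x) : b.AnalyticAt x := by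
  refine contMDiffAt_hom_of_apply (E₁ := fun x : M => TangentSpace 𝓘(𝕜, E) x)
    (E₂ := fun x : M => TangentSpace 𝓘(𝕜, E) x →L[𝕜] 𝕜) fun X hX => ?_
  refine contMDiffAt_hom_of_apply (E₁ := fun x : M => TangentSpace 𝓘(𝕜, E) x)
    (E₂ := Bundle.Trivial M 𝕜) fun Y hY => ?_
  exact contMDiffAt_totalSpace.2 ⟨contMDiffAt_id, h X Y hX hY⟩

theorem EndField.analyticAt_of_apply [FiniteDimensional 𝕜 E] {A : EndField 𝕜 E M} {x : M}
    (h : ∀ X : VecField 𝕜 E M, X.AnalyticAt x → VecField.AnalyticAt (fun y => A y (X y)) x) :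
    A.AnalyticAt x :=
  contMDiffAt_hom_of_apply (E₁ := fun x : M => TangentSpace 𝓘(𝕜, E) x)
    (E₂ := fun x : M => TangentSpace 𝓘(𝕜, E) x) fun X hX => h X hX

/-- The expression of a bilinear form field in a chart. -/
def BilinField.inChart (Ψ : OpenPartialHomeomorph M W) (b : BilinField 𝕜 E M) (q : W) :
    W →L[𝕜] W →L[𝕜] 𝕜 :=
  let B : E →L[𝕜] E →L[𝕜] 𝕜 := b (Ψ.symm q)
  let S : W →L[𝕜] E := chartDInv 𝕜 Ψ q
  B.bilinearComp S S

/-- The expression of an endomorphism field in a chart. -/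
def EndField.inChart (Ψ : OpenPartialHomeomorph M W) (A : EndField 𝕜 E M) (q : W) : W →L[𝕜] W :=
  (chartD 𝕜 Ψ q).comp ((A (Ψ.symm q)).comp (chartDInv 𝕜 Ψ q))

theorem BilinField.inChart_apply (b : BilinField 𝕜 E M) (q u v : W) :
    b.inChart Ψ q u v = b (Ψ.symm q) (chartDInv 𝕜 Ψ q u) (chartDInv 𝕜 Ψ q v) := rfl

theorem EndField.inChart_apply (A : EndField 𝕜 E M) (q u : W) :
    A.inChart Ψ q u = chartD 𝕜 Ψ q (A (Ψ.symm q) (chartDInv 𝕜 Ψ q u)) := rfl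

namespace IsModelChart

variable (hΨ : IsModelChart 𝕜 (E := E) Ψ) {q : W} (hq : q ∈ Ψ.target)
include hΨ hq

theorem apply_eq_inChart (b : BilinField 𝕜 E M) (u v : TangentSpace 𝓘(𝕜, E) (Ψ.symm q)) :
    b (Ψ.symm q) u v = b.inChart Ψ q (chartD 𝕜 Ψ q u) (chartD 𝕜 Ψ q v) := by
  rw [BilinField.inChart_apply, hΨ.chartDInv_chartD hq, hΨ.chartDInv_chartD hq]

theorem chartD_apply_eq_inChart (A : EndField 𝕜 E M) (u : TangentSpace 𝓘(𝕜, E) (Ψ.symm q)) :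
    chartD 𝕜 Ψ q (A (Ψ.symm q) u) = A.inChart Ψ q (chartD 𝕜 Ψ q u) := by
  rw [EndField.inChart_apply, hΨ.chartDInv_chartD hq]

theorem chartD_injective : Function.Injective (chartD 𝕜 (E := E) Ψ q) :=
  Function.LeftInverse.injective (hΨ.chartDInv_chartD hq)

theorem contDiffAt_bilin_inChart [FiniteDimensional 𝕜 W] {b : BilinField 𝕜 E M}
    (hb : b.AnalyticAt (Ψ.symm q)) : ContDiffAt 𝕜 ω (b.inChart Ψ) q := by
  refine contDiffAt_clm_of_apply fun u => contDiffAt_clm_of_apply fun v => ?_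
  have hu := hΨ.contMDiffAt_chartDInv hq (w := fun _ => u) contDiffAt_const
  have hv := hΨ.contMDiffAt_chartDInv hq (w := fun _ => v) contDiffAt_const
  have hb' := ContMDiffAt.comp (g := fun x => (TotalSpace.mk' (E →L[𝕜] E →L[𝕜] 𝕜) x (b x) :
      TotalSpace (E →L[𝕜] E →L[𝕜] 𝕜)
        (fun x : M => TangentSpace 𝓘(𝕜, E) x →L[𝕜] TangentSpace 𝓘(𝕜, E) x →L[𝕜] 𝕜))) q hb
    (hΨ.contMDiffAt_symm hq)
  have : ContMDiffAt 𝓘(𝕜, W) (𝓘(𝕜, E).prod 𝓘(𝕜, 𝕜)) ω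
      (fun m ↦ TotalSpace.mk' 𝕜 (E := Bundle.Trivial M 𝕜) (Ψ.symm m) (b (Ψ.symm m) (chartDInv 𝕜 Ψ m u) (chartDInv 𝕜 Ψ m v))) q := by
    apply ContMDiffAt.clm_bundle_apply₂ (F₁ := E) (F₂ := E)
    · exact hb'
    · exact hu
    · exact hv
  rw [contMDiffAt_totalSpace] at this
  exact contMDiffAt_iff_contDiffAt.1 this.2

theorem contDiffAt_end_inChart [FiniteDimensional 𝕜 W] {A : EndField 𝕜 E M}
    (hA : A.AnalyticAt (Ψ.symm q)) : ContDiffAt 𝕜 ω (A.inChart Ψ) q := by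
  refine contDiffAt_clm_of_apply fun u => ?_
  have hu := hΨ.contMDiffAt_chartDInv hq (w := fun _ => u) contDiffAt_const
  have hA' := ContMDiffAt.comp (g := fun x => (TotalSpace.mk' (E →L[𝕜] E) x (A x) :
      TotalSpace (E →L[𝕜] E)
        (fun x : M => TangentSpace 𝓘(𝕜, E) x →L[𝕜] TangentSpace 𝓘(𝕜, E) x))) q hA
    (hΨ.contMDiffAt_symm hq)
  have h1 := ContMDiffAt.clm_bundle_apply (F₁ := E) (F₂ := E) (E₁ := TangentSpace 𝓘(𝕜, E))
    (E₂ := TangentSpace 𝓘(𝕜, E)) hA' hu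
  exact contMDiffAt_iff_contDiffAt.1 (ContMDiffAt.comp
    (g := fun p : TangentBundle 𝓘(𝕜, E) M => mvfderiv 𝓘(𝕜, E) Ψ p.1 p.2) q
    (hΨ.contMDiffAt_mvfderiv hq _) h1)

theorem contDiffAt_inChart {X : VecField 𝕜 E M} (hX : X.AnalyticAt (Ψ.symm q)) :
    ContDiffAt 𝕜 ω (X.inChart 𝕜 Ψ) q := by
  have h1 : ContMDiffAt 𝓘(𝕜, W) (𝓘(𝕜, E).prod 𝓘(𝕜, E)) ω
      (fun y => (TotalSpace.mk' E (Ψ.symm y) (X (Ψ.symm y)) : TangentBundle 𝓘(𝕜, E) M)) q :=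
    ContMDiffAt.comp (g := fun y => (TotalSpace.mk' E y (X y) : TangentBundle 𝓘(𝕜, E) M)) q
      hX (hΨ.contMDiffAt_symm hq)
  have h2 := hΨ.contMDiffAt_mvfderiv hq (X (Ψ.symm q))
  exact contMDiffAt_iff_contDiffAt.1 (ContMDiffAt.comp
    (f := fun y => (TotalSpace.mk' E (Ψ.symm y) (X (Ψ.symm y)) : TangentBundle 𝓘(𝕜, E) M))
    (g := fun p : TangentBundle 𝓘(𝕜, E) M => mvfderiv 𝓘(𝕜, E) Ψ p.1 p.2) q h2 h1)

theorem analyticAt_of_inChart {X : VecField 𝕜 E M} (hX : ContDiffAt 𝕜 ω (X.inChart 𝕜 Ψ) q) :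
    X.AnalyticAt (Ψ.symm q) := by
  have h1 := hΨ.contMDiffAt_chartDInv hq hX
  rw [← Ψ.right_inv hq] at h1
  exact (ContMDiffAt.comp (Ψ.symm q) h1 (hΨ.contMDiffAt hq)).congr_of_eventuallyEq
    (hΨ.eventually_chartDInv_inChart hq X)

theorem bilin_analyticAt_of_inChart [FiniteDimensional 𝕜 E] {b : BilinField 𝕜 E M}
    (hb : ContDiffAt 𝕜 ω (b.inChart Ψ) q) : b.AnalyticAt (Ψ.symm q) := by
  refine BilinField.analyticAt_of_apply fun X Y hX hY => ?_
  have h1 : ContMDiffAt 𝓘(𝕜, W) 𝓘(𝕜, 𝕜) ω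
      (fun q => b.inChart Ψ q (X.inChart 𝕜 Ψ q) (Y.inChart 𝕜 Ψ q)) (Ψ (Ψ.symm q)) := by
    rw [Ψ.right_inv hq]
    exact contMDiffAt_iff_contDiffAt.2 ((hb.clm_apply (hΨ.contDiffAt_inChart hq hX)).clm_apply
      (hΨ.contDiffAt_inChart hq hY))
  refine (h1.comp (Ψ.symm q) (hΨ.contMDiffAt hq)).congr_of_eventuallyEq ?_
  filter_upwards [Ψ.open_source.mem_nhds (Ψ.map_target hq)] with y hy
  obtain ⟨p, hp, rfl⟩ : ∃ p ∈ Ψ.target, Ψ.symm p = y := ⟨Ψ y, Ψ.map_source hy, Ψ.left_inv hy⟩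
  rw [hΨ.apply_eq_inChart hp]
  simp only [Function.comp, Ψ.right_inv hp]
  rfl

theorem end_analyticAt_of_inChart [FiniteDimensional 𝕜 E] {A : EndField 𝕜 E M}
    (hA : ContDiffAt 𝕜 ω (A.inChart Ψ) q) : A.AnalyticAt (Ψ.symm q) := by
  refine EndField.analyticAt_of_apply fun X hX => hΨ.analyticAt_of_inChart hq ?_
  refine (hA.clm_apply (hΨ.contDiffAt_inChart hq hX)).congr_of_eventuallyEq ?_
  filter_upwards [Ψ.open_target.mem_nhds hq] with y hy
  exact hΨ.chartD_apply_eq_inChart hy A _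

end IsModelChart
end Tensor

end

/-! ### Koszul formula and the Levi-Civita connection in coordinates -/

section

section Koszul

variable {𝕜 : Type*} [RCLike 𝕜] {W : Type*} [NormedAddCommGroup W] [NormedSpace 𝕜 W]
  [FiniteDimensional 𝕜 W]

/-- A nondegenerate bilinear form on a finite-dimensional space is an isomorphism onto the dual. -/
theorem exists_equiv_of_nondegenerate {G : W →L[𝕜] W →L[𝕜] 𝕜}
    (hG : ∀ u, (∀ v, G u v = 0) → u = 0) : ∃ e : W ≃L[𝕜] (W →L[𝕜] 𝕜), ∀ u, e u = G u := by
  have hinj : Function.Injective (G : W →ₗ[𝕜] (W →L[𝕜] 𝕜)) := by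
    rw [← LinearMap.ker_eq_bot, LinearMap.ker_eq_bot']
    intro u hu
    exact hG u fun v => DFunLike.congr_fun hu v
  have hdim : Module.finrank 𝕜 W = Module.finrank 𝕜 (W →L[𝕜] 𝕜) := by
    rw [← (LinearMap.toContinuousLinearMap (𝕜 := 𝕜) (E := W) (F' := 𝕜)).finrank_eq]
    exact (Subspace.dual_finrank_eq (K := 𝕜) (V := W)).symm
  exact ⟨(LinearEquiv.ofInjectiveOfFinrankEq _ hinj hdim).toContinuousLinearEquiv, fun u => rfl⟩

/-- The Christoffel symbols given by the Koszul formula. -/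
theorem exists_christoffel {G : W →L[𝕜] W →L[𝕜] 𝕜} (hG : ∀ u, (∀ v, G u v = 0) → u = 0)
    (T : W →L[𝕜] W →L[𝕜] W →L[𝕜] 𝕜) :
    ∃ Γ : W →L[𝕜] W →L[𝕜] W, ∀ a b c, 2 * G (Γ a b) c = T a b c + T b a c - T c a b := by
  obtain ⟨e, he⟩ := exists_equiv_of_nondegenerate hG
  let K : W → W → (W →L[𝕜] 𝕜) := fun a b => (2⁻¹ : 𝕜) • (T a b + T b a - (T.flip a).flip b)
  have hK : ∀ a b c, K a b c = 2⁻¹ * (T a b c + T b a c - T c a b) := fun a b c => rfl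
  have ta : ∀ a a', T (a + a') = T a + T a' := fun a a' => ContinuousLinearMap.map_add T a a'
  have ts : ∀ (r : 𝕜) a, T (r • a) = r • T a := fun r a => ContinuousLinearMap.map_smul T r a
  let L : W →ₗ[𝕜] W →ₗ[𝕜] W := LinearMap.mk₂ 𝕜 (fun a b => e.symm (K a b))
    (fun a a' b => by
      rw [← map_add]; congr 1; ext c; simp only [hK, ta, add_apply, map_add (T _)]; ring)
    (fun r a b => by
      rw [← map_smul]; congr 1; ext c; simp only [hK, ts, smul_apply, map_smul (T _), smul_eq_mul]; ring)
    (fun a b b' => by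
      rw [← map_add]; congr 1; ext c; simp only [hK, ta, add_apply, map_add (T _), map_add (T _ _)]; ring)
    (fun r a b => by
      rw [← map_smul]; congr 1; ext c; simp only [hK, ts, smul_apply, map_smul (T _), map_smul (T _ _), smul_eq_mul]; ring)
  refine ⟨LinearMap.toContinuousLinearMap
    ((LinearMap.toContinuousLinearMap : (W →ₗ[𝕜] W) ≃ₗ[𝕜] (W →L[𝕜] W)).toLinearMap ∘ₗ L),
    fun a b c => ?_⟩
  change 2 * G (e.symm (K a b)) c = _
  rw [← he, e.apply_symm_apply, hK]
  ring

/-- Here `T a b c` stands for the derivative of `G b c` in direction `a`, so `hT` reflects symmetry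
of the metric. Symmetry of `Γ` is absence of torsion, since constant fields commute. -/
theorem christoffel_symm {G : W →L[𝕜] W →L[𝕜] 𝕜} (hG : ∀ u, (∀ v, G u v = 0) → u = 0)
    {T : W →L[𝕜] W →L[𝕜] W →L[𝕜] 𝕜} (hT : ∀ a b c, T a b c = T a c b)
    {Γ : W →L[𝕜] W →L[𝕜] W} (hΓ : ∀ a b c, 2 * G (Γ a b) c = T a b c + T b a c - T c a b)
    (a b : W) : Γ a b = Γ b a := by
  rw [← sub_eq_zero]
  refine hG _ fun c => ?_
  have h1 := hΓ a b c
  have h2 := hΓ b a c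
  rw [hT c a b] at h1
  have : 2 * G (Γ a b - Γ b a) c = 0 := by
    rw [map_sub, sub_apply, mul_sub, h1, h2]; ring
  simpa using this

/-- Add the Koszul formulas for (a, b, c) and (a, c, b): all terms cancel except twice `T a b c`. -/
theorem christoffel_metric {G : W →L[𝕜] W →L[𝕜] 𝕜} (hs : ∀ u v, G u v = G v u)
    {T : W →L[𝕜] W →L[𝕜] W →L[𝕜] 𝕜} (hT : ∀ a b c, T a b c = T a c b)
    {Γ : W →L[𝕜] W →L[𝕜] W} (hΓ : ∀ a b c, 2 * G (Γ a b) c = T a b c + T b a c - T c a b)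
    (a b c : W) : T a b c = G (Γ a b) c + G b (Γ a c) := by
  have h1 := hΓ a b c
  have h2 := hΓ a c b
  rw [hs b]
  have h3 := hT a b c
  refine mul_left_cancel₀ (two_ne_zero (α := 𝕜)) ?_
  linear_combination -h1 - h2 + h3

/-- A para-complex structure that is compatible with the metric and defines a closed form commutes
with the Christoffel symbols. -/
theorem christoffel_comm {G : W →L[𝕜] W →L[𝕜] 𝕜} (hG : ∀ u, (∀ v, G u v = 0) → u = 0)
    {P : W →L[𝕜] W} (hP : ∀ u, P (P u) = u)
    (hskew : ∀ u v, G (P u) v = -G u (P v))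
    {T : W →L[𝕜] W →L[𝕜] W →L[𝕜] 𝕜} (hT : ∀ a b c, T a b c = T a c b)
    (hTskew : ∀ a b c, T a (P b) c = -T a b (P c))
    (hclosed : ∀ a b c, T a (P b) c - T b (P a) c + T c (P a) b = 0)
    {Γ : W →L[𝕜] W →L[𝕜] W} (hΓ : ∀ a b c, 2 * G (Γ a b) c = T a b c + T b a c - T c a b)
    (a b : W) : Γ a (P b) = P (Γ a b) := by
  rw [← sub_eq_zero]
  refine hG _ fun c => ?_
  -- Up to the symmetries of `T`, the Koszul expressions of `Γ a (P b)` against `c` and of `Γ a b`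
  -- against `P c` add up to the difference of the closedness relation at (P b, P a, c) and at (P c,
  -- P a, b). This is the para-complex version of "integrable and closed implies parallel", with no
  -- torsion term because `P` is constant.
  have e2 := hclosed (P b) (P a) c
  have e3 := hclosed (P c) (P a) b
  simp only [hP] at e2 e3
  have key : 2 * G (Γ a (P b) - P (Γ a b)) c = 0 := by
    rw [map_sub, sub_apply, mul_sub, hskew]
    linear_combination hΓ a (P b) c + hΓ a b (P c) + hTskew a b c + e2 - e3 - hT c b (P a) -
      hTskew c a b + hT b c (P a) + hTskew b a c + hT (P a) b c
  simpa using key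

end Koszul

section

variable {𝕜 : Type*} [RCLike 𝕜] {E : Type*} [NormedAddCommGroup E] [NormedSpace 𝕜 E]
  {M : Type*} [TopologicalSpace M] [ChartedSpace E M] [IsManifold 𝓘(𝕜, E) ω M]
  {W : Type*} [NormedAddCommGroup W] [NormedSpace 𝕜 W] {Ψ : OpenPartialHomeomorph M W}

theorem VecField.chartD_apply (X : VecField 𝕜 E M) (q : W) :
    chartD 𝕜 Ψ q (X (Ψ.symm q)) = X.inChart 𝕜 Ψ q := rfl

namespace IsModelChart

variable (hΨ : IsModelChart 𝕜 (E := E) Ψ) {q : W} (hq : q ∈ Ψ.target)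
include hΨ hq

theorem mvfderiv_bilin_apply {b : BilinField 𝕜 E M} (hb : DifferentiableAt 𝕜 (b.inChart Ψ) q)
    {X Y : VecField 𝕜 E M} (hX : X.DiffAt (Ψ.symm q)) (hY : Y.DiffAt (Ψ.symm q))
    (v : TangentSpace 𝓘(𝕜, E) (Ψ.symm q)) :
    mvfderiv 𝓘(𝕜, E) (fun y => b y (X y) (Y y)) (Ψ.symm q) v =
      fderiv 𝕜 (b.inChart Ψ) q (chartD 𝕜 Ψ q v) (X.inChart 𝕜 Ψ q) (Y.inChart 𝕜 Ψ q) +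
      b.inChart Ψ q (fderiv 𝕜 (X.inChart 𝕜 Ψ) q (chartD 𝕜 Ψ q v)) (Y.inChart 𝕜 Ψ q) +
      b.inChart Ψ q (X.inChart 𝕜 Ψ q) (fderiv 𝕜 (Y.inChart 𝕜 Ψ) q (chartD 𝕜 Ψ q v)) := by
  have h1 : HasFDerivAt (fun q => b.inChart Ψ q (X.inChart 𝕜 Ψ q) (Y.inChart 𝕜 Ψ q)) _ q :=
    (hb.hasFDerivAt.clm_apply (hΨ.differentiableAt_inChart hq hX).hasFDerivAt).clm_apply
      (hΨ.differentiableAt_inChart hq hY).hasFDerivAt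
  have h2 := h1.congr_of_eventuallyEq
    (f₁ := (fun y => b y (X y) (Y y)) ∘ Ψ.symm) <| by
      filter_upwards [Ψ.open_target.mem_nhds hq] with y hy
      exact hΨ.apply_eq_inChart hy b _ _
  rw [hΨ.mvfderiv_apply hq h2.differentiableAt, h2.fderiv]
  simp only [add_apply, ContinuousLinearMap.comp_apply,
    ContinuousLinearMap.flip_apply]
  ring

/-- By the product rule and skewness, the terms containing derivatives of `X`, `Y`, `Z` cancel
against the brackets; the cyclic sum of derivatives of the coefficients remains. -/
theorem closed_of_inChart [CompleteSpace E] [CompleteSpace W] {b : BilinField 𝕜 E M}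
    (hb : DifferentiableAt 𝕜 (b.inChart Ψ) q) (halt : ∀ u v, b.inChart Ψ q u v = -b.inChart Ψ q v u)
    (hcl : ∀ u v w, fderiv 𝕜 (b.inChart Ψ) q u v w - fderiv 𝕜 (b.inChart Ψ) q v u w +
      fderiv 𝕜 (b.inChart Ψ) q w u v = 0)
    {X Y Z : VecField 𝕜 E M} (hX : X.DiffAt (Ψ.symm q)) (hY : Y.DiffAt (Ψ.symm q))
    (hZ : Z.DiffAt (Ψ.symm q)) :
    mvfderiv 𝓘(𝕜, E) (fun y => b y (Y y) (Z y)) (Ψ.symm q) (X (Ψ.symm q))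
      - mvfderiv 𝓘(𝕜, E) (fun y => b y (X y) (Z y)) (Ψ.symm q) (Y (Ψ.symm q))
      + mvfderiv 𝓘(𝕜, E) (fun y => b y (X y) (Y y)) (Ψ.symm q) (Z (Ψ.symm q))
      - b (Ψ.symm q) (mlieBracket 𝓘(𝕜, E) X Y (Ψ.symm q)) (Z (Ψ.symm q))
      + b (Ψ.symm q) (mlieBracket 𝓘(𝕜, E) X Z (Ψ.symm q)) (Y (Ψ.symm q))
      - b (Ψ.symm q) (mlieBracket 𝓘(𝕜, E) Y Z (Ψ.symm q)) (X (Ψ.symm q)) = 0 := by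
  rw [hΨ.mvfderiv_bilin_apply hq hb hY hZ, hΨ.mvfderiv_bilin_apply hq hb hX hZ,
    hΨ.mvfderiv_bilin_apply hq hb hX hY, hΨ.apply_eq_inChart hq, hΨ.apply_eq_inChart hq,
    hΨ.apply_eq_inChart hq, hΨ.chartD_mlieBracket hq hX hY, hΨ.chartD_mlieBracket hq hX hZ,
    hΨ.chartD_mlieBracket hq hY hZ]
  simp only [map_sub, sub_apply, VecField.chartD_apply]
  linear_combination hcl (X.inChart 𝕜 Ψ q) (Y.inChart 𝕜 Ψ q) (Z.inChart 𝕜 Ψ q) +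
    halt (Y.inChart 𝕜 Ψ q) (fderiv 𝕜 (Z.inChart 𝕜 Ψ) q (X.inChart 𝕜 Ψ q)) -
    halt (X.inChart 𝕜 Ψ q) (fderiv 𝕜 (Z.inChart 𝕜 Ψ) q (Y.inChart 𝕜 Ψ q)) +
    halt (X.inChart 𝕜 Ψ q) (fderiv 𝕜 (Y.inChart 𝕜 Ψ) q (Z.inChart 𝕜 Ψ q))

/-- At each point of a chart the Christoffel symbols define a torsion-free metric connection, for
which an endomorphism field with constant coefficients that commutes with them is parallel. -/
theorem exists_leviCivita_at [CompleteSpace E] [CompleteSpace W] {g : BilinField 𝕜 E M}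
    (hg : DifferentiableAt 𝕜 (g.inChart Ψ) q)
    {Γ : W →L[𝕜] W →L[𝕜] W} (hsymm : ∀ a b, Γ a b = Γ b a)
    (hmetric : ∀ a b c, fderiv 𝕜 (g.inChart Ψ) q a b c =
      g.inChart Ψ q (Γ a b) c + g.inChart Ψ q b (Γ a c))
    {A : EndField 𝕜 E M} {P : W →L[𝕜] W} (hA : ∀ᶠ q' in 𝓝 q, A.inChart Ψ q' = P)
    (hP : ∀ a b, Γ a (P b) = P (Γ a b)) :
    ∃ c : VecField 𝕜 E M →
        (TangentSpace 𝓘(𝕜, E) (Ψ.symm q) →L[𝕜] TangentSpace 𝓘(𝕜, E) (Ψ.symm q)),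
      (∀ X Y, X.DiffAt (Ψ.symm q) → Y.DiffAt (Ψ.symm q) → c (X + Y) = c X + c Y) ∧
      (∀ (h : M → 𝕜) (X : VecField 𝕜 E M), MDifferentiableAt 𝓘(𝕜, E) 𝓘(𝕜, 𝕜) h (Ψ.symm q) →
        X.DiffAt (Ψ.symm q) →
        c (h • X) = h (Ψ.symm q) • c X +
          (mvfderiv 𝓘(𝕜, E) h (Ψ.symm q)).smulRight (X (Ψ.symm q))) ∧
      (∀ X Y, X.DiffAt (Ψ.symm q) → Y.DiffAt (Ψ.symm q) →
        c Y (X (Ψ.symm q)) - c X (Y (Ψ.symm q)) = mlieBracket 𝓘(𝕜, E) X Y (Ψ.symm q)) ∧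
      (∀ X Y, X.DiffAt (Ψ.symm q) → Y.DiffAt (Ψ.symm q) → ∀ v,
        mvfderiv 𝓘(𝕜, E) (fun y => g y (X y) (Y y)) (Ψ.symm q) v =
          g (Ψ.symm q) (c X v) (Y (Ψ.symm q)) + g (Ψ.symm q) (X (Ψ.symm q)) (c Y v)) ∧
      (∀ X, X.DiffAt (Ψ.symm q) → ∀ v,
        c (fun y => A y (X y)) v = A (Ψ.symm q) (c X v)) := by
  -- In coordinates the connection is ∇_v X = dX(v) + Γ(v, X), transported to the tangent space by
  -- the differential of the chart.
  let D : VecField 𝕜 E M → W →L[𝕜] W := fun X =>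
    fderiv 𝕜 (X.inChart 𝕜 Ψ) q + Γ.flip (X.inChart 𝕜 Ψ q)
  let c : VecField 𝕜 E M →
        (TangentSpace 𝓘(𝕜, E) (Ψ.symm q) →L[𝕜] TangentSpace 𝓘(𝕜, E) (Ψ.symm q)) :=
    fun X => (chartDInv 𝕜 Ψ q).comp ((D X).comp (chartD 𝕜 Ψ q))
  have hc : ∀ X v, chartD 𝕜 Ψ q (c X v) = fderiv 𝕜 (X.inChart 𝕜 Ψ) q (chartD 𝕜 Ψ q v) +
      Γ (chartD 𝕜 Ψ q v) (X.inChart 𝕜 Ψ q) :=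
    fun X v => hΨ.chartD_chartDInv hq _
  refine ⟨c, fun X Y hX hY => ?_, fun h X hh hX => ?_, fun X Y hX hY => ?_, fun X Y hX hY v => ?_,
    fun X hX v => ?_⟩
  · ext v
    refine hΨ.chartD_injective hq ?_
    have e : (X + Y).inChart 𝕜 Ψ = X.inChart 𝕜 Ψ + Y.inChart 𝕜 Ψ := by
      ext q'; exact map_add _ _ _
    rw [add_apply, map_add, hc, hc, hc, e, fderiv_add (hΨ.differentiableAt_inChart hq hX)
      (hΨ.differentiableAt_inChart hq hY)]
    simp only [Pi.add_apply, add_apply, map_add]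
    abel
  · ext v
    refine hΨ.chartD_injective hq ?_
    have e : (h • X).inChart 𝕜 Ψ = fun q' => (h ∘ Ψ.symm) q' • X.inChart 𝕜 Ψ q' := by
      ext q'; exact map_smul _ _ _
    have hd : DifferentiableAt 𝕜 (h ∘ Ψ.symm) q :=
      mdifferentiableAt_iff_differentiableAt.1 (hh.comp q (hΨ.mdifferentiableAt_symm hq))
    rw [add_apply, map_add, hc, e,
      fderiv_fun_smul hd (hΨ.differentiableAt_inChart hq hX)]
    refine Eq.trans ?_ (congrArg₂ (· + ·) ((chartD 𝕜 Ψ q).map_smul _ (c X v))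
      (((chartD 𝕜 Ψ q).map_smul _ (X (Ψ.symm q))).trans
        (congrArg (fun t => t • X.inChart 𝕜 Ψ q) (hΨ.mvfderiv_apply hq hd v)))).symm
    rw [hc]
    simp only [add_apply, smul_apply, ContinuousLinearMap.smulRight_apply, map_smul, smul_add,
      Function.comp]
    abel
  · refine hΨ.chartD_injective hq ?_
    rw [map_sub, hc, hc, hΨ.chartD_mlieBracket hq hX hY]
    simp only [VecField.chartD_apply]
    rw [hsymm (X.inChart 𝕜 Ψ q)]
    abel
  · rw [hΨ.mvfderiv_bilin_apply hq hg hX hY, hΨ.apply_eq_inChart hq, hΨ.apply_eq_inChart hq, hc, hc,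
      hmetric]
    simp only [VecField.chartD_apply, map_add, add_apply]
    ring
  · refine hΨ.chartD_injective hq ?_
    have e : VecField.inChart 𝕜 Ψ (fun y => A y (X y)) =ᶠ[𝓝 q]
        fun q' => P (X.inChart 𝕜 Ψ q') := by
      filter_upwards [hA, Ψ.open_target.mem_nhds hq] with q' h1 h2
      rw [← h1]
      exact hΨ.chartD_apply_eq_inChart h2 A _
    have hd := P.hasFDerivAt.comp q (hΨ.differentiableAt_inChart hq hX).hasFDerivAt
    rw [hc, hΨ.chartD_apply_eq_inChart hq, hc, e.eq_of_nhds, e.fderiv_eq, hA.self_of_nhds,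
      hP, map_add]
    congr 1
    exact DFunLike.congr_fun hd.fderiv _

end IsModelChart
end

end

/-! ### Constant coefficients, and comparison of real and complex chart expressions -/

section

section ConstantCoefficients

variable {𝕜 : Type*} [RCLike 𝕜] {E : Type*} [NormedAddCommGroup E] [NormedSpace 𝕜 E]
  {M : Type*} [TopologicalSpace M] [ChartedSpace E M] [IsManifold 𝓘(𝕜, E) ω M]
  {W : Type*} [NormedAddCommGroup W] [NormedSpace 𝕜 W] {Ψ : OpenPartialHomeomorph M W}

namespace IsModelChart

variable (hΨ : IsModelChart 𝕜 (E := E) Ψ) {q : W} (hq : q ∈ Ψ.target)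
include hΨ hq

theorem inChart_apply_eventuallyEq {A : EndField 𝕜 E M} {P : W →L[𝕜] W}
    (hA : ∀ᶠ q' in 𝓝 q, A.inChart Ψ q' = P) (X : VecField 𝕜 E M) :
    VecField.inChart 𝕜 Ψ (fun y => A y (X y)) =ᶠ[𝓝 q] fun q' => P (X.inChart 𝕜 Ψ q') := by
  filter_upwards [hA, Ψ.open_target.mem_nhds hq] with q' h1 h2
  rw [← h1]
  exact hΨ.chartD_apply_eq_inChart h2 A _

theorem hasFDerivAt_inChart_apply {A : EndField 𝕜 E M} {P : W →L[𝕜] W}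
    (hA : ∀ᶠ q' in 𝓝 q, A.inChart Ψ q' = P) {X : VecField 𝕜 E M} (hX : X.DiffAt (Ψ.symm q)) :
    HasFDerivAt (VecField.inChart 𝕜 Ψ (fun y => A y (X y)))
      (P.comp (fderiv 𝕜 (X.inChart 𝕜 Ψ) q)) q :=
  (P.hasFDerivAt.comp q (hΨ.differentiableAt_inChart hq hX).hasFDerivAt).congr_of_eventuallyEq
    (hΨ.inChart_apply_eventuallyEq hq hA X)

theorem end_analyticAt_of_const [FiniteDimensional 𝕜 E] {A : EndField 𝕜 E M} {P : W →L[𝕜] W}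
    (hA : ∀ᶠ q' in 𝓝 q, A.inChart Ψ q' = P) : A.AnalyticAt (Ψ.symm q) :=
  hΨ.end_analyticAt_of_inChart hq ((contDiffAt_const (c := P)).congr_of_eventuallyEq hA)

/-- With constant coefficients the derivative of `A X` is `P` applied to that of `X`, so the four
brackets cancel algebraically by P² = -1. -/
theorem nijenhuis_of_const [CompleteSpace E] [CompleteSpace W] {A : EndField 𝕜 E M}
    {P : W →L[𝕜] W} (hA : ∀ᶠ q' in 𝓝 q, A.inChart Ψ q' = P) (hP : ∀ u, P (P u) = -u)
    {X Y : VecField 𝕜 E M} (hX : X.DiffAt (Ψ.symm q)) (hY : Y.DiffAt (Ψ.symm q)) :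
    mlieBracket 𝓘(𝕜, E) (fun y => A y (X y)) (fun y => A y (Y y)) (Ψ.symm q)
      - A (Ψ.symm q) (mlieBracket 𝓘(𝕜, E) (fun y => A y (X y)) Y (Ψ.symm q))
      - A (Ψ.symm q) (mlieBracket 𝓘(𝕜, E) X (fun y => A y (Y y)) (Ψ.symm q))
      - mlieBracket 𝓘(𝕜, E) X Y (Ψ.symm q) = 0 := by
  refine hΨ.chartD_injective hq ?_
  have hX' := hΨ.hasFDerivAt_inChart_apply hq hA hX
  have hY' := hΨ.hasFDerivAt_inChart_apply hq hA hY
  have hAX := hΨ.diffAt_of_inChart hq hX'.differentiableAt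
  have hAY := hΨ.diffAt_of_inChart hq hY'.differentiableAt
  rw [map_sub, map_sub, map_sub, map_zero, hΨ.chartD_apply_eq_inChart hq,
    hΨ.chartD_apply_eq_inChart hq, hΨ.chartD_mlieBracket hq hAX hAY,
    hΨ.chartD_mlieBracket hq hAX hY, hΨ.chartD_mlieBracket hq hX hAY,
    hΨ.chartD_mlieBracket hq hX hY, hX'.fderiv, hY'.fderiv,
    (hΨ.inChart_apply_eventuallyEq hq hA X).eq_of_nhds,
    (hΨ.inChart_apply_eventuallyEq hq hA Y).eq_of_nhds, hA.self_of_nhds]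
  simp only [ContinuousLinearMap.comp_apply, map_sub, hP]
  abel

/-- Vector fields in the kernel of an endomorphism field with constant coefficients are closed under
brackets. -/
theorem mlieBracket_mem_of_const [CompleteSpace E] [CompleteSpace W] {P : W →L[𝕜] W}
    {X Y : VecField 𝕜 E M} (hX : X.DiffAt (Ψ.symm q)) (hY : Y.DiffAt (Ψ.symm q))
    (hPX : ∀ᶠ q' in 𝓝 q, P (X.inChart 𝕜 Ψ q') = 0)
    (hPY : ∀ᶠ q' in 𝓝 q, P (Y.inChart 𝕜 Ψ q') = 0) :
    P (chartD 𝕜 Ψ q (mlieBracket 𝓘(𝕜, E) X Y (Ψ.symm q))) = 0 := by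
  have key : ∀ Z : VecField 𝕜 E M, Z.DiffAt (Ψ.symm q) →
      (∀ᶠ q' in 𝓝 q, P (Z.inChart 𝕜 Ψ q') = 0) → ∀ v, P (fderiv 𝕜 (Z.inChart 𝕜 Ψ) q v) = 0 := by
    intro Z hZ hPZ v
    have h1 := P.hasFDerivAt.comp q (hΨ.differentiableAt_inChart hq hZ).hasFDerivAt
    have h2 : HasFDerivAt (P ∘ Z.inChart 𝕜 Ψ) (0 : W →L[𝕜] W) q :=
      (hasFDerivAt_const 0 q).congr_of_eventuallyEq hPZ
    exact DFunLike.congr_fun (h1.unique h2) v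
  rw [hΨ.chartD_mlieBracket hq hX hY, map_sub, key Y hY hPY, key X hX hPX, sub_zero]

end IsModelChart
end ConstantCoefficients

section Restrict

variable {E : Type*} [NormedAddCommGroup E] [NormedSpace ℂ E]
  {M : Type*} [TopologicalSpace M] [ChartedSpace E M] [IsManifold 𝓘(ℂ, E) ω M]
  {W : Type*} [NormedAddCommGroup W] [NormedSpace ℂ W] {Ψ : OpenPartialHomeomorph M W}

namespace IsModelChart

variable (hΨ : IsModelChart ℂ (E := E) Ψ)
include hΨ

theorem restrictScalars_real : IsModelChart ℝ (E := E) Ψ :=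
  ⟨hΨ.contMDiffOn.restrictScalars_real, hΨ.contMDiffOn_symm.restrictScalars_real⟩

variable {q : W} (hq : q ∈ Ψ.target)
include hq

theorem chartD_real (u : TangentSpace 𝓘(ℝ, E) (Ψ.symm q)) :
    chartD ℝ Ψ q u = chartD ℂ Ψ q (toHol u) :=
  mfderiv_real_apply (hΨ.mdifferentiableAt hq) u

theorem chartDInv_real (w : W) : (chartDInv ℝ (E := E) Ψ q w : E) = chartDInv ℂ (E := E) Ψ q w :=
  mfderiv_real_apply (hΨ.mdifferentiableAt_symm hq) w

theorem end_inChart_real (A : EndField ℂ E M) :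
    A.toReal.inChart Ψ q = (A.inChart Ψ q).restrictScalars ℝ := by
  ext w
  change chartD ℝ Ψ q (A.toReal (Ψ.symm q) (chartDInv ℝ Ψ q w)) = _
  rw [hΨ.chartD_real hq]
  have h1 := hΨ.chartDInv_real hq w
  change chartD ℂ Ψ q (A (Ψ.symm q) (chartDInv ℝ (E := E) Ψ q w : E)) = _
  rw [h1]
  rfl

end IsModelChart
end Restrict

end

/-! ### Adapted charts: the para-complex structure in standard form -/

section

theorem hasFDerivAt_clm₂_apply {𝕜 D W F : Type*} [NontriviallyNormedField 𝕜]
    [NormedAddCommGroup D] [NormedSpace 𝕜 D] [NormedAddCommGroup W] [NormedSpace 𝕜 W]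
    [NormedAddCommGroup F] [NormedSpace 𝕜 F] {B : D → W →L[𝕜] W →L[𝕜] F} {q : D}
    (hB : DifferentiableAt 𝕜 B q) (v w : W) :
    HasFDerivAt (fun q => B q v w) (((fderiv 𝕜 B q).flip v).flip w) q := by
  refine ((hB.hasFDerivAt.clm_apply (hasFDerivAt_const v q)).clm_apply
    (hasFDerivAt_const w q)).congr_fderiv ?_
  ext u
  simp

theorem fderiv_clm₂_congr {𝕜 D W F : Type*} [NontriviallyNormedField 𝕜]
    [NormedAddCommGroup D] [NormedSpace 𝕜 D] [NormedAddCommGroup W] [NormedSpace 𝕜 W]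
    [NormedAddCommGroup F] [NormedSpace 𝕜 F] {B B' : D → W →L[𝕜] W →L[𝕜] F} {q : D}
    (hB : DifferentiableAt 𝕜 B q) (hB' : DifferentiableAt 𝕜 B' q) {v w v' w' : W}
    (h : ∀ᶠ q in 𝓝 q, B q v w = B' q v' w') (u : D) :
    fderiv 𝕜 B q u v w = fderiv 𝕜 B' q u v' w' :=
  DFunLike.congr_fun ((hasFDerivAt_clm₂_apply hB v w).unique
    ((hasFDerivAt_clm₂_apply hB' v' w').congr_of_eventuallyEq h)) u

theorem fderiv_clm₂_congr_neg {𝕜 D W F : Type*} [NontriviallyNormedField 𝕜]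
    [NormedAddCommGroup D] [NormedSpace 𝕜 D] [NormedAddCommGroup W] [NormedSpace 𝕜 W]
    [NormedAddCommGroup F] [NormedSpace 𝕜 F] {B B' : D → W →L[𝕜] W →L[𝕜] F} {q : D}
    (hB : DifferentiableAt 𝕜 B q) (hB' : DifferentiableAt 𝕜 B' q) {v w v' w' : W}
    (h : ∀ᶠ q in 𝓝 q, B q v w = -B' q v' w') (u : D) :
    fderiv 𝕜 B q u v w = -fderiv 𝕜 B' q u v' w' :=
  DFunLike.congr_fun ((hasFDerivAt_clm₂_apply hB v w).unique
    ((hasFDerivAt_clm₂_apply hB' v' w').neg.congr_of_eventuallyEq h)) u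

/-- The Christoffel symbols of a metric commute with a constant para-complex structure whose
fundamental form is closed. -/
theorem exists_christoffel_of_closed {𝕜 W : Type*} [RCLike 𝕜] [NormedAddCommGroup W]
    [NormedSpace 𝕜 W] [FiniteDimensional 𝕜 W] {G B : W → W →L[𝕜] W →L[𝕜] 𝕜} {q : W}
    (hG : DifferentiableAt 𝕜 G q) (hB : DifferentiableAt 𝕜 B q)
    (hs : ∀ᶠ q in 𝓝 q, ∀ u v, G q u v = G q v u) (hnd : ∀ u, (∀ v, G q u v = 0) → u = 0)
    (ha : ∀ᶠ q in 𝓝 q, ∀ u v, B q u v = -B q v u) {P : W →L[𝕜] W} (hP : ∀ u, P (P u) = u)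
    (hBG : ∀ᶠ q in 𝓝 q, ∀ u v, B q u v = G q (P u) v)
    (hcl : ∀ u v w, fderiv 𝕜 B q u v w - fderiv 𝕜 B q v u w + fderiv 𝕜 B q w u v = 0) :
    ∃ Γ : W →L[𝕜] W →L[𝕜] W, (∀ a b, Γ a b = Γ b a) ∧
      (∀ a b c, fderiv 𝕜 G q a b c = G q (Γ a b) c + G q b (Γ a c)) ∧
      ∀ a b, Γ a (P b) = P (Γ a b) := by
  have hT : ∀ u v w, fderiv 𝕜 G q u v w = fderiv 𝕜 G q u w v := fun u v w =>
    fderiv_clm₂_congr hG hG (hs.mono fun q' h => h v w) u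
  have hb : ∀ u v w, fderiv 𝕜 B q u v w = fderiv 𝕜 G q u (P v) w := fun u v w =>
    fderiv_clm₂_congr hB hG (hBG.mono fun q' h => h v w) u
  have hskew : ∀ u v w, fderiv 𝕜 B q u v w = -fderiv 𝕜 B q u w v := fun u v w =>
    fderiv_clm₂_congr_neg hB hB (ha.mono fun q' h => h v w) u
  obtain ⟨Γ, hΓ⟩ := exists_christoffel hnd (fderiv 𝕜 G q)
  refine ⟨Γ, christoffel_symm hnd hT hΓ, christoffel_metric hs.self_of_nhds hT hΓ,
    christoffel_comm hnd hP (fun u v => ?_) hT (fun u v w => ?_) (fun u v w => ?_) hΓ⟩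
  · rw [← hBG.self_of_nhds, ha.self_of_nhds, hBG.self_of_nhds, hs.self_of_nhds]
  · rw [← hb, hskew, hb, hT]
  · have := hcl u v w
    rwa [hb, hb, hb] at this

theorem neg_eq_self_iff_of_real {E : Type*} [AddCommGroup E] [Module ℝ E] (u : E) :
    -u = u ↔ u = 0 := by
  rw [neg_eq_iff_add_eq_zero, ← two_smul ℝ u, smul_eq_zero]
  simp

variable (E : Type*) [NormedAddCommGroup E] [NormedSpace ℂ E]

/-- The para-complex structure `(u, v) ↦ (-u, v)` of a product. -/
def paraDiag : E × E →L[ℂ] E × E :=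
  (-ContinuousLinearMap.fst ℂ E E).prod (ContinuousLinearMap.snd ℂ E E)

variable {E}

@[simp] theorem paraDiag_apply (u : E × E) : paraDiag E u = (-u.1, u.2) := rfl

variable {E' : Type*} [NormedAddCommGroup E'] [NormedSpace ℂ E']
  {M : Type*} [TopologicalSpace M] [ChartedSpace E' M] [IsManifold 𝓘(ℂ, E') ω M]

/-- On the open set of coordinates `S`, the chart `Ψ` puts the para-complex structure `F` into
standard form, and `g`, `b` satisfy in these coordinates the identities of a bicomplex Kähler
structure. -/
structure IsAdaptedOn (Ψ : OpenPartialHomeomorph M (E × E)) (S : Set (E × E))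
    (g : BilinField ℂ E' M) (F : EndField ℂ E' M) (b : BilinField ℂ E' M) : Prop where
  chart : IsModelChart ℂ (E := E') Ψ
  isOpen : IsOpen S
  subset : S ⊆ Ψ.target
  analyticAt_g : ∀ q ∈ S, g.AnalyticAt (Ψ.symm q)
  analyticAt_b : ∀ q ∈ S, b.AnalyticAt (Ψ.symm q)
  inChart_F : ∀ q ∈ S, F.inChart Ψ q = paraDiag E
  symm : ∀ q ∈ S, ∀ u v, g.inChart Ψ q u v = g.inChart Ψ q v u
  nondegenerate : ∀ q ∈ S, ∀ u, (∀ v, g.inChart Ψ q u v = 0) → u = 0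
  alternating : ∀ q ∈ S, ∀ u, b.inChart Ψ q u u = 0
  compatible : ∀ q ∈ S, ∀ u v, b.inChart Ψ q u v = g.inChart Ψ q (paraDiag E u) v
  closed : ∀ q ∈ S, ∀ u v w, fderiv ℂ (b.inChart Ψ) q u v w - fderiv ℂ (b.inChart Ψ) q v u w +
    fderiv ℂ (b.inChart Ψ) q w u v = 0

namespace IsAdaptedOn

variable {Ψ : OpenPartialHomeomorph M (E × E)} {S : Set (E × E)}
    {g : BilinField ℂ E' M} {F : EndField ℂ E' M} {b : BilinField ℂ E' M}
    (h : IsAdaptedOn Ψ S g F b) {q : E × E} (hq : q ∈ S)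
include h hq

theorem eventually_mem : ∀ᶠ q' in 𝓝 q, q' ∈ S := h.isOpen.mem_nhds hq

theorem eventually_inChart_F : ∀ᶠ q' in 𝓝 q, F.inChart Ψ q' = paraDiag E :=
  (h.eventually_mem hq).mono fun _ => h.inChart_F _

theorem chartD_F (u : TangentSpace 𝓘(ℂ, E') (Ψ.symm q)) :
    chartD ℂ Ψ q (F (Ψ.symm q) u) = (-(chartD ℂ Ψ q u).1, (chartD ℂ Ψ q u).2) := by
  rw [h.chart.chartD_apply_eq_inChart (h.subset hq), h.inChart_F q hq, paraDiag_apply]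

theorem F_F (u : TangentSpace 𝓘(ℂ, E') (Ψ.symm q)) : F (Ψ.symm q) (F (Ψ.symm q) u) = u := by
  refine h.chart.chartD_injective (h.subset hq) ?_
  rw [h.chartD_F hq, h.chartD_F hq]
  simp

theorem g_symm (u v : TangentSpace 𝓘(ℂ, E') (Ψ.symm q)) :
    g (Ψ.symm q) u v = g (Ψ.symm q) v u := by
  rw [h.chart.apply_eq_inChart (h.subset hq), h.symm q hq, ← h.chart.apply_eq_inChart (h.subset hq)]

theorem b_self (u : TangentSpace 𝓘(ℂ, E') (Ψ.symm q)) : b (Ψ.symm q) u u = 0 := by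
  rw [h.chart.apply_eq_inChart (h.subset hq), h.alternating q hq]

theorem b_eq (u v : TangentSpace 𝓘(ℂ, E') (Ψ.symm q)) :
    b (Ψ.symm q) u v = g (Ψ.symm q) (F (Ψ.symm q) u) v := by
  rw [h.chart.apply_eq_inChart (h.subset hq), h.compatible q hq, h.chart.apply_eq_inChart
    (h.subset hq) g, h.chart.chartD_apply_eq_inChart (h.subset hq), h.inChart_F q hq]

theorem inChart_b_skew (u v : E × E) : b.inChart Ψ q u v = -b.inChart Ψ q v u := by
  have h1 := h.alternating q hq (u + v)
  simp only [map_add, add_apply, h.alternating q hq, zero_add, add_zero] at h1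
  exact eq_neg_of_add_eq_zero_right h1

theorem g_nondegenerate (u : TangentSpace 𝓘(ℂ, E') (Ψ.symm q))
    (hu : ∀ v, g (Ψ.symm q) u v = 0) : u = 0 := by
  refine h.chart.chartD_injective (h.subset hq) ?_
  rw [map_zero]
  refine h.nondegenerate q hq _ fun v => ?_
  rw [← h.chart.chartD_chartDInv (h.subset hq) v, ← h.chart.apply_eq_inChart (h.subset hq), hu]

theorem b_nondegenerate (u : TangentSpace 𝓘(ℂ, E') (Ψ.symm q))
    (hu : ∀ v, b (Ψ.symm q) u v = 0) : u = 0 := by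
  have h1 := h.g_nondegenerate hq (F (Ψ.symm q) u) fun v => by rw [← h.b_eq hq, hu]
  rw [← h.F_F hq u, h1, map_zero]

/-- `F` acts by -1 on the first factor and by 1 on the second, so a fixed vector is one whose first
component equals its own opposite. -/
theorem mem_eigendistribution_one_iff (u : TangentSpace 𝓘(ℝ, E') (Ψ.symm q)) :
    u ∈ eigendistribution F.toReal 1 (Ψ.symm q) ↔ (chartD ℂ Ψ q (toHol u)).1 = 0 := by
  have h1 : u ∈ eigendistribution F.toReal 1 (Ψ.symm q) ↔ F (Ψ.symm q) (toHol u) = toHol u := by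
    change (F (Ψ.symm q) (toHol u) : E') - (1 : ℝ) • (toHol u : E') = 0 ↔ _
    rw [one_smul, sub_eq_zero]
  rw [h1, ← (h.chart.chartD_injective (h.subset hq)).eq_iff, h.chartD_F hq, Prod.ext_iff]
  simp [neg_eq_self_iff_of_real]

theorem mem_eigendistribution_neg_one_iff (u : TangentSpace 𝓘(ℝ, E') (Ψ.symm q)) :
    u ∈ eigendistribution F.toReal (-1) (Ψ.symm q) ↔ (chartD ℂ Ψ q (toHol u)).2 = 0 := by
  have h1 : u ∈ eigendistribution F.toReal (-1) (Ψ.symm q) ↔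
      F (Ψ.symm q) (toHol u) = -toHol u := by
    change (F (Ψ.symm q) (toHol u) : E') - (-1 : ℝ) • (toHol u : E') = 0 ↔ _
    rw [neg_smul, one_smul, sub_neg_eq_add, ← eq_neg_iff_add_eq_zero]
  rw [h1, ← (h.chart.chartD_injective (h.subset hq)).eq_iff, h.chartD_F hq, map_neg, Prod.ext_iff]
  rw [eq_comm (a := (_ : E × E).2)]
  simp [neg_eq_self_iff_of_real]

variable [FiniteDimensional ℂ E] [FiniteDimensional ℂ E']

theorem differentiableAt_b : DifferentiableAt ℂ (b.inChart Ψ) q :=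
  (h.chart.contDiffAt_bilin_inChart (h.subset hq) (h.analyticAt_b q hq)).differentiableAt (by simp)

theorem differentiableAt_g : DifferentiableAt ℂ (g.inChart Ψ) q :=
  (h.chart.contDiffAt_bilin_inChart (h.subset hq) (h.analyticAt_g q hq)).differentiableAt (by simp)

theorem exists_christoffel : ∃ Γ : E × E →L[ℂ] E × E →L[ℂ] E × E,
    (∀ a b, Γ a b = Γ b a) ∧
    (∀ a b c, fderiv ℂ (g.inChart Ψ) q a b c =
      g.inChart Ψ q (Γ a b) c + g.inChart Ψ q b (Γ a c)) ∧
    ∀ a b, Γ a (paraDiag E b) = paraDiag E (Γ a b) :=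
  exists_christoffel_of_closed (h.differentiableAt_g hq) (h.differentiableAt_b hq)
    ((h.eventually_mem hq).mono h.symm) (h.nondegenerate q hq)
    ((h.eventually_mem hq).mono fun _ hq' => h.inChart_b_skew hq') (P := paraDiag E)
    (fun u => by simp) ((h.eventually_mem hq).mono h.compatible) (h.closed q hq)

/-- `F` is conjugate to diag(-1, 1) on two copies of the same space, whose traces cancel. -/
theorem trace_F :
    LinearMap.trace ℝ (TangentSpace 𝓘(ℝ, E') (Ψ.symm q)) (F.toReal (Ψ.symm q)) = 0 := by
  have hR := h.chart.restrictScalars_real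
  let e : TangentSpace 𝓘(ℝ, E') (Ψ.symm q) ≃ₗ[ℝ] E × E :=
    { (chartD ℝ Ψ q).toLinearMap with
      invFun := chartDInv ℝ Ψ q
      left_inv := hR.chartDInv_chartD (h.subset hq)
      right_inv := hR.chartD_chartDInv (h.subset hq) }
  have h1 : e.conj (F.toReal (Ψ.symm q) :
      TangentSpace 𝓘(ℝ, E') (Ψ.symm q) →ₗ[ℝ] TangentSpace 𝓘(ℝ, E') (Ψ.symm q)) =
      LinearMap.prodMap (-LinearMap.id) LinearMap.id := by
    refine LinearMap.ext fun w => ?_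
    change F.toReal.inChart Ψ q w = _
    rw [h.chart.end_inChart_real (h.subset hq), h.inChart_F q hq]
    rfl
  rw [← LinearMap.trace_conj' _ e, h1, LinearMap.trace_prodMap', map_neg]
  exact neg_add_cancel _

theorem isCompl_eigendistribution :
    IsCompl (eigendistribution F.toReal 1 (Ψ.symm q))
      (eigendistribution F.toReal (-1) (Ψ.symm q)) := by
  constructor
  · rw [Submodule.disjoint_def]
    intro u h1 h2
    rw [h.mem_eigendistribution_one_iff hq] at h1
    rw [h.mem_eigendistribution_neg_one_iff hq] at h2
    have h3 : chartD ℂ Ψ q (toHol u) = chartD ℂ (E := E') Ψ q 0 := by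
      rw [map_zero]; exact Prod.ext h1 h2
    exact h.chart.chartD_injective (h.subset hq) h3
  · rw [codisjoint_iff, Submodule.eq_top_iff']
    intro u
    let w := chartD ℂ Ψ q (toHol u)
    have hs : chartDInv ℂ (E := E') Ψ q (0, w.2) + chartDInv ℂ (E := E') Ψ q (w.1, 0) = toHol u := by
      rw [← map_add, ← h.chart.chartDInv_chartD (h.subset hq) (toHol u)]
      refine congrArg _ ?_
      simp [w]
    refine Submodule.mem_sup.2 ⟨_, ?_, _, ?_, hs⟩
    · exact (h.mem_eigendistribution_one_iff hq _).2
        (congrArg Prod.fst (h.chart.chartD_chartDInv (h.subset hq) (0, w.2)))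
    · exact (h.mem_eigendistribution_neg_one_iff hq _).2
        (congrArg Prod.snd (h.chart.chartD_chartDInv (h.subset hq) (w.1, 0)))

/-- The subspace of tangent vectors annihilated by a component of the chart is half-dimensional. -/
theorem two_mul_finrank_eq {L : E × E →L[ℂ] E} (hL : Function.Surjective L)
    {D : Submodule ℝ (TangentSpace 𝓘(ℝ, E') (Ψ.symm q))}
    (hD : ∀ u, u ∈ D ↔ L (chartD ℂ Ψ q (toHol u)) = 0) :
    2 * Module.finrank ℝ D = Module.finrank ℝ E' := by
  have hfE : FiniteDimensional ℝ E := FiniteDimensional.complexToReal E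
  have hfE' : FiniteDimensional ℝ E' := FiniteDimensional.complexToReal E'
  have hR := h.chart.restrictScalars_real
  let e : E' ≃ₗ[ℝ] E × E :=
    { (chartD ℝ (E := E') Ψ q).toLinearMap with
      invFun := chartDInv ℝ (E := E') Ψ q
      left_inv := hR.chartDInv_chartD (h.subset hq)
      right_inv := hR.chartD_chartDInv (h.subset hq) }
  let K : E' →ₗ[ℝ] E := (L.restrictScalars ℝ : E × E →L[ℝ] E).toLinearMap ∘ₗ e.toLinearMap
  have hK : K.ker = (D : Submodule ℝ E') := by
    ext u
    refine Iff.trans ?_ (hD u).symm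
    exact iff_of_eq (congrArg (fun w => L w = 0) (h.chart.chartD_real (h.subset hq) u))
  have hsurj : K.range = ⊤ := LinearMap.range_eq_top.2 (hL.comp e.surjective)
  have h1 := K.finrank_range_add_finrank_ker
  rw [hK, hsurj, finrank_top] at h1
  have h3 : Module.finrank ℝ E + Module.finrank ℝ D = Module.finrank ℝ E' := h1
  have h2 := e.finrank_eq
  rw [Module.finrank_prod] at h2
  omega

/-- A component of the chart defines a holomorphic foliation. -/
theorem exists_submersion {V : Set M} (hV : IsOpen V) (hqV : Ψ.symm q ∈ V) {L : E × E →L[ℂ] E}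
    (hL : Function.Surjective L) {D : ∀ x : M, Submodule ℝ (TangentSpace 𝓘(ℝ, E') x)}
    (hD : ∀ q ∈ S, ∀ u : TangentSpace 𝓘(ℝ, E') (Ψ.symm q),
      u ∈ D (Ψ.symm q) ↔ L (chartD ℂ Ψ q (toHol u)) = 0) :
    ∃ (W : Set M) (k : ℕ) (s : M → Fin k → ℂ), IsOpen W ∧ Ψ.symm q ∈ W ∧ W ⊆ V ∧
      ContMDiffOn 𝓘(ℂ, E') 𝓘(ℂ, Fin k → ℂ) ω s W ∧
      ∀ y ∈ W, Function.Surjective (mvfderiv 𝓘(ℂ, E') s y) ∧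
        ∀ u : TangentSpace 𝓘(ℝ, E') y, u ∈ D y ↔ mvfderiv 𝓘(ℂ, E') s y (toHol u) = 0 := by
  let e : E ≃L[ℂ] (Fin (Module.finrank ℂ E) → ℂ) :=
    ContinuousLinearEquiv.ofFinrankEq (Module.finrank_fin_fun ℂ).symm
  let A : E × E →L[ℂ] (Fin (Module.finrank ℂ E) → ℂ) := e.toContinuousLinearMap.comp L
  refine ⟨V ∩ (Ψ.source ∩ Ψ ⁻¹' S), _, fun y => A (Ψ y), hV.inter
    (Ψ.isOpen_inter_preimage h.isOpen), ⟨hqV, Ψ.map_target (h.subset hq), ?_⟩,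
    inter_subset_left, ?_, ?_⟩
  · rw [mem_preimage, Ψ.right_inv (h.subset hq)]; exact hq
  · exact A.contDiff.contMDiff.comp_contMDiffOn (h.chart.contMDiffOn.mono fun y hy => hy.2.1)
  · rintro y ⟨-, hy, hyS⟩
    obtain ⟨p, hp, rfl⟩ : ∃ p ∈ S, Ψ.symm p = y := ⟨Ψ y, hyS, Ψ.left_inv hy⟩
    have hpt := h.subset hp
    have hd : HasFDerivAt ((fun y => A (Ψ y)) ∘ Ψ.symm) A p :=
      A.hasFDerivAt.congr_of_eventuallyEq
        ((h.chart.eventually_right_inv hpt).mono fun q' hq' => congrArg A hq')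
    have hm : ∀ v, mvfderiv 𝓘(ℂ, E') (fun y => A (Ψ y)) (Ψ.symm p) v = A (chartD ℂ Ψ p v) := by
      intro v
      rw [h.chart.mvfderiv_apply hpt hd.differentiableAt, hd.fderiv]
    refine ⟨fun w => ?_, fun u => ?_⟩
    · obtain ⟨w', hw'⟩ := (e.surjective.comp hL) w
      exact ⟨chartDInv ℂ Ψ p w', by rw [hm, h.chart.chartD_chartDInv hpt]; exact hw'⟩
    · rw [hD p hp, hm]
      exact (map_eq_zero_iff e e.injective).symm

end IsAdaptedOn

end

/-! ### From adapted charts to bicomplex Kähler and bi-Lagrangian structures -/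

section

section Adapted

variable {E : Type*} [NormedAddCommGroup E] [NormedSpace ℂ E] [FiniteDimensional ℂ E]
  {E' : Type*} [NormedAddCommGroup E'] [NormedSpace ℂ E'] [FiniteDimensional ℂ E']
  {M : Type*} [TopologicalSpace M] [ChartedSpace E' M] [IsManifold 𝓘(ℂ, E') ω M]

/-- Every point of `V` has adapted coordinates with values in `E × E`. -/
def HasAdaptedCharts (E : Type*) [NormedAddCommGroup E] [NormedSpace ℂ E] (V : Set M)
    (g : BilinField ℂ E' M) (F : EndField ℂ E' M) (b : BilinField ℂ E' M) : Prop :=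
  ∀ x ∈ V, ∃ (Ψ : OpenPartialHomeomorph M (E × E)) (S : Set (E × E)),
    IsAdaptedOn Ψ S g F b ∧ ∃ q ∈ S, Ψ.symm q = x

variable {V : Set M} {g : BilinField ℂ E' M} {F : EndField ℂ E' M} {b : BilinField ℂ E' M}

namespace HasAdaptedCharts

variable (hV : HasAdaptedCharts E V g F b)
include hV

theorem exists_leviCivita :
    ∃ cov : TangentConnection ℂ E' M, IsLeviCivitaOn V g cov ∧ ParallelOn V cov F := by
  have : CompleteSpace E := FiniteDimensional.complete ℂ E
  have : CompleteSpace E' := FiniteDimensional.complete ℂ E'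
  -- Every condition on a Levi-Civita connection, and parallelism as well, concerns the values of
  -- the connection at one point. The connection may therefore be chosen point by point, without
  -- comparing charts, and arbitrarily outside `V`.
  have key : ∀ x : M, ∃ c : VecField ℂ E' M →
        (TangentSpace 𝓘(ℂ, E') x →L[ℂ] TangentSpace 𝓘(ℂ, E') x), x ∈ V →
      (∀ X Y, X.DiffAt x → Y.DiffAt x → c (X + Y) = c X + c Y) ∧
      (∀ (h : M → ℂ) (X : VecField ℂ E' M), MDifferentiableAt 𝓘(ℂ, E') 𝓘(ℂ, ℂ) h x →
        X.DiffAt x → c (h • X) = h x • c X + (mvfderiv 𝓘(ℂ, E') h x).smulRight (X x)) ∧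
      (∀ X Y, X.DiffAt x → Y.DiffAt x →
        c Y (X x) - c X (Y x) = mlieBracket 𝓘(ℂ, E') X Y x) ∧
      (∀ X Y, X.DiffAt x → Y.DiffAt x → ∀ v,
        mvfderiv 𝓘(ℂ, E') (fun y => g y (X y) (Y y)) x v =
          g x (c X v) (Y x) + g x (X x) (c Y v)) ∧
      (∀ X, X.DiffAt x → ∀ v, c (fun y => F y (X y)) v = F x (c X v)) := by
    intro x
    by_cases hx : x ∈ V
    · obtain ⟨Ψ, S, h, q, hq, rfl⟩ := hV x hx
      obtain ⟨Γ, h1, h2, h3⟩ := h.exists_christoffel hq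
      obtain ⟨c, hc⟩ := h.chart.exists_leviCivita_at (h.subset hq) (h.differentiableAt_g hq) h1 h2
        (h.eventually_inChart_F hq) h3
      exact ⟨c, fun _ => hc⟩
    · exact ⟨fun _ => 0, fun h => absurd h hx⟩
  choose c hc using key
  refine ⟨fun X x => c x X, ⟨⟨fun {X Y x} hX hY hx => (hc x hx).1 X Y hX hY,
    fun {X h x} hX hh hx => (hc x hx).2.1 h X hh hX⟩, fun x hx => (hc x hx).2.2.1,
    fun x hx => (hc x hx).2.2.2.1⟩, fun x hx => (hc x hx).2.2.2.2⟩

theorem isComplexSymplecticOn : IsComplexSymplecticOn V b where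
  holomorphic x hx := by
    obtain ⟨Ψ, S, h, q, hq, rfl⟩ := hV x hx
    exact ContMDiffAt.contMDiffWithinAt (h.analyticAt_b q hq)
  alternating x hx := by
    obtain ⟨Ψ, S, h, q, hq, rfl⟩ := hV x hx
    exact h.b_self hq
  closed x hx := by
    have : CompleteSpace E := FiniteDimensional.complete ℂ E
    have : CompleteSpace E' := FiniteDimensional.complete ℂ E'
    obtain ⟨Ψ, S, h, q, hq, rfl⟩ := hV x hx
    exact fun X Y Z hX hY hZ => h.chart.closed_of_inChart (h.subset hq) (h.differentiableAt_b hq)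
      (h.inChart_b_skew hq) (h.closed q hq) hX hY hZ
  nondegenerate x hx := by
    obtain ⟨Ψ, S, h, q, hq, rfl⟩ := hV x hx
    exact h.b_nondegenerate hq

theorem isHolomorphicMetricOn : IsHolomorphicMetricOn V g where
  holomorphic x hx := by
    obtain ⟨Ψ, S, h, q, hq, rfl⟩ := hV x hx
    exact ContMDiffAt.contMDiffWithinAt (h.analyticAt_g q hq)
  symm x hx := by
    obtain ⟨Ψ, S, h, q, hq, rfl⟩ := hV x hx
    exact h.g_symm hq
  nondegenerate x hx := by
    obtain ⟨Ψ, S, h, q, hq, rfl⟩ := hV x hx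
    exact h.g_nondegenerate hq

/-- From I J = F and J² = -1 there is no choice but I = -F J. In adapted charts both `F` and this I
have constant coefficients, which gives holomorphy and integrability. -/
theorem isHolomorphicBicomplexOn :
    IsHolomorphicBicomplexOn V (fun x => -(F x).comp (complexStructureHol E' M x)) F := by
  have : CompleteSpace E := FiniteDimensional.complete ℂ E
  have : CompleteSpace E' := FiniteDimensional.complete ℂ E'
  have hFF : ∀ x ∈ V, ∀ u, F x (F x u) = u := by
    intro x hx
    obtain ⟨Ψ, S, h, q, hq, rfl⟩ := hV x hx
    exact h.F_F hq
  have hI : ∀ x (u : TangentSpace 𝓘(ℂ, E') x),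
      (-(F x).comp (complexStructureHol E' M x)) u = -(Complex.I • F x u) := by
    intro x u
    exact congrArg (fun w => -w) ((F x).map_smul Complex.I u)
  have hIchart : ∀ (Ψ : OpenPartialHomeomorph M (E × E)) (S : Set (E × E)),
      IsAdaptedOn Ψ S g F b → ∀ q ∈ S,
      EndField.inChart Ψ (fun x => -(F x).comp (complexStructureHol E' M x)) q =
        -(Complex.I • paraDiag E) := by
    intro Ψ S h q hq
    refine ContinuousLinearMap.ext fun w => ?_
    rw [EndField.inChart_apply, hI]
    refine ((chartD ℂ Ψ q).map_neg _).trans (congrArg (fun w => -w) ?_)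
    refine ((chartD ℂ Ψ q).map_smul _ _).trans (congrArg (fun w => Complex.I • w) ?_)
    exact DFunLike.congr_fun (h.inChart_F q hq) w
  exact
  { holomorphic_I := fun x hx => by
      obtain ⟨Ψ, S, h, q, hq, rfl⟩ := hV x hx
      exact ContMDiffAt.contMDiffWithinAt (h.chart.end_analyticAt_of_const (h.subset hq)
        ((h.eventually_mem hq).mono fun q' hq' => hIchart Ψ S h q' hq'))
    holomorphic_F := fun x hx => by
      obtain ⟨Ψ, S, h, q, hq, rfl⟩ := hV x hx
      exact ContMDiffAt.contMDiffWithinAt (h.chart.end_analyticAt_of_const (h.subset hq)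
        (h.eventually_inChart_F hq))
    sq_I := fun x hx u => by
      rw [hI, hI]
      have h1 : F x (-(Complex.I • F x u)) = -(Complex.I • u) :=
        ((F x).map_neg _).trans (congrArg (fun w => -w)
          (((F x).map_smul _ _).trans (congrArg (fun w => Complex.I • w) (hFF x hx u))))
      rw [h1, smul_neg, neg_neg, smul_smul, Complex.I_mul_I, neg_one_smul]
    sq_F := hFF
    comp_IJ := fun x hx u => by
      rw [hI]
      have h1 : F x (complexStructureHol E' M x u) = Complex.I • F x u := (F x).map_smul _ _
      rw [h1, smul_smul, Complex.I_mul_I, neg_one_smul, neg_neg]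
    comp_JI := fun x hx u => by
      rw [hI]
      change Complex.I • (-(Complex.I • F x u)) = F x u
      rw [smul_neg, smul_smul, Complex.I_mul_I, neg_one_smul, neg_neg]
    integrable_I := fun x hx X Y hX hY => by
      obtain ⟨Ψ, S, h, q, hq, rfl⟩ := hV x hx
      refine h.chart.restrictScalars_real.nijenhuis_of_const (h.subset hq)
        (P := (-(Complex.I • paraDiag E)).restrictScalars ℝ) ?_ (fun u => ?_) hX hY
      · filter_upwards [h.eventually_mem hq] with q' hq'
        rw [h.chart.end_inChart_real (h.subset hq'), hIchart Ψ S h q' hq']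
      · change -(Complex.I • paraDiag E (-(Complex.I • paraDiag E u))) = -u
        rw [map_neg, map_smul, smul_neg, smul_smul, Complex.I_mul_I, neg_one_smul, neg_neg]
        simp
    trace_F := fun x hx => by
      obtain ⟨Ψ, S, h, q, hq, rfl⟩ := hV x hx
      exact h.trace_F hq
    involutive_pos := fun x hx X Y hX hY hDX hDY => by
      obtain ⟨Ψ, S, h, q, hq, rfl⟩ := hV x hx
      have hc := h.chart.restrictScalars_real
      -- The first component is followed by an inclusion into `E × E` because
      -- `mlieBracket_mem_of_const` takes an endomorphism; only its kernel matters.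
      have key : ∀ Z : VecField ℝ E' M,
          (∀ᶠ y in 𝓝 (Ψ.symm q), Z y ∈ eigendistribution F.toReal 1 y) →
          ∀ᶠ q' in 𝓝 q, ((ContinuousLinearMap.inl ℝ E E).comp (ContinuousLinearMap.fst ℝ E E))
            (Z.inChart ℝ Ψ q') = 0 := by
        intro Z hZ
        filter_upwards [(Ψ.continuousAt_symm (h.subset hq)).eventually hZ, h.eventually_mem hq]
          with q' h1 h2
        rw [h.mem_eigendistribution_one_iff h2] at h1
        have h3 : (Z.inChart ℝ Ψ q').1 = 0 := by
          rw [VecField.inChart, h.chart.chartD_real (h.subset h2), h1]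
        change ((Z.inChart ℝ Ψ q').1, (0 : E)) = 0
        rw [h3]; rfl
      have h1 := hc.mlieBracket_mem_of_const (h.subset hq) hX hY (key X hDX) (key Y hDY)
      rw [h.mem_eigendistribution_one_iff hq, ← h.chart.chartD_real (h.subset hq)]
      exact congrArg Prod.fst h1
    involutive_neg := fun x hx X Y hX hY hDX hDY => by
      obtain ⟨Ψ, S, h, q, hq, rfl⟩ := hV x hx
      have hc := h.chart.restrictScalars_real
      have key : ∀ Z : VecField ℝ E' M,
          (∀ᶠ y in 𝓝 (Ψ.symm q), Z y ∈ eigendistribution F.toReal (-1) y) →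
          ∀ᶠ q' in 𝓝 q, ((ContinuousLinearMap.inl ℝ E E).comp (ContinuousLinearMap.snd ℝ E E))
            (Z.inChart ℝ Ψ q') = 0 := by
        intro Z hZ
        filter_upwards [(Ψ.continuousAt_symm (h.subset hq)).eventually hZ, h.eventually_mem hq]
          with q' h1 h2
        rw [h.mem_eigendistribution_neg_one_iff h2] at h1
        have h3 : (Z.inChart ℝ Ψ q').2 = 0 := by
          rw [VecField.inChart, h.chart.chartD_real (h.subset h2), h1]
        change ((Z.inChart ℝ Ψ q').2, (0 : E)) = 0
        rw [h3]; rfl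
      have h1 := hc.mlieBracket_mem_of_const (h.subset hq) hX hY (key X hDX) (key Y hDY)
      rw [h.mem_eigendistribution_neg_one_iff hq, ← h.chart.chartD_real (h.subset hq)]
      exact congrArg Prod.fst h1 }

theorem isBicomplexKahlerOn : IsBicomplexKahlerOn V g F b where
  metric := hV.isHolomorphicMetricOn
  bicomplex := ⟨_, hV.isHolomorphicBicomplexOn⟩
  symplectic := hV.isComplexSymplecticOn
  compatible x hx := by
    obtain ⟨Ψ, S, h, q, hq, rfl⟩ := hV x hx
    exact h.b_eq hq
  parallel := hV.exists_leviCivita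

/-- On the eigendistributions of `F` the form `b` vanishes. -/
theorem isotropic {x : M} (hx : x ∈ V) {c : ℂ} {u v : TangentSpace 𝓘(ℂ, E') x}
    (hu : F x u = c • u) (hv : F x v = c • v) : b x u v = 0 := by
  obtain ⟨Ψ, S, h, q, hq, rfl⟩ := hV x hx
  have h1 : b (Ψ.symm q) u v = -b (Ψ.symm q) v u := by
    rw [h.chart.apply_eq_inChart (h.subset hq), h.inChart_b_skew hq,
      ← h.chart.apply_eq_inChart (h.subset hq)]
  -- On the eigenspace the form is c times the metric, hence symmetric as well as skew.
  have e : ∀ u v : TangentSpace 𝓘(ℂ, E') (Ψ.symm q), F (Ψ.symm q) u = c • u →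
      b (Ψ.symm q) u v = c * g (Ψ.symm q) u v := by
    intro u v hu
    rw [h.b_eq hq, hu]
    exact DFunLike.congr_fun ((g (Ψ.symm q)).map_smul c u) v
  rw [e v u hv, h.g_symm hq v u, ← e u v hu] at h1
  exact self_eq_neg.1 h1

theorem isComplexBiLagrangianOn (hVo : IsOpen V)
    {D₁ D₂ : ∀ x : M, Submodule ℝ (TangentSpace 𝓘(ℝ, E') x)}
    (h₁ : ∀ x ∈ V, eigendistribution F.toReal 1 x = D₁ x)
    (h₂ : ∀ x ∈ V, eigendistribution F.toReal (-1) x = D₂ x) :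
    IsComplexBiLagrangianOn V b D₁ D₂ where
  symplectic := hV.isComplexSymplecticOn
  lagrangian₁ :=
  { foliation := fun x hx => by
      obtain ⟨Ψ, S, h, q, hq, rfl⟩ := hV x hx
      obtain ⟨W, k, s, hW, hxW, hWV, hs, hsW⟩ := h.exists_submersion hq hVo hx
        (L := ContinuousLinearMap.fst ℂ E E) Prod.fst_surjective
        (D := eigendistribution F.toReal 1) fun q hq => h.mem_eigendistribution_one_iff hq
      exact ⟨W, k, s, hW, hxW, hWV, hs, fun y hy => ⟨(hsW y hy).1, fun u => by
        rw [← h₁ y (hWV hy)]; exact (hsW y hy).2 u⟩⟩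
    half_dim := fun x hx => by
      rw [← h₁ x hx]
      obtain ⟨Ψ, S, h, q, hq, rfl⟩ := hV x hx
      exact h.two_mul_finrank_eq hq (L := ContinuousLinearMap.fst ℂ E E) Prod.fst_surjective
        (h.mem_eigendistribution_one_iff hq)
    isotropic := fun x hx u hu v hv => by
      have key : ∀ u ∈ D₁ x, F x (toHol u) = (1 : ℂ) • toHol u := by
        intro u hu
        rw [← h₁ x hx] at hu
        have : (F x (toHol u) : E') - (1 : ℝ) • (toHol u : E') = 0 := hu
        rw [one_smul, sub_eq_zero] at this
        rw [one_smul]; exact this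
      exact hV.isotropic hx (key u hu) (key v hv) }
  lagrangian₂ :=
  { foliation := fun x hx => by
      obtain ⟨Ψ, S, h, q, hq, rfl⟩ := hV x hx
      obtain ⟨W, k, s, hW, hxW, hWV, hs, hsW⟩ := h.exists_submersion hq hVo hx
        (L := ContinuousLinearMap.snd ℂ E E) Prod.snd_surjective
        (D := eigendistribution F.toReal (-1)) fun q hq => h.mem_eigendistribution_neg_one_iff hq
      exact ⟨W, k, s, hW, hxW, hWV, hs, fun y hy => ⟨(hsW y hy).1, fun u => by
        rw [← h₂ y (hWV hy)]; exact (hsW y hy).2 u⟩⟩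
    half_dim := fun x hx => by
      rw [← h₂ x hx]
      obtain ⟨Ψ, S, h, q, hq, rfl⟩ := hV x hx
      exact h.two_mul_finrank_eq hq (L := ContinuousLinearMap.snd ℂ E E) Prod.snd_surjective
        (h.mem_eigendistribution_neg_one_iff hq)
    isotropic := fun x hx u hu v hv => by
      have key : ∀ u ∈ D₂ x, F x (toHol u) = (-1 : ℂ) • toHol u := by
        intro u hu
        rw [← h₂ x hx] at hu
        have : (F x (toHol u) : E') - (-1 : ℝ) • (toHol u : E') = 0 := hu
        rw [neg_one_smul, sub_eq_zero] at this
        rw [neg_one_smul]; exact this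
      exact hV.isotropic hx (key u hu) (key v hv) }
  transverse x hx := by
    rw [← h₁ x hx, ← h₂ x hx]
    obtain ⟨Ψ, S, h, q, hq, rfl⟩ := hV x hx
    exact h.isCompl_eigendistribution hq

end HasAdaptedCharts
end Adapted

end

/-! ### Holomorphic charts straightening a complexification -/

section

/-- In the charts provided by the immersion, the map is the injective linear map `A`; the chart of
the source has injective differential. -/
theorem Manifold.IsImmersionAt.mfderiv_injective {E : Type*} [NormedAddCommGroup E]
    [NormedSpace ℝ E] {N : Type*} [TopologicalSpace N] [ChartedSpace E N] [IsManifold 𝓘(ℝ, E) ω N]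
    {E' : Type*} [NormedAddCommGroup E'] [NormedSpace ℝ E'] {M : Type*} [TopologicalSpace M]
    [ChartedSpace E' M] [IsManifold 𝓘(ℝ, E') ω M] {f : N → M} {p : N}
    (h : Manifold.IsImmersionAt 𝓘(ℝ, E) 𝓘(ℝ, E') ω f p) :
    Function.Injective (mfderiv 𝓘(ℝ, E) 𝓘(ℝ, E') f p) := by
  let d := h.domChart
  let c := h.codChart
  have hd : d.MDifferentiable 𝓘(ℝ, E) 𝓘(ℝ, E) :=
    ⟨(contMDiffOn_of_mem_maximalAtlas h.domChart_mem_maximalAtlas).mdifferentiableOn (by simp),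
      (contMDiffOn_symm_of_mem_maximalAtlas h.domChart_mem_maximalAtlas).mdifferentiableOn (by simp)⟩
  have hc : MDifferentiableAt 𝓘(ℝ, E') 𝓘(ℝ, E') c (f p) :=
    (contMDiffAt_of_mem_maximalAtlas h.codChart_mem_maximalAtlas
      h.mem_codChart_source).mdifferentiableAt (by simp)
  have hf : MDifferentiableAt 𝓘(ℝ, E) 𝓘(ℝ, E') f p := h.contMDiffAt.mdifferentiableAt (by simp)
  let A : E →L[ℝ] E' := h.equiv.toContinuousLinearMap.comp (ContinuousLinearMap.inl ℝ E h.complement)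
  have h1 : HasMFDerivAt 𝓘(ℝ, E) 𝓘(ℝ, E') (c ∘ f) p _ := hc.hasMFDerivAt.comp p hf.hasMFDerivAt
  have h2 : HasMFDerivAt 𝓘(ℝ, E) 𝓘(ℝ, E') (A ∘ d) p _ :=
    (A.hasMFDerivAt (x := d p)).comp p (hd.mdifferentiableAt h.mem_domChart_source).hasMFDerivAt
  have h3 : c ∘ f =ᶠ[𝓝 p] A ∘ d := by
    filter_upwards [d.open_source.mem_nhds h.mem_domChart_source] with y hy
    have hy' : d y ∈ (h.domChart.extend 𝓘(ℝ, E)).target := by simpa [d] using d.map_source hy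
    have := h.writtenInCharts hy'
    simpa [d.left_inv hy, c, d, A] using this
  have h4 := hasMFDerivAt_unique h1 (h2.congr_of_eventuallyEq h3)
  refine (injective_iff_map_eq_zero _).2 fun u hu => ?_
  have h5 : A (mfderiv 𝓘(ℝ, E) 𝓘(ℝ, E) d p u) = 0 := by
    refine (DFunLike.congr_fun h4 u).symm.trans ?_
    refine (congrArg (mfderiv 𝓘(ℝ, E') 𝓘(ℝ, E') c (f p)) hu).trans (map_zero _)
  have h6 : (mfderiv 𝓘(ℝ, E) 𝓘(ℝ, E) d p u : E) = 0 := by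
    have := h.equiv.injective (h5.trans (map_zero h.equiv).symm)
    exact congrArg Prod.fst this
  exact (injective_iff_map_eq_zero _).1 (hd.mfderiv_injective h.mem_domChart_source) u h6

/-- The inverse function theorem for analytic maps, on an open set where both directions are
analytic. -/
theorem exists_openPartialHomeomorph_of_bijective_fderiv {W F : Type*} [NormedAddCommGroup W]
    [NormedSpace ℂ W] [FiniteDimensional ℂ W] [NormedAddCommGroup F] [NormedSpace ℂ F] [CompleteSpace F] {H : W → F}
    {w₀ : W} (hH : AnalyticAt ℂ H w₀) (hbij : Function.Bijective (fderiv ℂ H w₀)) :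
    ∃ Θ : OpenPartialHomeomorph W F, w₀ ∈ Θ.source ∧ (∀ w, Θ w = H w) ∧
      ContDiffOn ℂ ω Θ Θ.source ∧ ContDiffOn ℂ ω Θ.symm Θ.target := by
  have : CompleteSpace W := FiniteDimensional.complete ℂ W
  let e : W ≃L[ℂ] F :=
    (LinearEquiv.ofBijective (fderiv ℂ H w₀ : W →ₗ[ℂ] F) hbij).toContinuousLinearEquiv
  have he : (e : W →L[ℂ] F) = fderiv ℂ H w₀ := rfl
  have hc : ContDiffAt ℂ ω H w₀ := hH.contDiffAt
  have hd : HasFDerivAt H (e : W →L[ℂ] F) w₀ := by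
    exact hH.differentiableAt.hasFDerivAt
  let Θ₀ := hc.toOpenPartialHomeomorph H hd (by simp)
  -- Analyticity of the inverse at every point of the target needs an invertible differential at
  -- every point of the source. Invertibility is an open condition, so the source is shrunk to where
  -- it holds.
  have h1 : ∀ᶠ w in 𝓝 w₀, AnalyticAt ℂ H w ∧ ∃ e' : W ≃L[ℂ] F, (e' : W →L[ℂ] F) = fderiv ℂ H w := by
    refine hH.eventually_analyticAt.and ?_
    have : ContinuousAt (fderiv ℂ H) w₀ := hH.fderiv.continuousAt
    exact this (by rw [← he]; exact ContinuousLinearEquiv.nhds e)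
  obtain ⟨U, hU, hUo, hwU⟩ := eventually_nhds_iff.1 h1
  refine ⟨Θ₀.restrOpen U hUo, ⟨hc.mem_toOpenPartialHomeomorph_source hd (by simp), hwU⟩,
    fun w => rfl, fun w hw => ((hU w hw.2).1.contDiffAt).contDiffWithinAt, fun y hy => ?_⟩
  have hmem := (Θ₀.restrOpen U hUo).map_target hy
  obtain ⟨ha, e', he'⟩ := hU _ hmem.2
  refine ((Θ₀.restrOpen U hUo).contDiffAt_symm hy (f₀' := e') ?_ ha.contDiffAt).contDiffWithinAt
  rw [he']
  exact ha.differentiableAt.hasFDerivAt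

variable {E : Type*} [NormedAddCommGroup E] [NormedSpace ℂ E] [FiniteDimensional ℂ E]
  {E' : Type*} [NormedAddCommGroup E'] [NormedSpace ℂ E']

/-- The holomorphic extension of a parametrization of a maximal totally real submanifold has
invertible differential. -/
theorem bijective_of_isCompl (σ : Conjugation E) {H' : E × E →L[ℂ] E'} {h' : E →L[ℝ] E'}
    (hH : ∀ z, H' (σ.diag z) = h' z) (hinj : Function.Injective h')
    (hcompl : IsCompl h'.range (h'.range.map
      (Complex.I • LinearMap.id : E' →ₗ[ℝ] E'))) : Function.Bijective H' := by
  -- `H'` is determined by `h'` through `E × E` = Δ ⊕ iΔ. Disjointness of the range of `h'` and its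
  -- rotation by i gives injectivity; that they span gives surjectivity.
  have key : ∀ w, H' w = h' (σ.re w) + Complex.I • h' (σ.im w) := by
    intro w
    conv_lhs => rw [← σ.diag_re_add_diag_im w]
    rw [map_add, map_smul, hH, hH]
  constructor
  · refine (injective_iff_map_eq_zero _).2 fun w hw => ?_
    rw [key] at hw
    have hz : ∀ z, h' z = 0 → z = 0 := fun z hz => hinj (hz.trans (map_zero h').symm)
    have h1 : h' (σ.re w) = 0 := by
      refine Submodule.disjoint_def.1 hcompl.disjoint _ ⟨_, rfl⟩ ⟨h' (-σ.im w), ⟨_, rfl⟩, ?_⟩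
      change Complex.I • h' (-σ.im w) = _
      rw [map_neg, smul_neg]
      exact (eq_neg_of_add_eq_zero_left hw).symm
    rw [h1, zero_add, smul_eq_zero] at hw
    have h2 := hw.resolve_left Complex.I_ne_zero
    rw [← σ.diag_re_add_diag_im w, hz _ h1, hz _ h2, map_zero, smul_zero, add_zero]
  · intro y
    have hy : y ∈ h'.range ⊔ _ := hcompl.sup_eq_top ▸ Submodule.mem_top (x := y)
    obtain ⟨_, ⟨u, rfl⟩, _, ⟨_, ⟨v, rfl⟩, rfl⟩, rfl⟩ := Submodule.mem_sup.1 hy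
    refine ⟨σ.diag u + Complex.I • σ.diag v, ?_⟩
    rw [map_add, map_smul, hH, hH]
    rfl


variable {N : Type*} [TopologicalSpace N] [ChartedSpace E N] [IsManifold 𝓘(ℂ, E) ω N]
  [FiniteDimensional ℂ E'] {M : Type*} [TopologicalSpace M] [ChartedSpace E' M]
  [IsManifold 𝓘(ℂ, E') ω M] {f : N → M}

namespace IsComplexification

theorem contMDiff (hf : IsComplexification E E' f) : ContMDiff 𝓘(ℝ, E) 𝓘(ℝ, E') ω f :=
  hf.isEmbedding.contMDiff

theorem realDeriv_injective (hf : IsComplexification E E' f) (p : N) :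
    Function.Injective (realDeriv E E' f p) :=
  Manifold.IsImmersionAt.mfderiv_injective (hf.isEmbedding.isImmersion.isImmersionAt p)

/-- A complexification of `N` has, near each point of `N`, a holomorphic chart with values in
`E × E` that extends a given chart of `N` to the totally real diagonal. -/
theorem exists_chart (hf : IsComplexification E E' f) (σ : Conjugation E) (a : N) :
    ∃ Ψ : OpenPartialHomeomorph M (E × E), IsModelChart ℂ (E := E') Ψ ∧ f a ∈ Ψ.source ∧
      ∀ y, f y ∈ Ψ.source → y ∈ (chartAt E a).source ∧ Ψ (f y) = σ.diag (chartAt E a y) := by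
  have : CompleteSpace E' := FiniteDimensional.complete ℂ E'
  let κ := chartAt E a
  let ψ := chartAt E' (f a)
  let z₀ := κ a
  have ha : a ∈ κ.source := mem_chart_source E a
  have hfa : f a ∈ ψ.source := mem_chart_source E' (f a)
  have hz₀ : z₀ ∈ κ.target := κ.map_source ha
  have hκz : κ.symm z₀ = a := κ.left_inv ha
  have hψ : ContMDiffOn 𝓘(ℂ, E') 𝓘(ℂ, E') ω ψ ψ.source := contMDiffOn_chart
  have hψs : ContMDiffOn 𝓘(ℂ, E') 𝓘(ℂ, E') ω ψ.symm ψ.target := contMDiffOn_chart_symm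
  have hκs : ContMDiffOn 𝓘(ℝ, E) 𝓘(ℝ, E) ω κ.symm κ.target := contMDiffOn_chart_symm
  have hψd : ψ.MDifferentiable 𝓘(ℝ, E') 𝓘(ℝ, E') :=
    ⟨hψ.restrictScalars_real.mdifferentiableOn (by simp),
      hψs.restrictScalars_real.mdifferentiableOn (by simp)⟩
  have hκd : κ.MDifferentiable 𝓘(ℝ, E) 𝓘(ℝ, E) :=
    ⟨(contMDiffOn_chart (n := ω)).mdifferentiableOn (by simp), hκs.mdifferentiableOn (by simp)⟩
  let h : E → E' := ψ ∘ f ∘ κ.symm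
  have hh : AnalyticAt ℝ h z₀ := by
    have h1 : ContMDiffAt 𝓘(ℝ, E) 𝓘(ℝ, E') ω h z₀ := by
      refine ContMDiffAt.comp z₀ (g := ψ) ?_ (ContMDiffAt.comp z₀ (g := f) (hf.contMDiff _)
        (hκs.contMDiffAt (κ.open_target.mem_nhds hz₀)))
      change ContMDiffAt 𝓘(ℝ, E') 𝓘(ℝ, E') ω ψ (f (κ.symm z₀))
      rw [hκz]
      exact hψ.restrictScalars_real.contMDiffAt (ψ.open_source.mem_nhds hfa)
    exact (contMDiffAt_iff_contDiffAt.1 h1).analyticAt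
  -- `H` is the holomorphic extension of `f` read in charts. The chart sought is the inverse of `H`
  -- after the given chart `ψ` of `M`.
  obtain ⟨H, hH, hHh⟩ := σ.exists_holomorphic_extension hh
  have hderiv : ∀ z, fderiv ℂ H (σ.diag z₀) (σ.diag z) = fderiv ℝ h z₀ z := by
    intro z
    have h1 : HasFDerivAt (H ∘ σ.diag) _ z₀ :=
      (hH.differentiableAt.hasFDerivAt.restrictScalars ℝ).comp z₀ σ.diag.hasFDerivAt
    have h2 := h1.unique (hh.differentiableAt.hasFDerivAt.congr_of_eventuallyEq hHh)
    exact DFunLike.congr_fun h2 z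
  have hfa' : f (κ.symm z₀) ∈ ψ.source := by rw [hκz]; exact hfa
  have hψc : ψ.MDifferentiable 𝓘(ℂ, E') 𝓘(ℂ, E') :=
    ⟨hψ.mdifferentiableOn (by simp), hψs.mdifferentiableOn (by simp)⟩
  let A : E' ≃L[ℂ] E' := hψc.mfderiv hfa'
  let B : E →L[ℝ] E := mfderiv 𝓘(ℝ, E) 𝓘(ℝ, E) κ.symm z₀
  let df : E →L[ℝ] E' := realDeriv E E' f (κ.symm z₀)
  have hh' : ∀ z, fderiv ℝ h z₀ z = A (df (B z)) := by
    intro z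
    have h1 : HasMFDerivAt 𝓘(ℝ, E) 𝓘(ℝ, E') h z₀ _ :=
      (HasMFDerivAt.restrictScalars_real (hψc.mdifferentiableAt hfa').hasMFDerivAt).comp z₀
        (((hf.contMDiff _).mdifferentiableAt (by simp)).hasMFDerivAt.comp z₀
          (hκd.symm.mdifferentiableAt hz₀).hasMFDerivAt)
    have h2 : HasFDerivAt h
        (((A : E' →L[ℂ] E').restrictScalars ℝ : E' →L[ℝ] E').comp (df.comp B)) z₀ :=
      h1.hasFDerivAt
    rw [h2.fderiv]
    rfl
  have hbij : Function.Bijective (fderiv ℂ H (σ.diag z₀)) := by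
    have hB : Function.Bijective B :=
      ⟨hκd.symm.mfderiv_injective hz₀, hκd.symm.mfderiv_surjective hz₀⟩
    have hrange : (df.comp B).range = df.range :=
      LinearMap.range_comp_of_range_eq_top _ (LinearMap.range_eq_top.2 hB.2)
    -- Composing with the inverse of the complex-linear `A` moves the question to the tangent space
    -- of `M`, where total reality is assumed.
    have h1 : Function.Bijective (A.symm.toContinuousLinearMap.comp (fderiv ℂ H (σ.diag z₀))) := by
      refine bijective_of_isCompl σ (h' := df.comp B) (fun z => ?_)
        ((hf.realDeriv_injective _).comp hB.1) ?_
      · change A.symm (fderiv ℂ H (σ.diag z₀) (σ.diag z)) = df (B z)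
        rw [hderiv, hh', A.symm_apply_apply]
      · rw [hrange]
        exact hf.totally_real (κ.symm z₀)
    have h2 := A.bijective.comp h1
    convert h2 using 1
    ext w
    simp
  obtain ⟨Θ, hΘ, hΘH, hΘc, hΘs⟩ := exists_openPartialHomeomorph_of_bijective_fderiv hH hbij
  have hev : ∀ᶠ y in 𝓝 a, y ∈ κ.source ∧ H (σ.diag (κ y)) = h (κ y) ∧ σ.diag (κ y) ∈ Θ.source := by
    have hκa : ContinuousAt κ a := κ.continuousAt ha
    refine Filter.Eventually.and (κ.open_source.mem_nhds ha) ((hκa.eventually hHh).and ?_)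
    exact (σ.diag.continuous.continuousAt.comp hκa).eventually (Θ.open_source.mem_nhds hΘ)
  -- Since `f` is a topological embedding, a property of y near `a` follows from `f y` being near `f
  -- a`. This excludes points of `f(N)` in the chart domain that come from far away in `N`.
  rw [hf.isEmbedding.isEmbedding.nhds_eq_comap, Filter.eventually_comap] at hev
  obtain ⟨U, hU, hUo, hfU⟩ := eventually_nhds_iff.1 hev
  refine ⟨(ψ.trans Θ.symm).restrOpen U hUo, ⟨?_, ?_⟩, ⟨⟨hfa, ?_⟩, hfU⟩, ?_⟩
  · exact (hΘs.contMDiffOn.comp (hψ.mono fun y hy => hy.1) fun y hy => hy.2).mono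
      fun y hy => hy.1
  · refine ContMDiffOn.comp (g := ψ.symm) (f := Θ) hψs (hΘc.contMDiffOn.mono fun q hq => ?_)
      fun q hq => ?_
    · exact hq.1.1
    · exact hq.1.2
  · change ψ (f a) ∈ Θ.target
    have h1 : ψ (f a) = Θ (σ.diag z₀) := by
      rw [hΘH, hHh.self_of_nhds]; simp [h, hκz]
    rw [h1]
    exact Θ.map_source hΘ
  · rintro y ⟨hy, hyU⟩
    obtain ⟨h1, h2, h3⟩ := hU (f y) hyU y rfl
    refine ⟨h1, ?_⟩
    change Θ.symm (ψ (f y)) = _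
    have h4 : ψ (f y) = Θ (σ.diag (κ y)) := by
      rw [hΘH, h2]; simp [h, κ.left_inv h1]
    rw [h4, Θ.left_inv h3]

end IsComplexification

end

/-! ### Diagonal charts and the coefficients of extended tensors -/

section

theorem isModelChart_chartAt {𝕜 : Type*} [RCLike 𝕜] {E : Type*} [NormedAddCommGroup E]
    [NormedSpace 𝕜 E] {N : Type*} [TopologicalSpace N] [ChartedSpace E N]
    [IsManifold 𝓘(𝕜, E) ω N] (a : N) : IsModelChart 𝕜 (E := E) (chartAt E a) :=
  ⟨contMDiffOn_chart, contMDiffOn_chart_symm⟩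

section

variable {E : Type*} [NormedAddCommGroup E] [NormedSpace ℂ E] [FiniteDimensional ℂ E]
  {N : Type*} [TopologicalSpace N] [ChartedSpace E N] [IsManifold 𝓘(ℂ, E) ω N]
  {E' : Type*} [NormedAddCommGroup E'] [NormedSpace ℂ E'] [FiniteDimensional ℂ E']
  {M : Type*} [TopologicalSpace M] [ChartedSpace E' M] [IsManifold 𝓘(ℂ, E') ω M]

/-- `Ψ` is a holomorphic chart near `f a` in which `f` is the totally real diagonal. -/
structure IsDiagonalChart (σ : Conjugation E) (f : N → M) (a : N)
    (Ψ : OpenPartialHomeomorph M (E × E)) : Prop where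
  chart : IsModelChart ℂ (E := E') Ψ
  mem_source : f a ∈ Ψ.source
  apply_eq : ∀ y, f y ∈ Ψ.source → y ∈ (chartAt E a).source ∧ Ψ (f y) = σ.diag (chartAt E a y)
  symm_diag : ∀ z, σ.diag z ∈ Ψ.target →
    z ∈ (chartAt E a).target ∧ Ψ.symm (σ.diag z) = f ((chartAt E a).symm z)

theorem IsComplexification.exists_isDiagonalChart
    {f : N → M} (hf : IsComplexification E E' f) (σ : Conjugation E) (a : N) :
    ∃ Ψ : OpenPartialHomeomorph M (E × E), IsDiagonalChart (E' := E') σ f a Ψ := by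
  obtain ⟨Ψ, hΨ, ha, hap⟩ := hf.exists_chart σ a
  let κ := chartAt E a
  -- Restricting the source to points whose coordinates have real part in `Z` forces every point of
  -- Δ in the target to be the image of a point of `N`.
  let Z : Set E := κ.target ∩ κ.symm ⁻¹' (f ⁻¹' Ψ.source)
  have hZ : IsOpen Z :=
    κ.isOpen_inter_preimage_symm (Ψ.open_source.preimage hf.contMDiff.continuous)
  have hs : IsOpen (Ψ.source ∩ Ψ ⁻¹' (σ.re ⁻¹' Z)) :=
    Ψ.isOpen_inter_preimage (hZ.preimage σ.re.continuous)
  have hκ : a ∈ κ.source := mem_chart_source E a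
  have haZ : κ a ∈ Z := ⟨κ.map_source hκ, by simpa [κ.left_inv hκ] using ha⟩
  refine ⟨Ψ.restrOpen _ hs, ⟨⟨hΨ.contMDiffOn.mono fun y hy => hy.1,
    hΨ.contMDiffOn_symm.mono fun y hy => hy.1⟩, ⟨ha, ha, ?_⟩, fun y hy => hap y hy.1, ?_⟩⟩
  · change σ.re (Ψ (f a)) ∈ Z
    rw [(hap a ha).2, σ.re_diag]
    exact haZ
  · intro z hz
    have h1 : σ.re (Ψ (Ψ.symm (σ.diag z))) ∈ Z := hz.2.2
    rw [Ψ.right_inv hz.1, σ.re_diag] at h1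
    refine ⟨h1.1, ?_⟩
    have h2 := (hap _ h1.2).2
    rw [κ.right_inv h1.1] at h2
    change Ψ.symm (σ.diag z) = _
    rw [← h2, Ψ.left_inv h1.2]

/-- The complex bilinear form `bc` at `f y` pulls back to `b` at `y`. -/
def BilinField.ExtendsAt (b : BilinField ℝ E N) (f : N → M) (bc : BilinField ℂ E' M) (y : N) :
    Prop :=
  ∀ u v : TangentSpace 𝓘(ℝ, E) y,
    bc (f y) (toHol (realDeriv E E' f y u)) (toHol (realDeriv E E' f y v)) = ((b y u v : ℝ) : ℂ)

/-- The complex-linear endomorphism `Ac` at `f y` pulls back to `A` at `y`. -/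
def EndField.ExtendsAt (A : EndField ℝ E N) (f : N → M) (Ac : EndField ℂ E' M) (y : N) : Prop :=
  ∀ u : TangentSpace 𝓘(ℝ, E) y,
    Ac (f y) (toHol (realDeriv E E' f y u)) = toHol (realDeriv E E' f y (A y u))

/-- Formulated with vectors in the model space so that the base point `Ψ.symm q` can be replaced by
an equal point without transporting tangent vectors. -/
theorem BilinField.inChart_apply_of_eq {Ψ : OpenPartialHomeomorph M (E × E)}
    (b : BilinField ℂ E' M) {q : E × E} {x : M} (hx : Ψ.symm q = x) {u v : E × E} {u' v' : E'}
    (hu : (chartDInv ℂ (E := E') Ψ q u : E') = u') (hv : (chartDInv ℂ (E := E') Ψ q v : E') = v') :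
    b.inChart Ψ q u v = b x u' v' := by
  subst hx hu hv
  rfl

namespace IsDiagonalChart

variable {σ : Conjugation E} {f : N → M} {a : N} {Ψ : OpenPartialHomeomorph M (E × E)}
  (h : IsDiagonalChart (E' := E') σ f a Ψ)
include h

theorem diag_mem_target : σ.diag (chartAt E a a) ∈ Ψ.target := by
  rw [← (h.apply_eq a h.mem_source).2]
  exact Ψ.map_source h.mem_source

variable {z : E} (hz : σ.diag z ∈ Ψ.target)
include hz

theorem mem_target : z ∈ (chartAt E a).target := (h.symm_diag z hz).1

/-- The chain rule applied to Ψ⁻¹ ∘ `σ.diag` = f ∘ κ⁻¹, an equality near z. -/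
theorem chartDInv_diag (hf : IsComplexification E E' f) (u : E) :
    (chartDInv ℂ (E := E') Ψ (σ.diag z) (σ.diag u) : E') =
      realDeriv E E' f ((chartAt E a).symm z) (chartDInv ℝ (chartAt E a) z u) := by
  have hκ : IsModelChart ℝ (E := E) (chartAt E a) := isModelChart_chartAt a
  have h1 : HasMFDerivAt 𝓘(ℝ, E) 𝓘(ℝ, E') (Ψ.symm ∘ σ.diag) z _ :=
    (HasMFDerivAt.restrictScalars_real (h.chart.mdifferentiableAt_symm hz).hasMFDerivAt).comp z
      (σ.diag.hasMFDerivAt (x := z))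
  have h2 : HasMFDerivAt 𝓘(ℝ, E) 𝓘(ℝ, E') (f ∘ (chartAt E a).symm) z _ :=
    ((hf.contMDiff _).mdifferentiableAt (by simp)).hasMFDerivAt.comp z
      (hκ.mdifferentiableAt_symm (h.mem_target hz)).hasMFDerivAt
  have h3 : Ψ.symm ∘ σ.diag =ᶠ[𝓝 z] f ∘ (chartAt E a).symm := by
    filter_upwards [(Ψ.open_target.preimage σ.diag.continuous).mem_nhds hz] with z' hz'
    exact (h.symm_diag z' hz').2
  have h4 := hasMFDerivAt_unique h1 (h2.congr_of_eventuallyEq h3)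
  exact DFunLike.congr_fun h4 u

theorem bilin_inChart_diag (hf : IsComplexification E E' f) {b : BilinField ℝ E N}
    {bc : BilinField ℂ E' M} (hb : b.ExtendsAt f bc ((chartAt E a).symm z)) (u v : E) :
    bc.inChart Ψ (σ.diag z) (σ.diag u) (σ.diag v) = (b.inChart (chartAt E a) z u v : ℂ) := by
  rw [bc.inChart_apply_of_eq (h.symm_diag z hz).2 (h.chartDInv_diag hz hf u)
    (h.chartDInv_diag hz hf v)]
  exact hb _ _

theorem end_inChart_diag (hf : IsComplexification E E' f) {A : EndField ℝ E N}
    {Ac : EndField ℂ E' M} (hA : A.ExtendsAt f Ac ((chartAt E a).symm z)) (u : E) :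
    Ac.inChart Ψ (σ.diag z) (σ.diag u) = σ.diag (A.inChart (chartAt E a) z u) := by
  have hκ : IsModelChart ℝ (E := E) (chartAt E a) := isModelChart_chartAt a
  have key : ∀ {x : M} (hx : Ψ.symm (σ.diag z) = x) {u' w : E'}
      (hu : (chartDInv ℂ (E := E') Ψ (σ.diag z) (σ.diag u) : E') = u')
      (hw : (chartDInv ℂ (E := E') Ψ (σ.diag z)
        (σ.diag (A.inChart (chartAt E a) z u)) : E') = w), (Ac x u' : E') = w →
      Ac.inChart Ψ (σ.diag z) (σ.diag u) = σ.diag (A.inChart (chartAt E a) z u) := by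
    intro x hx u' w hu hw h1
    subst hx hu hw
    rw [EndField.inChart_apply]
    exact (congrArg (chartD ℂ (E := E') Ψ (σ.diag z)) h1).trans (h.chart.chartD_chartDInv hz _)
  refine key (h.symm_diag z hz).2 (h.chartDInv_diag hz hf u) (h.chartDInv_diag hz hf _) ?_
  refine (hA _).trans (congrArg (realDeriv E E' f ((chartAt E a).symm z)) ?_)
  rw [EndField.inChart_apply]
  exact (hκ.chartDInv_chartD (h.mem_target hz) _).symm

end IsDiagonalChart

/-- In a holomorphic chart the complex structure is multiplication by `i`. -/
theorem complexStructure_inChart {κ : OpenPartialHomeomorph N E} (hκ : IsModelChart ℂ (E := E) κ)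
    {z : E} (hz : z ∈ κ.target) (u : E) :
    (complexStructure E N).inChart κ z u = Complex.I • u := by
  rw [EndField.inChart_apply, hκ.chartD_real hz]
  have h1 : toHol (complexStructure E N (κ.symm z) (chartDInv ℝ κ z u)) =
      Complex.I • chartDInv ℂ (E := E) κ z u :=
    congrArg (fun w : E => Complex.I • w) (hκ.chartDInv_real hz u)
  rw [h1]
  exact ((chartD ℂ κ z).map_smul _ _).trans
    (congrArg (fun w => Complex.I • w) (hκ.chartD_chartDInv hz u))

end

end

/-! ### Closedness of the fundamental form of a Kähler metric -/

section

section ConstField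

variable {𝕜 : Type*} [RCLike 𝕜] {E : Type*} [NormedAddCommGroup E] [NormedSpace 𝕜 E]
  {M : Type*} [TopologicalSpace M] [ChartedSpace E M] [IsManifold 𝓘(𝕜, E) ω M]
  {W : Type*} [NormedAddCommGroup W] [NormedSpace 𝕜 W] {Ψ : OpenPartialHomeomorph M W}

variable (𝕜) in
/-- The vector field with constant coordinates `c` in the chart `Ψ`. -/
def constField (Ψ : OpenPartialHomeomorph M W) (c : W) : VecField 𝕜 E M :=
  fun y => (chartDInv 𝕜 (E := E) Ψ (Ψ y) c : E)

namespace IsModelChart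

variable (hΨ : IsModelChart 𝕜 (E := E) Ψ) {q : W} (hq : q ∈ Ψ.target)
include hΨ hq

theorem inChart_constField (c : W) : (constField 𝕜 (E := E) Ψ c).inChart 𝕜 Ψ q = c := by
  have key : ∀ p, p = q → chartD 𝕜 (E := E) Ψ q (chartDInv 𝕜 (E := E) Ψ p c : E) = c := by
    rintro _ rfl
    exact hΨ.chartD_chartDInv hq c
  exact key _ (Ψ.right_inv hq)

theorem constField_symm_apply (c : W) :
    constField 𝕜 (E := E) Ψ c (Ψ.symm q) = chartDInv 𝕜 (E := E) Ψ q c := by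
  rw [← hΨ.chartDInv_chartD hq (constField 𝕜 (E := E) Ψ c (Ψ.symm q))]
  exact congrArg _ (hΨ.inChart_constField hq c)

theorem hasFDerivAt_inChart_of_eventually {X : VecField 𝕜 E M} {c : W}
    (hX : ∀ᶠ q' in 𝓝 q, X.inChart 𝕜 Ψ q' = c) :
    HasFDerivAt (X.inChart 𝕜 Ψ) (0 : W →L[𝕜] W) q :=
  (hasFDerivAt_const c q).congr_of_eventuallyEq hX

theorem eventually_inChart_constField (c : W) :
    ∀ᶠ q' in 𝓝 q, (constField 𝕜 (E := E) Ψ c).inChart 𝕜 Ψ q' = c :=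
  Filter.eventually_of_mem (Ψ.open_target.mem_nhds hq) fun _ h => hΨ.inChart_constField h c

/-- The Christoffel symbols of the Levi-Civita connection of a metric for which the endomorphism
field `A`, constant in the chart, is parallel. -/
theorem exists_christoffel_of_leviCivita [CompleteSpace E] [CompleteSpace W]
    {g : BilinField 𝕜 E M} (hg : DifferentiableAt 𝕜 (g.inChart Ψ) q)
    {cov : TangentConnection 𝕜 E M} (hcov : IsLeviCivitaOn univ g cov) {A : EndField 𝕜 E M}
    {P : W →L[𝕜] W} (hA : ∀ᶠ q' in 𝓝 q, A.inChart Ψ q' = P) (hpar : ParallelOn univ cov A) :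
    ∃ Γ : W → W → W, (∀ a b, Γ a b = Γ b a) ∧
      ∀ a b c, fderiv 𝕜 (g.inChart Ψ) q a (P b) c =
        g.inChart Ψ q (P (Γ a b)) c + g.inChart Ψ q (P b) (Γ a c) := by
  have hC : ∀ c, VecField.DiffAt (constField 𝕜 (E := E) Ψ c) (Ψ.symm q) := fun c =>
    hΨ.diffAt_of_inChart hq (hΨ.hasFDerivAt_inChart_of_eventually hq
      (hΨ.eventually_inChart_constField hq c)).differentiableAt
  have hD : ∀ c, fderiv 𝕜 ((constField 𝕜 (E := E) Ψ c).inChart 𝕜 Ψ) q = 0 := fun c =>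
    (hΨ.hasFDerivAt_inChart_of_eventually hq (hΨ.eventually_inChart_constField hq c)).fderiv
  -- `Γ a b` is the covariant derivative of the constant field `b` in direction `a`. Linearity of
  -- `Γ` is not needed.
  refine ⟨fun a b => chartD 𝕜 Ψ q (cov (constField 𝕜 Ψ b) (Ψ.symm q) (chartDInv 𝕜 Ψ q a)),
    fun a b => ?_, fun a b c => ?_⟩
  · have h1 := hcov.torsion_free (Ψ.symm q) (mem_univ _) (constField 𝕜 Ψ a) (constField 𝕜 Ψ b)
      (hC a) (hC b)
    have h2 := congrArg (chartD 𝕜 Ψ q) h1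
    rw [hΨ.chartD_mlieBracket hq (hC a) (hC b), hD, hD, map_sub, hΨ.constField_symm_apply hq,
      hΨ.constField_symm_apply hq] at h2
    exact sub_eq_zero.1 (h2.trans (sub_self _))
  -- Metric compatibility is applied to `A` of the constant field `b` and to the constant field `c`.
  -- The former again has constant coordinates `P b`, and parallelism moves `A` out of its covariant
  -- derivative.
  · have hAX : ∀ᶠ q' in 𝓝 q,
        VecField.inChart 𝕜 Ψ (fun y => A y (constField 𝕜 (E := E) Ψ b y)) q' = P b := by
      filter_upwards [hΨ.inChart_apply_eventuallyEq hq hA (constField 𝕜 (E := E) Ψ b),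
        hΨ.eventually_inChart_constField hq b] with q' h1 h2
      rw [h1, h2]
    have hAD := hΨ.hasFDerivAt_inChart_of_eventually hq hAX
    have hAd := hΨ.diffAt_of_inChart hq hAD.differentiableAt
    have h1 := hcov.metric (Ψ.symm q) (mem_univ _) _ (constField 𝕜 Ψ c) hAd (hC c)
      (chartDInv 𝕜 Ψ q a)
    rw [hΨ.mvfderiv_bilin_apply hq hg hAd (hC c), hD, hAD.fderiv,
      hpar (Ψ.symm q) (mem_univ _) _ (hC b), hΨ.apply_eq_inChart hq, hΨ.apply_eq_inChart hq,
      hΨ.chartD_apply_eq_inChart hq, hA.self_of_nhds, hΨ.chartD_chartDInv hq,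
      hAX.self_of_nhds, hΨ.inChart_constField hq] at h1
    have h2 : chartD 𝕜 Ψ q (A (Ψ.symm q) (constField 𝕜 (E := E) Ψ b (Ψ.symm q))) = P b :=
      hAX.self_of_nhds
    have h3 : chartD 𝕜 Ψ q (constField 𝕜 (E := E) Ψ c (Ψ.symm q)) = c :=
      hΨ.inChart_constField hq c
    rw [h2, h3] at h1
    simpa using h1

end IsModelChart
end ConstField

section Kahler

variable {E : Type*} [NormedAddCommGroup E] [NormedSpace ℂ E] [FiniteDimensional ℂ E]
  {N : Type*} [TopologicalSpace N] [ChartedSpace E N] [IsManifold 𝓘(ℂ, E) ω N]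
  {g b : BilinField ℝ E N} {κ : OpenPartialHomeomorph N E}

variable (E) in
/-- Multiplication by `i` as a real-linear map. -/
def mulI : E →L[ℝ] E := (Complex.I • ContinuousLinearMap.id ℂ E).restrictScalars ℝ

@[simp] theorem mulI_apply (u : E) : mulI E u = Complex.I • u := rfl

namespace IsKahler

variable (hK : IsKahler g b) (hκ : IsModelChart ℂ (E := E) κ) {z : E} (hz : z ∈ κ.target)
include hK hκ hz

theorem inChart_compatible (u v : E) :
    b.inChart κ z u v = g.inChart κ z (Complex.I • u) v := by
  rw [← complexStructure_inChart hκ hz u, BilinField.inChart_apply, hK.compatible,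
    EndField.inChart_apply, BilinField.inChart_apply,
    hκ.restrictScalars_real.chartDInv_chartD hz]

theorem inChart_skew (u v : E) : b.inChart κ z u v = -b.inChart κ z v u := by
  have h : ∀ u, b.inChart κ z u u = 0 := fun u => hK.alternating _ (mem_univ _) _
  have h1 := h (u + v)
  simp only [map_add, add_apply, h, zero_add, add_zero] at h1
  exact eq_neg_of_add_eq_zero_right h1

/-- In a holomorphic chart the form is the metric precomposed with the constant map i, so it
inherits its analyticity. -/
theorem contDiffAt_inChart (hg : g.AnalyticAt (κ.symm z)) : ContDiffAt ℝ ω (b.inChart κ) z := by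
  have : FiniteDimensional ℝ E := FiniteDimensional.complexToReal E
  have h1 := hκ.restrictScalars_real.contDiffAt_bilin_inChart hz hg
  refine (h1.clm_comp (contDiffAt_const (c := mulI E))).congr_of_eventuallyEq ?_
  filter_upwards [κ.open_target.mem_nhds hz] with z' hz'
  ext u v
  exact hK.inChart_compatible hκ hz' u v

/-- The fundamental form of a Kähler metric is closed. -/
theorem inChart_closed (hg : g.AnalyticAt (κ.symm z)) (u v w : E) :
    fderiv ℝ (b.inChart κ) z u v w - fderiv ℝ (b.inChart κ) z v u w +
      fderiv ℝ (b.inChart κ) z w u v = 0 := by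
  have : FiniteDimensional ℝ E := FiniteDimensional.complexToReal E
  have : CompleteSpace E := FiniteDimensional.complete ℂ E
  have hκr := hκ.restrictScalars_real
  have hG := (hκr.contDiffAt_bilin_inChart hz hg).differentiableAt (by simp)
  have hB := (hK.contDiffAt_inChart hκ hz hg).differentiableAt (by simp)
  have hI : ∀ᶠ z' in 𝓝 z, (complexStructure E N).inChart κ z' = mulI E := by
    filter_upwards [κ.open_target.mem_nhds hz] with z' hz'
    ext u
    exact complexStructure_inChart hκ hz' u
  obtain ⟨cov, hcov, hpar⟩ := hK.parallel
  obtain ⟨Γ, hs, hΓ⟩ := hκr.exists_christoffel_of_leviCivita hz hG hcov hI hpar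
  -- The form is itself parallel. Symmetry of `Γ` and skewness of the form then cancel the cyclic
  -- sum.
  have hc : ∀ u v w, fderiv ℝ (b.inChart κ) z u v w =
      b.inChart κ z (Γ u v) w + b.inChart κ z v (Γ u w) := by
    intro u v w
    have h1 : fderiv ℝ (b.inChart κ) z u v w = fderiv ℝ (g.inChart κ) z u (mulI E v) w :=
      fderiv_clm₂_congr hB hG (by
        filter_upwards [κ.open_target.mem_nhds hz] with z' hz'
        exact hK.inChart_compatible hκ hz' v w) u
    rw [h1, hΓ, hK.inChart_compatible hκ hz, hK.inChart_compatible hκ hz]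
    rfl
  rw [hc, hc, hc, hs v u, hs w u, hs w v]
  linear_combination hK.inChart_skew hκ hz v (Γ u w)

end IsKahler
end Kahler

end

/-! ### Continuation of tensor identities from the diagonal -/

section

namespace Conjugation

variable {E : Type*} [NormedAddCommGroup E] [NormedSpace ℂ E] (σ : Conjugation E)
  {F : Type*} [NormedAddCommGroup F] [NormedSpace ℂ F]

theorem eq_zero_of_diag {b : E × E → F} (h1 : ∃ L : E × E →L[ℂ] F, ∀ u, b u = L u)
    (h : ∀ u, b (σ.diag u) = 0) (u : E × E) : b u = 0 := by
  obtain ⟨L, hL⟩ := h1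
  rw [hL]
  exact σ.ext_diag (L' := (0 : E × E →L[ℂ] F)) (fun u => by rw [← hL, h]; rfl) u

/-- A holomorphic family of linear maps that vanishes on the diagonal vanishes. -/
theorem eventually_eq_zero_of_diag [CompleteSpace F] {z₀ : E} {T : Set (E × E)}
    (hT : T ∈ 𝓝 (σ.diag z₀)) {b : E × E → E × E → F}
    (hd : ∀ q ∈ T, ∀ u, DifferentiableAt ℂ (fun q => b q u) q)
    (h1 : ∀ q ∈ T, ∃ L : E × E →L[ℂ] F, ∀ u, b q u = L u)
    (h : ∀ z, σ.diag z ∈ T → ∀ u, b (σ.diag z) (σ.diag u) = 0) :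
    ∀ᶠ q in 𝓝 (σ.diag z₀), ∀ u, b q u = 0 := by
  obtain ⟨S, hS, -, hid⟩ := σ.eqOn_zero_of_diag (F := F) z₀ hT
  filter_upwards [hS] with q hq u
  exact hid (fun q => b q u) (fun q hq => hd q hq u) (fun z hz =>
    σ.eq_zero_of_diag (h1 _ hz) (h z hz) u) q hq

/-- A holomorphic family of bilinear forms that vanishes on the diagonal vanishes. -/
theorem eventually_eq_zero_of_diag₂ [CompleteSpace F] {z₀ : E} {T : Set (E × E)}
    (hT : T ∈ 𝓝 (σ.diag z₀)) {b : E × E → E × E → E × E → F}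
    (hd : ∀ q ∈ T, ∀ u v, DifferentiableAt ℂ (fun q => b q u v) q)
    (h1 : ∀ q ∈ T, ∀ v, ∃ L : E × E →L[ℂ] F, ∀ u, b q u v = L u)
    (h2 : ∀ q ∈ T, ∀ u, ∃ L : E × E →L[ℂ] F, ∀ v, b q u v = L v)
    (h : ∀ z, σ.diag z ∈ T → ∀ u v, b (σ.diag z) (σ.diag u) (σ.diag v) = 0) :
    ∀ᶠ q in 𝓝 (σ.diag z₀), ∀ u v, b q u v = 0 := by
  obtain ⟨S, hS, -, hid⟩ := σ.eqOn_zero_of_diag (F := F) z₀ hT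
  filter_upwards [hS] with q hq u v
  exact hid (fun q => b q u v) (fun q hq => hd q hq u v) (fun z hz =>
    σ.eq_zero_of_diag (h1 _ hz v) (fun u => σ.eq_zero_of_diag (h2 _ hz _) (h z hz u) v) u) q hq

/-- A holomorphic family of trilinear forms that vanishes on the diagonal vanishes. -/
theorem eventually_eq_zero_of_diag₃ [CompleteSpace F] {z₀ : E} {T : Set (E × E)}
    (hT : T ∈ 𝓝 (σ.diag z₀)) {b : E × E → E × E → E × E → E × E → F}
    (hd : ∀ q ∈ T, ∀ u v w, DifferentiableAt ℂ (fun q => b q u v w) q)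
    (h1 : ∀ q ∈ T, ∀ v w, ∃ L : E × E →L[ℂ] F, ∀ u, b q u v w = L u)
    (h2 : ∀ q ∈ T, ∀ u w, ∃ L : E × E →L[ℂ] F, ∀ v, b q u v w = L v)
    (h3 : ∀ q ∈ T, ∀ u v, ∃ L : E × E →L[ℂ] F, ∀ w, b q u v w = L w)
    (h : ∀ z, σ.diag z ∈ T → ∀ u v w, b (σ.diag z) (σ.diag u) (σ.diag v) (σ.diag w) = 0) :
    ∀ᶠ q in 𝓝 (σ.diag z₀), ∀ u v w, b q u v w = 0 := by
  obtain ⟨S, hS, -, hid⟩ := σ.eqOn_zero_of_diag (F := F) z₀ hT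
  filter_upwards [hS] with q hq u v w
  exact hid (fun q => b q u v w) (fun q hq => hd q hq u v w) (fun z hz =>
    σ.eq_zero_of_diag (h1 _ hz v w) (fun u => σ.eq_zero_of_diag (h2 _ hz _ w)
      (fun v => σ.eq_zero_of_diag (h3 _ hz _ _) (h z hz u v) w) v) u) q hq

/-- Antilinearity of σ gives i(iu, σ(iu)) = (-u, σ u). This is what identifies I₀ᶜ with -i diag(-1,
1) on Δ, hence F with diag(-1, 1). -/
theorem paraDiag_diag (u : E) : paraDiag E (σ.diag u) = Complex.I • σ.diag (Complex.I • u) := by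
  refine Prod.ext ?_ ?_
  · simp [smul_smul]
  · simp [σ.map_I, smul_smul]

end Conjugation

/-- The cyclic sum expressing the exterior derivative of a two-form. -/
def cyclicSum {W : Type*} [NormedAddCommGroup W] [NormedSpace ℂ W]
    (T : W →L[ℂ] W →L[ℂ] W →L[ℂ] ℂ) (u v w : W) : ℂ := T u v w - T v u w + T w u v

section CyclicSum

variable {W : Type*} [NormedAddCommGroup W] [NormedSpace ℂ W] (T : W →L[ℂ] W →L[ℂ] W →L[ℂ] ℂ)

/-- Linearity in each argument, recorded in the form that `eventually_eq_zero_of_diag₃` consumes. -/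
theorem cyclicSum_linear₁ (v w : W) : ∃ L : W →L[ℂ] ℂ, ∀ u, cyclicSum T u v w = L u :=
  ⟨(T.flip v).flip w - (T v).flip w + (T w).flip v, fun _ => rfl⟩

theorem cyclicSum_linear₂ (u w : W) : ∃ L : W →L[ℂ] ℂ, ∀ v, cyclicSum T u v w = L v :=
  ⟨(T u).flip w - (T.flip u).flip w + T w u, fun _ => rfl⟩

theorem cyclicSum_linear₃ (u v : W) : ∃ L : W →L[ℂ] ℂ, ∀ w, cyclicSum T u v w = L w :=
  ⟨T u v - T v u + (T.flip u).flip v, fun _ => rfl⟩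

theorem ContDiffAt.differentiableAt_fderiv_apply {W V : Type*} [NormedAddCommGroup W] [NormedSpace ℂ W]
    [NormedAddCommGroup V] [NormedSpace ℂ V] {B : W → V} {q : W} (hB : ContDiffAt ℂ ω B q)
    (u : W) : DifferentiableAt ℂ (fun q => fderiv ℂ B q u) q :=
  ((hB.fderiv_right (m := 1) le_top).differentiableAt one_ne_zero).clm_apply
    (differentiableAt_const u)

theorem ContDiffAt.const_smul_complex {W V : Type*} [NormedAddCommGroup W] [NormedSpace ℂ W]
    [NormedAddCommGroup V] [NormedSpace ℂ V] {B : W → V} {q : W} {n : ℕ∞ω}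
    (hB : ContDiffAt ℂ n B q) (c : ℂ) : ContDiffAt ℂ n (fun q => c • B q) q :=
  hB.const_smul c

theorem ContDiffAt.of_eq_const_mul {W : Type*} [NormedAddCommGroup W] [NormedSpace ℂ W]
    {B B' : W → W →L[ℂ] W →L[ℂ] ℂ} {q : W} {n : ℕ∞ω} (hB : ContDiffAt ℂ n B q) (c : ℂ)
    (h : ∀ q u v, B' q u v = c * B q u v) : ContDiffAt ℂ n B' q := by
  have : B' = fun q => c • B q :=
    funext fun q => ContinuousLinearMap.ext fun u => ContinuousLinearMap.ext fun v => h q u v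
  rw [this]
  exact ContDiffAt.const_smul_complex hB c

theorem differentiableAt_cyclicSum {B : W → W →L[ℂ] W →L[ℂ] ℂ} {q : W} (hB : ContDiffAt ℂ ω B q)
    (u v w : W) : DifferentiableAt ℂ (fun q => cyclicSum (fderiv ℂ B q) u v w) q := by
  have h2 : ∀ u v w, DifferentiableAt ℂ (fun q => fderiv ℂ B q u v w) q := fun u v w =>
    (hasFDerivAt_clm₂_apply (B := fun q => fderiv ℂ B q u) 
      (ContDiffAt.differentiableAt_fderiv_apply hB u) v w).differentiableAt
  unfold cyclicSum
  exact ((h2 u v w).sub (h2 v u w)).add (h2 w u v)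

end CyclicSum

/-- Nondegeneracy is invertibility of the induced map to the dual, and the invertible maps form an
open set. -/
theorem ContinuousLinearMap.eventually_nondegenerate {W : Type*} [NormedAddCommGroup W]
    [NormedSpace ℂ W] [FiniteDimensional ℂ W] {X : Type*} [TopologicalSpace X]
    {G : X → W →L[ℂ] W →L[ℂ] ℂ} {x : X} (hG : ContinuousAt G x)
    (h : ∀ u, (∀ v, G x u v = 0) → u = 0) :
    ∀ᶠ y in 𝓝 x, ∀ u, (∀ v, G y u v = 0) → u = 0 := by
  have : CompleteSpace W := FiniteDimensional.complete ℂ W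
  obtain ⟨e, he⟩ := exists_equiv_of_nondegenerate h
  have he' : (e : W →L[ℂ] (W →L[ℂ] ℂ)) = G x := ContinuousLinearMap.ext he
  have h1 : range ((↑) : (W ≃L[ℂ] (W →L[ℂ] ℂ)) → (W →L[ℂ] (W →L[ℂ] ℂ))) ∈ 𝓝 (G x) := by
    rw [← he']; exact ContinuousLinearEquiv.nhds e
  filter_upwards [hG.eventually h1]
  rintro y ⟨e', he'⟩ u hu
  have : e' u = 0 := by
    refine ContinuousLinearMap.ext fun v => ?_
    have := congrArg (fun L : W →L[ℂ] (W →L[ℂ] ℂ) => L u v) he'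
    exact this.trans (hu v)
  exact (map_eq_zero_iff e' e'.injective).1 this

theorem IsAdaptedOn.mono {E : Type*} [NormedAddCommGroup E] [NormedSpace ℂ E]
    {E' : Type*} [NormedAddCommGroup E'] [NormedSpace ℂ E']
    {M : Type*} [TopologicalSpace M] [ChartedSpace E' M] [IsManifold 𝓘(ℂ, E') ω M]
    {Ψ : OpenPartialHomeomorph M (E × E)} {S S' : Set (E × E)} {g : BilinField ℂ E' M}
    {F : EndField ℂ E' M} {b : BilinField ℂ E' M} (h : IsAdaptedOn Ψ S g F b) (hS' : IsOpen S')
    (hSS' : S' ⊆ S) : IsAdaptedOn Ψ S' g F b where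
  chart := h.chart
  isOpen := hS'
  subset := hSS'.trans h.subset
  analyticAt_g q hq := h.analyticAt_g q (hSS' hq)
  analyticAt_b q hq := h.analyticAt_b q (hSS' hq)
  inChart_F q hq := h.inChart_F q (hSS' hq)
  symm q hq := h.symm q (hSS' hq)
  nondegenerate q hq := h.nondegenerate q (hSS' hq)
  alternating q hq := h.alternating q (hSS' hq)
  compatible q hq := h.compatible q (hSS' hq)
  closed q hq := h.closed q (hSS' hq)

section

variable {E : Type*} [NormedAddCommGroup E] [NormedSpace ℂ E] [FiniteDimensional ℂ E]
  {N : Type*} [TopologicalSpace N] [ChartedSpace E N] [IsManifold 𝓘(ℂ, E) ω N]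
  {E' : Type*} [NormedAddCommGroup E'] [NormedSpace ℂ E'] [FiniteDimensional ℂ E']
  {M : Type*} [TopologicalSpace M] [ChartedSpace E' M] [IsManifold 𝓘(ℂ, E') ω M]

namespace IsDiagonalChart

variable {σ : Conjugation E} {f : N → M} {a : N} {Ψ : OpenPartialHomeomorph M (E × E)}
  (h : IsDiagonalChart (E' := E') σ f a Ψ) {z : E} (hz : σ.diag z ∈ Ψ.target)
include h hz

/-- Derivatives in directions tangent to Δ only see the restriction to Δ, where the coefficients are
those of `b`. This is why closedness passes to the extension. -/
theorem fderiv_bilin_inChart_diag (hf : IsComplexification E E' f) {b : BilinField ℝ E N}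
    {bc : BilinField ℂ E' M} (hb : ∀ y, b.ExtendsAt f bc y)
    (hbc : DifferentiableAt ℂ (bc.inChart Ψ) (σ.diag z))
    (hbd : DifferentiableAt ℝ (b.inChart (chartAt E a)) z) (u v w : E) :
    fderiv ℂ (bc.inChart Ψ) (σ.diag z) (σ.diag u) (σ.diag v) (σ.diag w) =
      (fderiv ℝ (b.inChart (chartAt E a)) z u v w : ℂ) := by
  have h1 := ((hasFDerivAt_clm₂_apply hbc (σ.diag v) (σ.diag w)).restrictScalars ℝ).comp z
    σ.diag.hasFDerivAt
  have h2 := Complex.ofRealCLM.hasFDerivAt.comp z (hasFDerivAt_clm₂_apply hbd v w)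
  have h3 := h1.unique (h2.congr_of_eventuallyEq (by
    filter_upwards [(Ψ.open_target.preimage σ.diag.continuous).mem_nhds hz] with z' hz'
    exact h.bilin_inChart_diag hz' hf (hb _) v w))
  exact DFunLike.congr_fun h3 u

end IsDiagonalChart

set_option maxHeartbeats 1000000 in
/-- Near the image of `f` the holomorphic extension of a Kähler structure satisfies the identities
of a bicomplex Kähler structure. -/
theorem IsDiagonalChart.exists_isAdaptedOn {σ : Conjugation E} {f : N → M} {a : N}
    {Ψ : OpenPartialHomeomorph M (E × E)} (h : IsDiagonalChart (E' := E') σ f a Ψ)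
    (hf : IsComplexification E E' f)
    {g₀ ω₀ : BilinField ℝ E N} (hg₀ : ∀ x, g₀.AnalyticAt x) (hg₀s : ∀ x u v, g₀ x u v = g₀ x v u)
    (hg₀d : ∀ x u, g₀ x u u = 0 → u = 0) (hK : IsKahler g₀ ω₀) {U : Set M} {g₀c : BilinField ℂ E' M}
    {I₀c : EndField ℂ E' M} {ω₀c : BilinField ℂ E' M} (hU : IsOpen U) (hfU : range f ⊆ U)
    (hg : IsHolomorphicExtensionBilin f g₀ U g₀c)
    (hI : IsHolomorphicExtensionEnd f (complexStructure E N) U I₀c)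
    (hω : IsHolomorphicExtensionBilin f ω₀ U ω₀c) {g : BilinField ℂ E' M} {F : EndField ℂ E' M}
    (hgg : ∀ x, Complex.I • g x = g₀c x)
    (hF : ∀ x, F x = (I₀c x).comp (complexStructureHol E' M x)) :
    ∃ S, σ.diag (chartAt E a a) ∈ S ∧ IsAdaptedOn Ψ S g F ω₀c := by
  have : CompleteSpace E := FiniteDimensional.complete ℂ E
  have : FiniteDimensional ℝ E := FiniteDimensional.complexToReal E
  have hκ : IsModelChart ℂ (E := E) (chartAt E a) := isModelChart_chartAt a
  let T : Set (E × E) := Ψ.target ∩ Ψ.symm ⁻¹' U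
  have hTo : IsOpen T := Ψ.isOpen_inter_preimage_symm hU
  have hz₀ : σ.diag (chartAt E a a) ∈ Ψ.target := h.diag_mem_target
  have hT₀ : σ.diag (chartAt E a a) ∈ T := by
    refine ⟨hz₀, hfU ?_⟩
    rw [(h.symm_diag _ hz₀).2]
    exact mem_range_self _
  have hTn := hTo.mem_nhds hT₀
  have hGan : ∀ q ∈ T, g₀c.AnalyticAt (Ψ.symm q) := fun q hq =>
    ContMDiffOn.contMDiffAt hg.holomorphic (hU.mem_nhds hq.2)
  have hωan : ∀ q ∈ T, ω₀c.AnalyticAt (Ψ.symm q) := fun q hq =>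
    ContMDiffOn.contMDiffAt hω.holomorphic (hU.mem_nhds hq.2)
  have hIan : ∀ q ∈ T, I₀c.AnalyticAt (Ψ.symm q) := fun q hq =>
    ContMDiffOn.contMDiffAt hI.holomorphic (hU.mem_nhds hq.2)
  have hG : ∀ q ∈ T, ContDiffAt ℂ ω (g₀c.inChart Ψ) q := fun q hq =>
    h.chart.contDiffAt_bilin_inChart hq.1 (hGan q hq)
  have hΩ : ∀ q ∈ T, ContDiffAt ℂ ω (ω₀c.inChart Ψ) q := fun q hq =>
    h.chart.contDiffAt_bilin_inChart hq.1 (hωan q hq)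
  have hA : ∀ q ∈ T, ContDiffAt ℂ ω (I₀c.inChart Ψ) q := fun q hq =>
    h.chart.contDiffAt_end_inChart hq.1 (hIan q hq)
  have hgx : ∀ x, g x = (-Complex.I) • g₀c x := fun x => by
    rw [← hgg x, smul_smul, neg_mul, Complex.I_mul_I, neg_neg, one_smul]
  have hgq : ∀ q u v, g.inChart Ψ q u v = -Complex.I * g₀c.inChart Ψ q u v := by
    intro q u v
    rw [BilinField.inChart_apply, hgx]
    rfl
  have hFq : ∀ q u, F.inChart Ψ q u = I₀c.inChart Ψ q (Complex.I • u) := by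
    intro q u
    rw [EndField.inChart_apply, hF, EndField.inChart_apply]
    refine congrArg (fun w => chartD ℂ (E := E') Ψ q (I₀c (Ψ.symm q) w)) ?_
    exact ((chartDInv ℂ (E := E') Ψ q).map_smul Complex.I u).symm
  have hdG : ∀ q ∈ T, ∀ u v, DifferentiableAt ℂ (fun q => g₀c.inChart Ψ q u v) q :=
    fun q hq u v => (hasFDerivAt_clm₂_apply ((hG q hq).differentiableAt (by simp)) u v).differentiableAt
  have hdΩ : ∀ q ∈ T, ∀ u v, DifferentiableAt ℂ (fun q => ω₀c.inChart Ψ q u v) q :=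
    fun q hq u v => (hasFDerivAt_clm₂_apply ((hΩ q hq).differentiableAt (by simp)) u v).differentiableAt
  -- This and the next four statements are holomorphic identities obtained by continuation: each is
  -- multilinear in the vectors and holds on Δ for vectors of Δ.
  have hsymm : ∀ᶠ q in 𝓝 (σ.diag (chartAt E a a)), ∀ u v,
      g₀c.inChart Ψ q u v - g₀c.inChart Ψ q v u = 0 := by
    refine σ.eventually_eq_zero_of_diag₂ hTn (fun q hq u v => (hdG q hq u v).sub (hdG q hq v u))
      (fun q _ v => ⟨(g₀c.inChart Ψ q).flip v - g₀c.inChart Ψ q v, fun _ => rfl⟩)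
      (fun q _ u => ⟨g₀c.inChart Ψ q u - (g₀c.inChart Ψ q).flip u, fun _ => rfl⟩)
      fun z hz u v => ?_
    rw [h.bilin_inChart_diag hz.1 hf (hg.pullback _), h.bilin_inChart_diag hz.1 hf (hg.pullback _), sub_eq_zero]
    exact congrArg _ (hg₀s _ _ _)
  have hskew : ∀ᶠ q in 𝓝 (σ.diag (chartAt E a a)), ∀ u v,
      ω₀c.inChart Ψ q u v + ω₀c.inChart Ψ q v u = 0 := by
    refine σ.eventually_eq_zero_of_diag₂ hTn (fun q hq u v => (hdΩ q hq u v).add (hdΩ q hq v u))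
      (fun q _ v => ⟨(ω₀c.inChart Ψ q).flip v + ω₀c.inChart Ψ q v, fun _ => rfl⟩)
      (fun q _ u => ⟨ω₀c.inChart Ψ q u + (ω₀c.inChart Ψ q).flip u, fun _ => rfl⟩)
      fun z hz u v => ?_
    rw [h.bilin_inChart_diag hz.1 hf (hω.pullback _), h.bilin_inChart_diag hz.1 hf (hω.pullback _),
      hK.inChart_skew hκ (h.mem_target hz.1), Complex.ofReal_neg, neg_add_cancel]
  -- This is ω = g(F·,·) with g = -i g₀ᶜ and F = diag(-1, 1) substituted. On Δ it reads ω₀(u, v) =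
  -- g₀(iu, v), since F(diag u) = i diag(iu).
  have hcompat : ∀ᶠ q in 𝓝 (σ.diag (chartAt E a a)), ∀ u v, ω₀c.inChart Ψ q u v +
      Complex.I * g₀c.inChart Ψ q (paraDiag E u) v = 0 := by
    refine σ.eventually_eq_zero_of_diag₂ hTn
      (fun q hq u v => (hdΩ q hq u v).add ((hdG q hq _ v).const_mul _))
      (fun q _ v => ⟨(ω₀c.inChart Ψ q).flip v +
        Complex.I • ((g₀c.inChart Ψ q).flip v).comp (paraDiag E), fun _ => rfl⟩)
      (fun q _ u => ⟨ω₀c.inChart Ψ q u + Complex.I • g₀c.inChart Ψ q (paraDiag E u), fun _ => rfl⟩)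
      fun z hz u v => ?_
    rw [σ.paraDiag_diag, h.bilin_inChart_diag hz.1 hf (hω.pullback _),
      hK.inChart_compatible hκ (h.mem_target hz.1), ← h.bilin_inChart_diag hz.1 hf (hg.pullback _)]
    have h1 := DFunLike.congr_fun
      ((g₀c.inChart Ψ (σ.diag z)).map_smul Complex.I (σ.diag (Complex.I • u))) (σ.diag v)
    rw [h1]
    change _ + Complex.I * (Complex.I * _) = _
    rw [← mul_assoc, Complex.I_mul_I, neg_one_mul]
    exact add_neg_cancel _
  have hpara : ∀ᶠ q in 𝓝 (σ.diag (chartAt E a a)), ∀ u : E × E,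
      I₀c.inChart Ψ q (Complex.I • u) - paraDiag E u = 0 := by
    refine σ.eventually_eq_zero_of_diag hTn
      (fun q hq u => (((hA q hq).differentiableAt (by simp)).clm_apply
        (differentiableAt_const _)).sub_const _)
      (fun q _ => ⟨Complex.I • I₀c.inChart Ψ q - paraDiag E, fun u => ?_⟩) fun z hz u => ?_
    · rw [map_smul]; rfl
    · rw [map_smul, h.end_inChart_diag hz.1 hf (hI.pullback _),
        complexStructure_inChart hκ (h.mem_target hz.1), σ.paraDiag_diag, sub_self]
  have hclosed : ∀ᶠ q in 𝓝 (σ.diag (chartAt E a a)), ∀ u v w,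
      cyclicSum (fderiv ℂ (ω₀c.inChart Ψ) q) u v w = 0 := by
    refine σ.eventually_eq_zero_of_diag₃ hTn
      (fun q hq => differentiableAt_cyclicSum (hΩ q hq)) (fun q _ => cyclicSum_linear₁ _)
      (fun q _ => cyclicSum_linear₂ _) (fun q _ => cyclicSum_linear₃ _) fun z hz u v w => ?_
    have hd := (hΩ _ hz).differentiableAt (by simp)
    have hbd := (hK.contDiffAt_inChart hκ (h.mem_target hz.1) (hg₀ _)).differentiableAt (by simp)
    rw [cyclicSum, h.fderiv_bilin_inChart_diag hz.1 hf hω.pullback hd hbd,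
      h.fderiv_bilin_inChart_diag hz.1 hf hω.pullback hd hbd, h.fderiv_bilin_inChart_diag hz.1 hf hω.pullback hd hbd]
    exact_mod_cast hK.inChart_closed hκ (h.mem_target hz.1) (hg₀ _) u v w
  -- Nondegeneracy is open, so the base point suffices. There, testing against vectors of Δ, the
  -- real and imaginary parts of u are each g₀-orthogonal to everything, hence zero by definiteness.
  have hnd : ∀ᶠ q in 𝓝 (σ.diag (chartAt E a a)), ∀ u, (∀ v, g₀c.inChart Ψ q u v = 0) → u = 0 := by
    refine ContinuousLinearMap.eventually_nondegenerate (hG _ hT₀).continuousAt fun u hu => ?_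
    have key : ∀ v, g₀.inChart (chartAt E a) (chartAt E a a)
          (σ.re u) v = 0 ∧
        g₀.inChart (chartAt E a) (chartAt E a a) (σ.im u) v = 0 := by
      intro v
      have h1 := hu (σ.diag v)
      rw [← σ.diag_re_add_diag_im u, map_add, map_smul, add_apply, smul_apply,
        h.bilin_inChart_diag hz₀ hf (hg.pullback _), h.bilin_inChart_diag hz₀ hf (hg.pullback _), smul_eq_mul, mul_comm] at h1
      simpa [Complex.ext_iff] using h1
    have hpos : ∀ w, g₀.inChart (chartAt E a) (chartAt E a a) w w = 0 →
        w = 0 := by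
      intro w hw
      rw [← hκ.restrictScalars_real.chartD_chartDInv (h.mem_target hz₀) w]
      exact (congrArg (chartD ℝ (chartAt E a) _) (hg₀d _ _ hw)).trans (map_zero _)
    rw [← σ.diag_re_add_diag_im u, hpos _ (key _).1, hpos _ (key _).2]
    simp
  obtain ⟨S, hS, hSo, hzS⟩ := eventually_nhds_iff.1 (hnd.and (hsymm.and (hskew.and
    (hcompat.and (hpara.and (hclosed.and hTn))))))
  refine ⟨S, hzS, h.chart, hSo, fun q hq => (hS q hq).2.2.2.2.2.2.1, fun q hq => ?_,
    fun q hq => hωan q (hS q hq).2.2.2.2.2.2, fun q hq => ?_,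
    fun q hq u v => ?_, fun q hq u hu => (hS q hq).1 u fun v => ?_, fun q hq u => ?_,
    fun q hq u v => ?_, fun q hq => (hS q hq).2.2.2.2.2.1⟩
  · have hqT := (hS q hq).2.2.2.2.2.2
    exact h.chart.bilin_analyticAt_of_inChart hqT.1 (ContDiffAt.of_eq_const_mul (hG q hqT) _ hgq)
  · refine ContinuousLinearMap.ext fun u => ?_
    rw [hFq]
    exact sub_eq_zero.1 ((hS q hq).2.2.2.2.1 u)
  · rw [hgq, hgq, sub_eq_zero.1 ((hS q hq).2.1 u v)]
  · have := hu v
    rw [hgq] at this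
    simpa using this
  · have := (hS q hq).2.2.1 u u
    rwa [← two_mul, mul_eq_zero, or_iff_right two_ne_zero] at this
  · rw [hgq, eq_neg_of_add_eq_zero_left ((hS q hq).2.2.2.1 u v), neg_mul]

end

end

/-! ### Existence and uniqueness of holomorphic extensions along `N` -/

section

/-- Local extensions along the range of `f`, given by a local condition `P` near the range and by
prescribed values `Q` on it, glue if their germs are unique. -/
theorem exists_glue_extension {N M : Type*} [TopologicalSpace M] [SecondCountableTopology M]
    [RegularSpace M] {Y : M → Type*} [∀ x, Inhabited (Y x)] (f : N → M)
    (P : (∀ x, Y x) → M → Prop) (Q : (∀ x, Y x) → N → Prop)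
    (hP : ∀ s t x, (∀ᶠ y in 𝓝 x, t y = s y) → P s x → P t x)
    (hQ : ∀ s t y, t (f y) = s (f y) → Q s y → Q t y)
    (hloc : ∀ a, ∃ s, ∃ W ∈ 𝓝 (f a), (∀ x ∈ W, P s x) ∧ ∀ y, f y ∈ W → Q s y)
    (huniq : ∀ a s t, ∀ W ∈ 𝓝 (f a), (∀ x ∈ W, P s x) → (∀ y, f y ∈ W → Q s y) →
      (∀ x ∈ W, P t x) → (∀ y, f y ∈ W → Q t y) → ∀ᶠ x in 𝓝 (f a), s x = t x) :
    ∃ (U : Set M) (t : ∀ x, Y x), IsOpen U ∧ range f ⊆ U ∧ (∀ x ∈ U, P t x) ∧ ∀ y, Q t y := by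
  choose s W hW hPs hQs using hloc
  -- Near `f k` the two local extensions both satisfy the conditions on the intersection of their
  -- domains, so uniqueness at `k` identifies their germs. Interiors are taken so that this
  -- intersection is still a neighbourhood of `f k`.
  obtain ⟨t, ht⟩ := exists_glue_germs f s (fun a => interior (W a))
    (fun a => interior_mem_nhds.2 (hW a)) fun a k hk =>
      huniq k (s a) (s k) (interior (W a) ∩ W k)
        (Filter.inter_mem (isOpen_interior.mem_nhds hk) (hW k))
        (fun x hx => hPs a x (interior_subset hx.1)) (fun y hy => hQs a y (interior_subset hy.1))
        (fun x hx => hPs k x hx.2) fun y hy => hQs k y hy.2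
  refine ⟨interior {x | P t x}, t, isOpen_interior, ?_, fun x hx => interior_subset hx, fun y =>
    hQ (s y) t y (ht y).self_of_nhds (hQs y y (mem_of_mem_nhds (hW y)))⟩
  rintro _ ⟨a, rfl⟩
  refine mem_interior_iff_mem_nhds.2 ?_
  filter_upwards [eventually_eventually_nhds.2 (ht a), hW a] with x hx hxW
  exact hP (s a) t x hx (hPs a x hxW)

theorem contDiffAt_sum_smul {W V ι : Type*} [NormedAddCommGroup W] [NormedSpace ℂ W]
    [NormedAddCommGroup V] [NormedSpace ℂ V] [Fintype ι] {H : ι → W → ℂ} {q : W}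
    (hH : ∀ i, ContDiffAt ℂ ω (H i) q) (c : ι → V) :
    ContDiffAt ℂ ω (fun q => ∑ i, H i q • c i) q :=
  ContDiffAt.sum fun i _ => (hH i).smul contDiffAt_const

/-- The bilinear form with the given coefficients in terms of linear forms `ℓ`. -/
def bilinOfCoeff {W ι : Type*} [NormedAddCommGroup W] [NormedSpace ℂ W] [Fintype ι]
    (ℓ : ι → W →L[ℂ] ℂ) (H : ι × ι → W → ℂ) (q : W) : W →L[ℂ] W →L[ℂ] ℂ :=
  ∑ i, H i q • (ℓ i.1).smulRight (ℓ i.2)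

theorem bilinOfCoeff_apply {W ι : Type*} [NormedAddCommGroup W] [NormedSpace ℂ W] [Fintype ι]
    (ℓ : ι → W →L[ℂ] ℂ) (H : ι × ι → W → ℂ) (q u v : W) :
    bilinOfCoeff ℓ H q u v = ∑ i, H i q * (ℓ i.1 u * ℓ i.2 v) := by
  simp [bilinOfCoeff]

theorem contDiffAt_bilinOfCoeff {W ι : Type*} [NormedAddCommGroup W] [NormedSpace ℂ W] [Fintype ι]
    (ℓ : ι → W →L[ℂ] ℂ) {H : ι × ι → W → ℂ} {q : W} (hH : ∀ i, ContDiffAt ℂ ω (H i) q) :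
    ContDiffAt ℂ ω (bilinOfCoeff ℓ H) q :=
  contDiffAt_sum_smul hH _

/-- A real-analytic field of bilinear forms on `E` extends holomorphically to `E × E`. -/
theorem Conjugation.exists_bilin_extension {E : Type*} [NormedAddCommGroup E] [NormedSpace ℂ E]
    [FiniteDimensional ℂ E] (σ : Conjugation E) {b : E → E →L[ℝ] E →L[ℝ] ℝ} {z₀ : E}
    (hb : ContDiffAt ℝ ω b z₀) :
    ∃ B : E × E → E × E →L[ℂ] E × E →L[ℂ] ℂ,
      (∀ᶠ q in 𝓝 (σ.diag z₀), ContDiffAt ℂ ω B q) ∧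
      ∀ᶠ z in 𝓝 z₀, ∀ u v, B (σ.diag z) (σ.diag u) (σ.diag v) = (b z u v : ℂ) := by
  have : FiniteDimensional ℝ E := FiniteDimensional.complexToReal E
  let e := Module.finBasis ℝ E
  have hc : ∀ i : Fin (Module.finrank ℝ E) × Fin (Module.finrank ℝ E),
      AnalyticAt ℝ (fun z => (b z (e i.1) (e i.2) : ℂ)) z₀ := fun i =>
    (Complex.ofRealCLM.contDiff.contDiffAt.comp z₀ ((hb.clm_apply contDiffAt_const).clm_apply
      contDiffAt_const)).analyticAt
  choose H hHa hH using fun i => σ.exists_holomorphic_extension (hc i)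
  let ℓ : Fin (Module.finrank ℝ E) → E × E →L[ℂ] ℂ := fun i =>
    σ.complexify (Complex.ofRealCLM.comp (LinearMap.toContinuousLinearMap (e.coord i)))
  refine ⟨bilinOfCoeff ℓ H, ?_, ?_⟩
  · filter_upwards [Filter.eventually_all.2 fun i => (hHa i).eventually_analyticAt] with q hq
    exact contDiffAt_bilinOfCoeff ℓ fun i => (hq i).contDiffAt
  · filter_upwards [Filter.eventually_all.2 hH] with z hz u v
    have hℓ : ∀ i u, ℓ i (σ.diag u) = (e.repr u i : ℂ) := fun i u => σ.complexify_diag _ _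
    rw [bilinOfCoeff_apply]
    conv_rhs => rw [← e.sum_repr u, ← e.sum_repr v]
    simp only [hz, hℓ, map_sum, map_smul, sum_apply, smul_apply, smul_eq_mul, Complex.ofReal_sum,
      Complex.ofReal_mul, Fintype.sum_prod_type, Finset.mul_sum]
    exact Finset.sum_comm.trans (Finset.sum_congr rfl fun i _ => Finset.sum_congr rfl fun j _ => by ring)

section

variable {E' : Type*} [NormedAddCommGroup E'] [NormedSpace ℂ E']
  {M : Type*} [TopologicalSpace M] [ChartedSpace E' M] [IsManifold 𝓘(ℂ, E') ω M]
  {W : Type*} [NormedAddCommGroup W] [NormedSpace ℂ W] {Ψ : OpenPartialHomeomorph M W}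

/-- The bilinear form field with a given expression in a chart. -/
def BilinField.ofChart (Ψ : OpenPartialHomeomorph M W) (B : W → W →L[ℂ] W →L[ℂ] ℂ) :
    BilinField ℂ E' M := fun x =>
  let D : E' →L[ℂ] W := mvfderiv 𝓘(ℂ, E') Ψ x
  let R : E' →L[ℂ] E' →L[ℂ] ℂ := (B (Ψ x)).bilinearComp D D
  R

/-- The endomorphism field with a given constant expression in a chart. -/
def EndField.ofChart (Ψ : OpenPartialHomeomorph M W) (P : W →L[ℂ] W) : EndField ℂ E' M := fun x =>
  let D : E' →L[ℂ] W := mvfderiv 𝓘(ℂ, E') Ψ x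
  let S : W →L[ℂ] E' := chartDInv ℂ (E := E') Ψ (Ψ x)
  S.comp (P.comp D)

namespace IsModelChart

variable (hΨ : IsModelChart ℂ (E := E') Ψ) {q : W} (hq : q ∈ Ψ.target)
include hΨ hq

theorem bilin_inChart_ofChart (B : W → W →L[ℂ] W →L[ℂ] ℂ) :
    (BilinField.ofChart (E' := E') Ψ B).inChart Ψ q = B q := by
  refine ContinuousLinearMap.ext fun u => ContinuousLinearMap.ext fun v => ?_
  rw [BilinField.inChart_apply]
  change B (Ψ (Ψ.symm q)) (chartD ℂ (E := E') Ψ q (chartDInv ℂ (E := E') Ψ q u))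
    (chartD ℂ (E := E') Ψ q (chartDInv ℂ (E := E') Ψ q v)) = _
  rw [hΨ.chartD_chartDInv hq, hΨ.chartD_chartDInv hq, Ψ.right_inv hq]

theorem end_inChart_ofChart (P : W →L[ℂ] W) :
    (EndField.ofChart (E' := E') Ψ P).inChart Ψ q = P := by
  refine ContinuousLinearMap.ext fun u => ?_
  rw [EndField.inChart_apply]
  have key : ∀ q', q' = q → (chartD ℂ (E := E') Ψ q : E' →L[ℂ] W)
      ((chartDInv ℂ (E := E') Ψ q' : W →L[ℂ] E') (P u)) = P u := by
    rintro _ rfl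
    exact hΨ.chartD_chartDInv hq _
  refine Eq.trans ?_ (key _ (Ψ.right_inv hq))
  exact congrArg (fun w => (chartD ℂ (E := E') Ψ q : E' →L[ℂ] W)
    ((chartDInv ℂ (E := E') Ψ (Ψ (Ψ.symm q)) : W →L[ℂ] E') (P w))) (hΨ.chartD_chartDInv hq u)

theorem bilin_eq_of_inChart_eq {b c : BilinField ℂ E' M}
    (h : ∀ u v, b.inChart Ψ q u v = c.inChart Ψ q u v) : b (Ψ.symm q) = c (Ψ.symm q) := by
  refine ContinuousLinearMap.ext fun u => ContinuousLinearMap.ext fun v => ?_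
  rw [hΨ.apply_eq_inChart hq, hΨ.apply_eq_inChart hq, h]

theorem end_eq_of_inChart_eq {A B : EndField ℂ E' M}
    (h : ∀ u, A.inChart Ψ q u = B.inChart Ψ q u) : A (Ψ.symm q) = B (Ψ.symm q) := by
  refine ContinuousLinearMap.ext fun u => hΨ.chartD_injective hq ?_
  rw [hΨ.chartD_apply_eq_inChart hq, hΨ.chartD_apply_eq_inChart hq, h]

end IsModelChart
end

section

variable {E : Type*} [NormedAddCommGroup E] [NormedSpace ℂ E] [FiniteDimensional ℂ E]
  {N : Type*} [TopologicalSpace N] [ChartedSpace E N] [IsManifold 𝓘(ℂ, E) ω N]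
  {E' : Type*} [NormedAddCommGroup E'] [NormedSpace ℂ E'] [FiniteDimensional ℂ E']
  {M : Type*} [TopologicalSpace M] [ChartedSpace E' M] [IsManifold 𝓘(ℂ, E') ω M]

theorem BilinField.ExtendsAt.congr {f : N → M} {b : BilinField ℝ E N} {bc bc' : BilinField ℂ E' M}
    {y : N} (h : b.ExtendsAt f bc y) (hbc : bc' (f y) = bc (f y)) : b.ExtendsAt f bc' y := by
  intro u v
  rw [hbc]
  exact h u v

theorem EndField.ExtendsAt.congr {f : N → M} {A : EndField ℝ E N} {Ac Ac' : EndField ℂ E' M}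
    {y : N} (h : A.ExtendsAt f Ac y) (hAc : Ac' (f y) = Ac (f y)) : A.ExtendsAt f Ac' y := by
  intro u
  rw [hAc]
  exact h u

theorem BilinField.AnalyticAt.congr {b c : BilinField ℂ E' M} {x : M} (hb : b.AnalyticAt x)
    (h : ∀ᶠ y in 𝓝 x, c y = b y) : c.AnalyticAt x :=
  ContMDiffAt.congr_of_eventuallyEq hb (h.mono fun y hy => congrArg (TotalSpace.mk' _ y) hy)

theorem EndField.AnalyticAt.congr {A B : EndField ℂ E' M} {x : M} (hA : A.AnalyticAt x)
    (h : ∀ᶠ y in 𝓝 x, B y = A y) : B.AnalyticAt x :=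
  ContMDiffAt.congr_of_eventuallyEq hA (h.mono fun y hy => congrArg (TotalSpace.mk' _ y) hy)

namespace IsDiagonalChart

variable {σ : Conjugation E} {f : N → M} {a : N} {Ψ : OpenPartialHomeomorph M (E × E)}
  (h : IsDiagonalChart (E' := E') σ f a Ψ)
include h

theorem exists_eq_symm {y : N} (hy : f y ∈ Ψ.source) :
    ∃ z, σ.diag z ∈ Ψ.target ∧ (chartAt E a).symm z = y ∧ chartAt E a y = z := by
  refine ⟨chartAt E a y, ?_, (chartAt E a).left_inv (h.apply_eq y hy).1, rfl⟩
  rw [← (h.apply_eq y hy).2]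
  exact Ψ.map_source hy

theorem eventually_of_eventually {p : M → Prop}
    (hp : ∀ᶠ q in 𝓝 (σ.diag (chartAt E a a)), p (Ψ.symm q)) : ∀ᶠ x in 𝓝 (f a), p x := by
  rw [← (h.apply_eq a h.mem_source).2] at hp
  filter_upwards [(Ψ.continuousAt h.mem_source).eventually hp,
    Ψ.open_source.mem_nhds h.mem_source] with x hx hxs
  rwa [Ψ.left_inv hxs] at hx

theorem inter_preimage_mem_nhds {W : Set M} (hW : W ∈ 𝓝 (f a)) :
    Ψ.target ∩ Ψ.symm ⁻¹' W ∈ 𝓝 (σ.diag (chartAt E a a)) := by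
  refine Filter.inter_mem (Ψ.open_target.mem_nhds h.diag_mem_target)
    ((Ψ.continuousAt_symm h.diag_mem_target).preimage_mem_nhds ?_)
  rwa [← (h.apply_eq a h.mem_source).2, Ψ.left_inv h.mem_source]

theorem bilin_extendsAt (hf : IsComplexification E E' f) {z : E} (hz : σ.diag z ∈ Ψ.target)
    {b : BilinField ℝ E N} {bc : BilinField ℂ E' M}
    (hb : ∀ u v, bc.inChart Ψ (σ.diag z) (σ.diag u) (σ.diag v) =
      (b.inChart (chartAt E a) z u v : ℂ)) :
    b.ExtendsAt f bc ((chartAt E a).symm z) := by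
  have hκ : IsModelChart ℝ (E := E) (chartAt E a) := isModelChart_chartAt a
  intro u v
  have h1 := hb (chartD ℝ (chartAt E a) z u) (chartD ℝ (chartAt E a) z v)
  rw [bc.inChart_apply_of_eq (h.symm_diag z hz).2 (h.chartDInv_diag hz hf _)
    (h.chartDInv_diag hz hf _), ← hκ.apply_eq_inChart (h.mem_target hz),
    hκ.chartDInv_chartD (h.mem_target hz), hκ.chartDInv_chartD (h.mem_target hz)] at h1
  exact h1

theorem end_extendsAt (hf : IsComplexification E E' f) {z : E} (hz : σ.diag z ∈ Ψ.target)
    {A : EndField ℝ E N} {Ac : EndField ℂ E' M}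
    (hA : ∀ u, Ac.inChart Ψ (σ.diag z) (σ.diag u) = σ.diag (A.inChart (chartAt E a) z u)) :
    A.ExtendsAt f Ac ((chartAt E a).symm z) := by
  have hκ : IsModelChart ℝ (E := E) (chartAt E a) := isModelChart_chartAt a
  have key : ∀ {x : M} (hx : Ψ.symm (σ.diag z) = x) {u' w : E'} {u r : E}
      (hu : (chartDInv ℂ (E := E') Ψ (σ.diag z) (σ.diag u) : E') = u')
      (hw : (chartDInv ℂ (E := E') Ψ (σ.diag z) (σ.diag r) : E') = w),
      Ac.inChart Ψ (σ.diag z) (σ.diag u) = σ.diag r → (Ac x u' : E') = w := by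
    intro x hx u' w u r hu hw h1
    subst hx hu hw
    rw [EndField.inChart_apply] at h1
    refine h.chart.chartD_injective hz (h1.trans ?_)
    exact (h.chart.chartD_chartDInv hz _).symm
  intro u
  have h2 := key (h.symm_diag z hz).2 (h.chartDInv_diag hz hf _) (h.chartDInv_diag hz hf _)
    (hA (chartD ℝ (chartAt E a) z u))
  rw [← hκ.chartD_apply_eq_inChart (h.mem_target hz), hκ.chartDInv_chartD (h.mem_target hz),
    hκ.chartDInv_chartD (h.mem_target hz)] at h2
  exact h2


/-- The germ along `N` of the holomorphic extension of a bilinear form is unique. -/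
theorem bilin_eventually_eq (hf : IsComplexification E E' f) {b : BilinField ℝ E N}
    {s t : BilinField ℂ E' M} {W : Set M} (hW : W ∈ 𝓝 (f a)) (hs : ∀ x ∈ W, s.AnalyticAt x)
    (hsb : ∀ y, f y ∈ W → b.ExtendsAt f s y) (ht : ∀ x ∈ W, t.AnalyticAt x)
    (htb : ∀ y, f y ∈ W → b.ExtendsAt f t y) : ∀ᶠ x in 𝓝 (f a), s x = t x := by
  have hT := h.inter_preimage_mem_nhds hW
  have hc : ∀ q ∈ Ψ.target ∩ Ψ.symm ⁻¹' W, ∀ b : BilinField ℂ E' M, b.AnalyticAt (Ψ.symm q) →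
      ∀ u v, DifferentiableAt ℂ (fun q => b.inChart Ψ q u v) q := fun q hq b hb u v =>
    (hasFDerivAt_clm₂_apply ((h.chart.contDiffAt_bilin_inChart hq.1 hb).differentiableAt
      (by simp)) u v).differentiableAt
  refine h.eventually_of_eventually ?_
  filter_upwards [hT, σ.eventually_eq_zero_of_diag₂ hT
    (b := fun q u v => s.inChart Ψ q u v - t.inChart Ψ q u v)
    (fun q hq u v => (hc q hq s (hs _ hq.2) u v).sub (hc q hq t (ht _ hq.2) u v))
    (fun q _ v => ⟨(s.inChart Ψ q).flip v - (t.inChart Ψ q).flip v, fun _ => rfl⟩)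
    (fun q _ u => ⟨s.inChart Ψ q u - t.inChart Ψ q u, fun _ => rfl⟩)
    fun z hz u v => by
      have hz' : f ((chartAt E a).symm z) ∈ W := by
        rw [← (h.symm_diag z hz.1).2]
        exact hz.2
      rw [h.bilin_inChart_diag hz.1 hf (hsb _ hz'), h.bilin_inChart_diag hz.1 hf (htb _ hz'),
        sub_self]] with q hq hst
  exact h.chart.bilin_eq_of_inChart_eq hq.1 fun u v => sub_eq_zero.1 (hst u v)

/-- The germ along `N` of the holomorphic extension of an endomorphism field is unique. -/
theorem end_eventually_eq (hf : IsComplexification E E' f) {A : EndField ℝ E N}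
    {s t : EndField ℂ E' M} {W : Set M} (hW : W ∈ 𝓝 (f a)) (hs : ∀ x ∈ W, s.AnalyticAt x)
    (hsA : ∀ y, f y ∈ W → A.ExtendsAt f s y) (ht : ∀ x ∈ W, t.AnalyticAt x)
    (htA : ∀ y, f y ∈ W → A.ExtendsAt f t y) : ∀ᶠ x in 𝓝 (f a), s x = t x := by
  have hT := h.inter_preimage_mem_nhds hW
  have : CompleteSpace E := FiniteDimensional.complete ℂ E
  have hc : ∀ q ∈ Ψ.target ∩ Ψ.symm ⁻¹' W, ∀ b : EndField ℂ E' M, b.AnalyticAt (Ψ.symm q) →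
      ∀ u, DifferentiableAt ℂ (fun q => b.inChart Ψ q u) q := fun q hq b hb u =>
    ((h.chart.contDiffAt_end_inChart hq.1 hb).differentiableAt (by simp)).clm_apply
      (differentiableAt_const u)
  refine h.eventually_of_eventually ?_
  filter_upwards [hT, σ.eventually_eq_zero_of_diag hT
    (b := fun q u => s.inChart Ψ q u - t.inChart Ψ q u)
    (fun q hq u => (hc q hq s (hs _ hq.2) u).sub (hc q hq t (ht _ hq.2) u))
    (fun q _ => ⟨s.inChart Ψ q - t.inChart Ψ q, fun _ => rfl⟩)
    fun z hz u => by
      have hz' : f ((chartAt E a).symm z) ∈ W := by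
        rw [← (h.symm_diag z hz.1).2]
        exact hz.2
      rw [h.end_inChart_diag hz.1 hf (hsA _ hz'), h.end_inChart_diag hz.1 hf (htA _ hz'),
        sub_self]] with q hq hst
  exact h.chart.end_eq_of_inChart_eq hq.1 fun u => sub_eq_zero.1 (hst u)

/-- The coefficients in κ are extended off Δ, and the resulting matrix is carried to `M` by the
diagonal chart. -/
theorem exists_local_bilin_extension (hf : IsComplexification E E' f) {b : BilinField ℝ E N}
    (hb : ContDiffAt ℝ ω (b.inChart (chartAt E a)) (chartAt E a a)) :
    ∃ s : BilinField ℂ E' M, ∃ W ∈ 𝓝 (f a), (∀ x ∈ W, s.AnalyticAt x) ∧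
      ∀ y, f y ∈ W → b.ExtendsAt f s y := by
  obtain ⟨B, hB, hBb⟩ := σ.exists_bilin_extension hb
  have h1 : ∀ᶠ q in 𝓝 (σ.diag (chartAt E a a)), ContDiffAt ℂ ω B q ∧ q ∈ Ψ.target :=
    hB.and (Ψ.open_target.mem_nhds h.diag_mem_target)
  -- The real part `σ.re` converts a property of z near the base point into a property of q near its
  -- image on Δ.
  have h2 : ∀ᶠ q in 𝓝 (σ.diag (chartAt E a a)), q ∈ Ψ.target → ∀ u v,
      B (σ.diag (σ.re q)) (σ.diag u) (σ.diag v) = (b.inChart (chartAt E a) (σ.re q) u v : ℂ) := by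
    have : Filter.Tendsto σ.re (𝓝 (σ.diag (chartAt E a a))) (𝓝 (chartAt E a a)) := by
      conv_rhs => rw [← σ.re_diag (chartAt E a a)]
      exact σ.re.continuous.continuousAt
    exact (this.eventually hBb).mono fun q hq _ => hq
  let s := BilinField.ofChart (E' := E') Ψ B
  -- The neighbourhood is cut out by the very properties required. The condition on z concerns only
  -- points of Δ and applies to `f y` with z the coordinate of y.
  refine ⟨s, {x | x ∈ Ψ.source ∧ s.AnalyticAt x ∧ ∀ z, Ψ x = σ.diag z → ∀ u v,
      B (σ.diag z) (σ.diag u) (σ.diag v) = (b.inChart (chartAt E a) z u v : ℂ)}, ?_,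
    fun x hx => hx.2.1, fun y hy => ?_⟩
  · refine Filter.inter_mem (Ψ.open_source.mem_nhds h.mem_source)
      (h.eventually_of_eventually (p := fun x => s.AnalyticAt x ∧ ∀ z, Ψ x = σ.diag z → ∀ u v,
      B (σ.diag z) (σ.diag u) (σ.diag v) = (b.inChart (chartAt E a) z u v : ℂ)) ?_)
    filter_upwards [h1, h2] with q hq hq2
    refine ⟨h.chart.bilin_analyticAt_of_inChart hq.2 (hq.1.congr_of_eventuallyEq ?_),
      fun z hz u v => ?_⟩
    · filter_upwards [Ψ.open_target.mem_nhds hq.2] with q' hq'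
      exact h.chart.bilin_inChart_ofChart hq' B
    · rw [Ψ.right_inv hq.2] at hz
      have := hq2 hq.2 u v
      rwa [hz, σ.re_diag] at this
  · obtain ⟨z, hz, rfl, hz'⟩ := h.exists_eq_symm hy.1
    refine h.bilin_extendsAt hf hz fun u v => ?_
    rw [h.chart.bilin_inChart_ofChart hz]
    exact hy.2.2 z (by rw [(h.apply_eq _ hy.1).2, hz']) u v

/-- The extension is explicit: on Δ the structure of `N` acts as -i diag(-1, 1), which has constant
coefficients. -/
theorem exists_local_complexStructure_extension (hf : IsComplexification E E' f) :
    ∃ s : EndField ℂ E' M, ∃ W ∈ 𝓝 (f a), (∀ x ∈ W, s.AnalyticAt x) ∧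
      ∀ y, f y ∈ W → (complexStructure E N).ExtendsAt f s y := by
  have hκ : IsModelChart ℂ (E := E) (chartAt E a) := isModelChart_chartAt a
  refine ⟨EndField.ofChart (E' := E') Ψ (-Complex.I • paraDiag E), Ψ.source,
    Ψ.open_source.mem_nhds h.mem_source, fun x hx => ?_, fun y hy => ?_⟩
  · rw [← Ψ.left_inv hx]
    refine h.chart.end_analyticAt_of_const (P := -Complex.I • paraDiag E) (Ψ.map_source hx) ?_
    filter_upwards [Ψ.open_target.mem_nhds (Ψ.map_source hx)] with q hq
    exact h.chart.end_inChart_ofChart hq _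
  · obtain ⟨z, hz, rfl, -⟩ := h.exists_eq_symm hy
    refine h.end_extendsAt hf hz fun u => ?_
    rw [h.chart.end_inChart_ofChart hz, complexStructure_inChart hκ (h.mem_target hz),
      smul_apply, σ.paraDiag_diag, smul_smul, neg_mul, Complex.I_mul_I, neg_neg, one_smul]

end IsDiagonalChart

section Global

variable [SecondCountableTopology M] [RegularSpace M] {f : N → M} (hf : IsComplexification E E' f)
include hf

theorem IsComplexification.exists_bilin_extension {b : BilinField ℝ E N}
    (hb : ∀ a, ContDiffAt ℝ ω (b.inChart (chartAt E a)) (chartAt E a a)) :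
    ∃ (U : Set M) (bc : BilinField ℂ E' M), IsOpen U ∧ range f ⊆ U ∧
      IsHolomorphicExtensionBilin f b U bc := by
  obtain ⟨σ⟩ := exists_conjugation E
  choose Ψ hΨ using hf.exists_isDiagonalChart σ
  obtain ⟨U, t, hU, hfU, ht, htb⟩ := exists_glue_extension
    (Y := fun x : M => TangentSpace 𝓘(ℂ, E') x →L[ℂ] TangentSpace 𝓘(ℂ, E') x →L[ℂ] ℂ) f
    BilinField.AnalyticAt (fun s y => b.ExtendsAt f s y)
    (fun s t x hst hs => BilinField.AnalyticAt.congr hs hst) (fun s t y hst hs => hs.congr hst)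
    (fun a => (hΨ a).exists_local_bilin_extension hf (hb a))
    fun a s t W hW hs hsb ht htb => (hΨ a).bilin_eventually_eq hf hW hs hsb ht htb
  exact ⟨U, t, hU, hfU, ⟨fun x hx => ContMDiffAt.contMDiffWithinAt (ht x hx), htb⟩⟩

theorem IsComplexification.exists_complexStructure_extension :
    ∃ (U : Set M) (I : EndField ℂ E' M), IsOpen U ∧ range f ⊆ U ∧
      IsHolomorphicExtensionEnd f (complexStructure E N) U I := by
  obtain ⟨σ⟩ := exists_conjugation E
  choose Ψ hΨ using hf.exists_isDiagonalChart σ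
  obtain ⟨U, t, hU, hfU, ht, htb⟩ := exists_glue_extension
    (Y := fun x : M => TangentSpace 𝓘(ℂ, E') x →L[ℂ] TangentSpace 𝓘(ℂ, E') x) f
    EndField.AnalyticAt (fun s y => (complexStructure E N).ExtendsAt f s y)
    (fun s t x hst hs => EndField.AnalyticAt.congr hs hst) (fun s t y hst hs => hs.congr hst)
    (fun a => (hΨ a).exists_local_complexStructure_extension hf)
    fun a s t W hW hs hsb ht htb => (hΨ a).end_eventually_eq hf hW hs hsb ht htb
  exact ⟨U, t, hU, hfU, ⟨fun x hx => ContMDiffAt.contMDiffWithinAt (ht x hx), htb⟩⟩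

end Global
end

end

/-! ### Identification of a neighbourhood of `N` with a neighbourhood of the diagonal in `N × N̄` -/

section

/-- A map that is a local homeomorphism at the points of a family `f`, and that has a continuous
inverse along this family, is injective near the family. -/
theorem exists_injOn_of_local_homeomorph {X Y ι : Type*} [TopologicalSpace X] [Nonempty X]
    [TopologicalSpace Y] [SecondCountableTopology Y] [RegularSpace Y] {f : ι → X} {φ : X → Y}
    {r : Y → X} (hr : ∀ i, ContinuousAt r (φ (f i))) (hrf : ∀ i, r (φ (f i)) = f i)
    (e : ι → OpenPartialHomeomorph X Y) (he : ∀ i, f i ∈ (e i).source)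
    (heφ : ∀ i, EqOn φ (e i) (e i).source) :
    ∃ U, IsOpen U ∧ range f ⊆ U ∧ InjOn φ U := by
  have : Inhabited X := Classical.inhabited_of_nonempty inferInstance
  have hmem : ∀ i, φ (f i) ∈ (e i).target := fun i => by
    rw [heφ i (he i)]
    exact (e i).map_source (he i)
  -- The local inverses of φ are glued along φ ∘ f. The continuous map `r` restricts the domains so
  -- that φ(f k) lies in the i-th one only if `f k` lies in the source of `e i`; both inverses then
  -- send φ(f k) to `f k` and agree nearby.
  obtain ⟨t, ht⟩ := exists_glue_germs (Y := fun _ : Y => X) (fun i => φ (f i))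
    (fun i => (e i).symm) (fun i => (e i).target ∩ r ⁻¹' (e i).source)
    (fun i => Filter.inter_mem ((e i).open_target.mem_nhds (hmem i))
      ((hr i).preimage_mem_nhds ((e i).open_source.mem_nhds (by rw [hrf]; exact he i))))
    fun i k hk => by
      have hki : f k ∈ (e i).source := by
        have := hk.2
        rwa [mem_preimage, hrf] at this
      have hk' : φ (f k) ∈ (e k).target := hmem k
      have h1 : (e i).symm (φ (f k)) = f k := by rw [heφ i hki, (e i).left_inv hki]
      have h2 : ∀ᶠ y in 𝓝 (φ (f k)), (e i).symm y ∈ (e k).source :=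
        ((e i).continuousAt_symm hk.1).eventually
          (by rw [h1]; exact (e k).open_source.mem_nhds (he k))
      filter_upwards [h2, (e i).open_target.mem_nhds hk.1, (e k).open_target.mem_nhds hk']
        with y hy hyi hyk
      refine (e k).injOn hy ((e k).map_target hyk) ?_
      rw [← heφ k hy, heφ i ((e i).map_target hyi), (e i).right_inv hyi, (e k).right_inv hyk]
  -- Where the glued map `t` is a left inverse of φ, the map φ is injective.
  refine ⟨interior {x | t (φ x) = x}, isOpen_interior, ?_, fun x hx y hy hxy => ?_⟩
  · rintro _ ⟨i, rfl⟩
    refine mem_interior_iff_mem_nhds.2 ?_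
    have h1 : ∀ᶠ x in 𝓝 (f i), t (e i x) = (e i).symm (e i x) :=
      ((e i).continuousAt (he i)).eventually (by rw [← heφ i (he i)]; exact ht i)
    filter_upwards [h1, (e i).open_source.mem_nhds (he i)] with x hx hxs
    rw [heφ i hxs, hx, (e i).left_inv hxs]
  · have h1 : x ∈ {x | t (φ x) = x} := interior_subset hx
    have h2 : y ∈ {x | t (φ x) = x} := interior_subset hy
    rw [mem_ofPred_eq] at h1 h2
    rw [← h1, hxy, h2]

/-- Each of the two maps factors locally through the other, so by the chain rule their differentials
have the same kernel. It serves to compare a component of φ with a component of Ψ. -/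
theorem mfderiv_eq_zero_iff_of_factor {E₁ E₂ W M N : Type*} [NormedAddCommGroup E₁]
    [NormedSpace ℝ E₁] [TopologicalSpace M] [ChartedSpace E₁ M] [NormedAddCommGroup E₂]
    [NormedSpace ℝ E₂] [TopologicalSpace N] [ChartedSpace E₂ N] [NormedAddCommGroup W]
    [NormedSpace ℝ W] {p : M → N} {r : M → W} {k : N → W} {l : W → N} {x : M}
    (hp : MDifferentiableAt 𝓘(ℝ, E₁) 𝓘(ℝ, E₂) p x) (hr : MDifferentiableAt 𝓘(ℝ, E₁) 𝓘(ℝ, W) r x)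
    (hk : MDifferentiableAt 𝓘(ℝ, E₂) 𝓘(ℝ, W) k (p x))
    (hl : MDifferentiableAt 𝓘(ℝ, W) 𝓘(ℝ, E₂) l (r x)) (h1 : ∀ᶠ y in 𝓝 x, k (p y) = r y)
    (h2 : ∀ᶠ y in 𝓝 x, l (r y) = p y) (u : TangentSpace 𝓘(ℝ, E₁) x) :
    mfderiv 𝓘(ℝ, E₁) 𝓘(ℝ, E₂) p x u = 0 ↔ mfderiv 𝓘(ℝ, E₁) 𝓘(ℝ, W) r x u = 0 := by
  have e1 := hasMFDerivAt_unique hr.hasMFDerivAt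
    ((hk.hasMFDerivAt.comp x hp.hasMFDerivAt).congr_of_eventuallyEq (h1.mono fun y hy => hy.symm))
  have e2 := hasMFDerivAt_unique hp.hasMFDerivAt
    ((hl.hasMFDerivAt.comp x hr.hasMFDerivAt).congr_of_eventuallyEq (h2.mono fun y hy => hy.symm))
  constructor
  · intro hu
    refine (DFunLike.congr_fun e1 u).trans ?_
    exact (congrArg (mfderiv 𝓘(ℝ, E₂) 𝓘(ℝ, W) k (p x)) hu).trans (map_zero _)
  · intro hu
    refine (DFunLike.congr_fun e2 u).trans ?_
    exact (congrArg (mfderiv 𝓘(ℝ, W) 𝓘(ℝ, E₂) l (r x)) hu).trans (map_zero _)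

theorem IsLocalDiffeomorphAt.congr {E₁ E₂ H₂ M N : Type*} [NormedAddCommGroup E₁]
    [NormedSpace ℝ E₁] [TopologicalSpace M] [ChartedSpace E₁ M] [NormedAddCommGroup E₂]
    [NormedSpace ℝ E₂] [TopologicalSpace H₂] {J : ModelWithCorners ℝ E₂ H₂} [TopologicalSpace N]
    [ChartedSpace H₂ N] {n : ℕ∞ω} {φ ψ : M → N} {x : M} (h : IsLocalDiffeomorphAt 𝓘(ℝ, E₁) J n φ x)
    (hψ : ∀ᶠ y in 𝓝 x, ψ y = φ y) : IsLocalDiffeomorphAt 𝓘(ℝ, E₁) J n ψ x := by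
  obtain ⟨Φ, hx, hΦ⟩ := h
  obtain ⟨S, hS, hSo, hxS⟩ := eventually_nhds_iff.1 hψ
  let e := Φ.toOpenPartialHomeomorph.restrOpen S hSo
  refine ⟨⟨e.toPartialEquiv, e.open_source, e.open_target,
    Φ.contMDiffOn_toFun.mono fun y hy => hy.1, Φ.contMDiffOn_invFun.mono fun y hy => hy.1⟩,
    ⟨hx, hxS⟩, fun y hy => ?_⟩
  exact (hS y hy.2).trans (hΦ hy.1)

/-- The homeomorphism `(z, w) ↦ (z, σ w)`. -/
def Conjugation.sndHomeomorph {E : Type*} [NormedAddCommGroup E] [NormedSpace ℂ E]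
    (σ : Conjugation E) : E × E ≃ₜ E × E where
  toFun q := (q.1, σ.map q.2)
  invFun q := (q.1, σ.map q.2)
  left_inv q := by simp [σ.map_map]
  right_inv q := by simp [σ.map_map]
  continuous_toFun := by fun_prop
  continuous_invFun := by fun_prop

section

variable {E : Type*} [NormedAddCommGroup E] [NormedSpace ℂ E] [FiniteDimensional ℂ E]
  {N : Type*} [TopologicalSpace N] [ChartedSpace E N] [IsManifold 𝓘(ℂ, E) ω N]
  {E' : Type*} [NormedAddCommGroup E'] [NormedSpace ℂ E'] [FiniteDimensional ℂ E']
  {M : Type*} [TopologicalSpace M] [ChartedSpace E' M] [IsManifold 𝓘(ℂ, E') ω M]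

variable (E E') in
/-- The map `φ` is at `x` a local biholomorphism to `N × N̄`. -/
structure IsIdentificationAt (φ : M → N × N) (x : M) : Prop where
  localDiffeo : IsLocalDiffeomorphAt 𝓘(ℝ, E') (𝓘(ℝ, E).prod 𝓘(ℝ, E)) ω φ x
  fst : ∃ L : E' →L[ℝ] E, HasMFDerivAt 𝓘(ℝ, E') 𝓘(ℝ, E) (fun y => (φ y).1) x L ∧
    ∀ u, L (Complex.I • u) = Complex.I • L u
  snd : ∃ L : E' →L[ℝ] E, HasMFDerivAt 𝓘(ℝ, E') 𝓘(ℝ, E) (fun y => (φ y).2) x L ∧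
    ∀ u, L (Complex.I • u) = -(Complex.I • L u)

theorem IsIdentificationAt.congr {φ ψ : M → N × N} {x : M} (h : IsIdentificationAt E E' φ x)
    (hψ : ∀ᶠ y in 𝓝 x, ψ y = φ y) : IsIdentificationAt E E' ψ x := by
  obtain ⟨L₁, h1, h1'⟩ := h.fst
  obtain ⟨L₂, h2, h2'⟩ := h.snd
  exact ⟨h.localDiffeo.congr hψ,
    ⟨L₁, h1.congr_of_eventuallyEq (hψ.mono fun y hy => congrArg Prod.fst hy), h1'⟩,
    ⟨L₂, h2.congr_of_eventuallyEq (hψ.mono fun y hy => congrArg Prod.snd hy), h2'⟩⟩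

theorem IsCanonicalIdentification.isIdentificationAt {f : N → M} {U : Set M} {φ : M → N × N}
    (h : IsCanonicalIdentification E E' f U φ) {x : M} (hx : x ∈ U) :
    IsIdentificationAt E E' φ x := by
  have h1 : MDifferentiableAt 𝓘(ℝ, E') (𝓘(ℝ, E).prod 𝓘(ℝ, E)) φ x :=
    (h.localDiffeo ⟨x, hx⟩).mdifferentiableAt (by simp)
  exact ⟨h.localDiffeo ⟨x, hx⟩, ⟨_, h1.fst.hasMFDerivAt, h.holomorphic_fst x hx⟩,
    ⟨_, h1.snd.hasMFDerivAt, h.antiholomorphic_snd x hx⟩⟩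

theorem isCanonicalIdentification_of_forall {f : N → M} {U : Set M} {φ : M → N × N} (hU : IsOpen U)
    (hfU : range f ⊆ U) (hφ : ∀ y, φ (f y) = (y, y)) (hinj : InjOn φ U)
    (h : ∀ x ∈ U, IsIdentificationAt E E' φ x) : IsCanonicalIdentification E E' f U φ := by
  refine ⟨hU, hfU, hφ, hinj, fun x => (h x x.2).localDiffeo, fun x hx u => ?_, fun x hx u => ?_⟩
  · obtain ⟨L, hL, hL'⟩ := (h x hx).fst
    rw [realDerivFst, hL.mfderiv]
    exact hL' u
  · obtain ⟨L, hL, hL'⟩ := (h x hx).snd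
    rw [realDerivSnd, hL.mfderiv]
    exact hL' u

theorem IsIdentificationAt.mdifferentiableAt_fst {κ : OpenPartialHomeomorph N E}
    (hκ : IsModelChart ℂ (E := E) κ) {φ : M → N × N} {x : M} (h : IsIdentificationAt E E' φ x)
    (hx : (φ x).1 ∈ κ.source) :
    MDifferentiableAt 𝓘(ℂ, E') 𝓘(ℂ, E) (fun y => κ (φ y).1) x := by
  obtain ⟨L, hL, hL'⟩ := h.fst
  have h1 : MDifferentiableAt 𝓘(ℂ, E) 𝓘(ℂ, E) κ (φ x).1 :=
    (hκ.contMDiffOn.contMDiffAt (κ.open_source.mem_nhds hx)).mdifferentiableAt (by simp)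
  let D : E →L[ℂ] E := mfderiv 𝓘(ℂ, E) 𝓘(ℂ, E) κ (φ x).1
  have h2 : HasMFDerivAt 𝓘(ℝ, E') 𝓘(ℝ, E) (fun y => κ (φ y).1) x
      ((D.comp (L.toComplex hL')).restrictScalars ℝ) :=
    (HasMFDerivAt.restrictScalars_real (L := D) h1.hasMFDerivAt).comp x hL
  exact (HasMFDerivAt.of_real h2).mdifferentiableAt

/-- The second component of φ is antiholomorphic; composing with the antilinear σ restores complex
linearity of the differential. -/
theorem IsIdentificationAt.mdifferentiableAt_snd (σ : Conjugation E)
    {κ : OpenPartialHomeomorph N E} (hκ : IsModelChart ℂ (E := E) κ) {φ : M → N × N} {x : M}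
    (h : IsIdentificationAt E E' φ x) (hx : (φ x).2 ∈ κ.source) :
    MDifferentiableAt 𝓘(ℂ, E') 𝓘(ℂ, E) (fun y => σ.map (κ (φ y).2)) x := by
  obtain ⟨L, hL, hL'⟩ := h.snd
  have h1 : MDifferentiableAt 𝓘(ℂ, E) 𝓘(ℂ, E) κ (φ x).2 :=
    (hκ.contMDiffOn.contMDiffAt (κ.open_source.mem_nhds hx)).mdifferentiableAt (by simp)
  let D : E →L[ℂ] E := mfderiv 𝓘(ℂ, E) 𝓘(ℂ, E) κ (φ x).2
  let T : E' →L[ℝ] E := σ.map.comp ((D.restrictScalars ℝ).comp L)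
  have hT : ∀ u, T (Complex.I • u) = Complex.I • T u := by
    intro u
    change σ.map (D (L (Complex.I • u))) = Complex.I • σ.map (D (L u))
    rw [hL', map_neg, map_smul, map_neg, σ.map_I, neg_neg]
  have h2 : HasMFDerivAt 𝓘(ℝ, E') 𝓘(ℝ, E) (fun y => σ.map (κ (φ y).2)) x
      ((T.toComplex hT).restrictScalars ℝ) :=
    σ.map.hasMFDerivAt.comp x
      ((HasMFDerivAt.restrictScalars_real (L := D) h1.hasMFDerivAt).comp x hL)
  exact (HasMFDerivAt.of_real h2).mdifferentiableAt

namespace IsDiagonalChart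

variable {σ : Conjugation E} {f : N → M} {a : N} {Ψ : OpenPartialHomeomorph M (E × E)}
  (h : IsDiagonalChart (E' := E') σ f a Ψ)
include h

/-- An identification with `N × N̄` is expressed in a diagonal chart by a chart of `N`. -/
theorem eventually_identification_eq {φ : M → N × N} {W : Set M} (hW : W ∈ 𝓝 (f a))
    (hφ : ∀ x ∈ W, IsIdentificationAt E E' φ x) (hφf : ∀ y, f y ∈ W → φ (f y) = (y, y)) :
    ∀ᶠ q in 𝓝 (σ.diag (chartAt E a a)), (φ (Ψ.symm q)).1 ∈ (chartAt E a).source ∧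
      (φ (Ψ.symm q)).2 ∈ (chartAt E a).source ∧ chartAt E a (φ (Ψ.symm q)).1 = q.1 ∧
      σ.map (chartAt E a (φ (Ψ.symm q)).2) = q.2 := by
  have : CompleteSpace E := FiniteDimensional.complete ℂ E
  have hκ : IsModelChart ℂ (E := E) (chartAt E a) := isModelChart_chartAt a
  have haW : f a ∈ W := mem_of_mem_nhds hW
  have hcont : ContinuousAt φ (f a) := (hφ _ haW).localDiffeo.contMDiffAt.continuousAt
  have hκa : (chartAt E a).source ×ˢ (chartAt E a).source ∈ 𝓝 (φ (f a)) := by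
    rw [hφf a haW]
    exact prod_mem_nhds (chart_source_mem_nhds E a) (chart_source_mem_nhds E a)
  have hT := h.inter_preimage_mem_nhds (Filter.inter_mem hW (hcont.preimage_mem_nhds hκa))
  have hd : ∀ z, σ.diag z ∈ Ψ.target → Ψ.symm (σ.diag z) ∈ W →
      φ (Ψ.symm (σ.diag z)) = ((chartAt E a).symm z, (chartAt E a).symm z) := by
    intro z hz hzW
    rw [(h.symm_diag z hz).2] at hzW ⊢
    exact hφf _ hzW
  -- The coordinates of φ minus those of q are holomorphic in q, and vanish on Δ because φ ∘ f is
  -- the diagonal embedding.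
  obtain ⟨S₁, hS₁, -, hid₁⟩ := σ.eqOn_zero_of_diag (F := E) _ hT
  have h1 := hid₁ (fun q => chartAt E a (φ (Ψ.symm q)).1 - q.1) (fun q hq =>
    (mdifferentiableAt_iff_differentiableAt.1 (MDifferentiableAt.comp q
      ((hφ _ hq.2.1).mdifferentiableAt_fst hκ hq.2.2.1)
      (h.chart.mdifferentiableAt_symm hq.1))).sub differentiableAt_fst) fun z hz => by
        rw [hd z hz.1 hz.2.1, (chartAt E a).right_inv (h.mem_target hz.1), σ.diag_fst, sub_self]
  have h2 := hid₁ (fun q => σ.map (chartAt E a (φ (Ψ.symm q)).2) - q.2) (fun q hq =>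
    (mdifferentiableAt_iff_differentiableAt.1 (MDifferentiableAt.comp q
      ((hφ _ hq.2.1).mdifferentiableAt_snd σ hκ hq.2.2.2)
      (h.chart.mdifferentiableAt_symm hq.1))).sub differentiableAt_snd) fun z hz => by
        rw [hd z hz.1 hz.2.1, (chartAt E a).right_inv (h.mem_target hz.1), σ.diag_snd, sub_self]
  filter_upwards [hT, hS₁] with q hq hqS
  exact ⟨hq.2.2.1, hq.2.2.2, sub_eq_zero.1 (h1 q hqS), sub_eq_zero.1 (h2 q hqS)⟩

theorem identification_eventually_eq {s t : M → N × N} {W : Set M} (hW : W ∈ 𝓝 (f a))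
    (hs : ∀ x ∈ W, IsIdentificationAt E E' s x) (hsf : ∀ y, f y ∈ W → s (f y) = (y, y))
    (ht : ∀ x ∈ W, IsIdentificationAt E E' t x) (htf : ∀ y, f y ∈ W → t (f y) = (y, y)) :
    ∀ᶠ x in 𝓝 (f a), s x = t x := by
  refine h.eventually_of_eventually ?_
  filter_upwards [h.eventually_identification_eq hW hs hsf,
    h.eventually_identification_eq hW ht htf] with q h1 h2
  refine Prod.ext ((chartAt E a).injOn h1.1 h2.1 (h1.2.2.1.trans h2.2.2.1.symm))
    ((chartAt E a).injOn h1.2.1 h2.2.1 ?_)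
  have := congrArg σ.map (h1.2.2.2.trans h2.2.2.2.symm)
  rwa [σ.map_map, σ.map_map] at this

variable (σ a Ψ) in
/-- The local identification with `N × N̄` given by a diagonal chart. -/
def _root_.Conjugation.localIdentification : OpenPartialHomeomorph M (N × N) :=
  (Ψ.trans σ.sndHomeomorph.toOpenPartialHomeomorph).trans
    ((chartAt E a).prod (chartAt E a)).symm

omit h in
theorem _root_.Conjugation.mem_source_of_mem_localIdentification {x : M}
    (hx : x ∈ (σ.localIdentification a Ψ).source) : x ∈ Ψ.source ∧
      (Ψ x).1 ∈ (chartAt E a).target ∧ σ.map (Ψ x).2 ∈ (chartAt E a).target :=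
  ⟨hx.1.1, hx.2.1, hx.2.2⟩

/-- The map is x ↦ (κ⁻¹(Ψ₁ x), κ⁻¹(σ Ψ₂ x)): holomorphic in the first component and, because of σ,
antiholomorphic in the second. Its inverse is p ↦ Ψ⁻¹(κ p₁, σ κ p₂). -/
theorem isIdentificationAt_localIdentification {x : M}
    (hx : x ∈ (σ.localIdentification a Ψ).source) :
    IsIdentificationAt E E' (σ.localIdentification a Ψ) x := by
  have hκ : IsModelChart ℂ (E := E) (chartAt E a) := isModelChart_chartAt a
  have hκℝ : IsModelChart ℝ (E := E) (chartAt E a) := isModelChart_chartAt a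
  have hΨs : ∀ y ∈ Ψ.source, ContMDiffAt 𝓘(ℂ, E') 𝓘(ℂ, E × E) ω Ψ y := fun y hy =>
    h.chart.contMDiffOn.contMDiffAt (Ψ.open_source.mem_nhds hy)
  have hΨt : ∀ q ∈ Ψ.target, ContMDiffAt 𝓘(ℂ, E × E) 𝓘(ℂ, E') ω Ψ.symm q := fun q hq =>
    h.chart.contMDiffAt_symm hq
  have hfst : ∀ y, y ∈ (σ.localIdentification a Ψ).source →
      ContMDiffAt 𝓘(ℂ, E') 𝓘(ℂ, E) ω (fun y => (chartAt E a).symm (Ψ y).1) y := fun y hy =>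
    ContMDiffAt.comp (I' := 𝓘(ℂ, E)) y
      (hκ.contMDiffAt_symm (Conjugation.mem_source_of_mem_localIdentification hy).2.1)
      (ContMDiffAt.comp (I' := 𝓘(ℂ, E × E)) y
        (ContinuousLinearMap.fst ℂ E E).contMDiff.contMDiffAt (hΨs y hy.1.1))
  have hsnd : ∀ y, y ∈ (σ.localIdentification a Ψ).source →
      ContMDiffAt 𝓘(ℂ, E') 𝓘(ℂ, E) ω (fun y => (Ψ y).2) y := fun y hy =>
    ContMDiffAt.comp (I' := 𝓘(ℂ, E × E)) y
      (ContinuousLinearMap.snd ℂ E E).contMDiff.contMDiffAt (hΨs y hy.1.1)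
  refine ⟨⟨⟨(σ.localIdentification a Ψ).toPartialEquiv, (σ.localIdentification a Ψ).open_source,
    (σ.localIdentification a Ψ).open_target, fun y hy => ?_, fun p hp => ?_⟩, hx, fun y _ => rfl⟩,
    ?_, ?_⟩
  · refine ContMDiffAt.contMDiffWithinAt ?_
    have h2 : ContMDiffAt 𝓘(ℝ, E') 𝓘(ℝ, E) ω (fun y => σ.map (Ψ y).2) y :=
      ContMDiffAt.comp (I' := 𝓘(ℝ, E)) (g := σ.map) (f := fun y => (Ψ y).2) y
        σ.map.contMDiff.contMDiffAt (ContMDiffAt.restrictScalars_real (hsnd y hy))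
    have h3 : ContMDiffAt 𝓘(ℝ, E') 𝓘(ℝ, E) ω (fun y => (chartAt E a).symm (σ.map (Ψ y).2)) y :=
      ContMDiffAt.comp (I' := 𝓘(ℝ, E)) (g := (chartAt E a).symm) (f := fun y => σ.map (Ψ y).2) y
        (hκℝ.contMDiffAt_symm (Conjugation.mem_source_of_mem_localIdentification hy).2.2) h2
    exact (ContMDiffAt.restrictScalars_real (hfst y hy)).prodMk h3
  · refine ContMDiffAt.contMDiffWithinAt ?_
    have hp1 : p.1 ∈ (chartAt E a).source := hp.1.1
    have hp2 : p.2 ∈ (chartAt E a).source := hp.1.2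
    have hp3 : (chartAt E a p.1, σ.map (chartAt E a p.2)) ∈ Ψ.target := hp.2.2
    have h1 : ContMDiffAt (𝓘(ℝ, E).prod 𝓘(ℝ, E)) 𝓘(ℝ, E × E) ω
        (fun p : N × N => (chartAt E a p.1, σ.map (chartAt E a p.2))) p :=
      ContMDiffAt.prodMk_space
        ((hκℝ.contMDiffOn.contMDiffAt ((chartAt E a).open_source.mem_nhds hp1)).comp p
          contMDiffAt_fst)
        (ContMDiffAt.comp (I' := 𝓘(ℝ, E)) (g := σ.map) (f := fun p : N × N => chartAt E a p.2) p
          σ.map.contMDiff.contMDiffAt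
          ((hκℝ.contMDiffOn.contMDiffAt ((chartAt E a).open_source.mem_nhds hp2)).comp p
            contMDiffAt_snd))
    exact ContMDiffAt.comp (I' := 𝓘(ℝ, E × E)) (g := Ψ.symm)
      (f := fun p : N × N => (chartAt E a p.1, σ.map (chartAt E a p.2))) p (ContMDiffAt.restrictScalars_real (hΨt _ hp3)) h1
  · let L : E' →L[ℂ] E := mfderiv 𝓘(ℂ, E') 𝓘(ℂ, E) (fun y => (chartAt E a).symm (Ψ y).1) x
    exact ⟨L.restrictScalars ℝ, HasMFDerivAt.restrictScalars_real (L := L)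
      ((hfst x hx).mdifferentiableAt (by simp)).hasMFDerivAt, L.map_smul _⟩
  · have hm := (Conjugation.mem_source_of_mem_localIdentification hx).2.2
    let L : E' →L[ℂ] E := mfderiv 𝓘(ℂ, E') 𝓘(ℂ, E) (fun y => (Ψ y).2) x
    let D : E →L[ℂ] E := mfderiv 𝓘(ℂ, E) 𝓘(ℂ, E) (chartAt E a).symm (σ.map (Ψ x).2)
    refine ⟨(D.restrictScalars ℝ).comp (σ.map.comp (L.restrictScalars ℝ)), ?_, fun u => ?_⟩
    · exact HasMFDerivAt.comp (g := (chartAt E a).symm) (f := fun y => σ.map (Ψ y).2) x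
        (HasMFDerivAt.restrictScalars_real (L := D)
        (hκ.mdifferentiableAt_symm hm).hasMFDerivAt) (HasMFDerivAt.comp (g := σ.map)
          (f := fun y => (Ψ y).2) x (σ.map.hasMFDerivAt (x := (Ψ x).2)) (HasMFDerivAt.restrictScalars_real (L := L)
            ((hsnd x hx).mdifferentiableAt (by simp)).hasMFDerivAt))
    · change D (σ.map (L (Complex.I • u))) = -(Complex.I • D (σ.map (L u)))
      rw [map_smul, σ.map_I, map_neg, map_smul]

theorem localIdentification_apply {y : N} (hy : f y ∈ Ψ.source) :
    σ.localIdentification a Ψ (f y) = (y, y) := by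
  change ((chartAt E a).symm (Ψ (f y)).1, (chartAt E a).symm (σ.map (Ψ (f y)).2)) = (y, y)
  obtain ⟨hy', hy''⟩ := h.apply_eq y hy
  rw [hy'', σ.diag_fst, σ.diag_snd, σ.map_map, (chartAt E a).left_inv hy']

theorem mem_localIdentification_source : f a ∈ (σ.localIdentification a Ψ).source := by
  have ha := (chartAt E a).map_source (mem_chart_source E a)
  refine ⟨⟨h.mem_source, mem_univ _⟩, ?_, ?_⟩
  · change (Ψ (f a)).1 ∈ (chartAt E a).target
    rwa [(h.apply_eq a h.mem_source).2]
  · change σ.map (Ψ (f a)).2 ∈ (chartAt E a).target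
    rwa [(h.apply_eq a h.mem_source).2, σ.diag_snd, σ.map_map]

end IsDiagonalChart

/-- A neighbourhood of `N` in its complexification is identified with a neighbourhood of the diagonal
in `N × N̄`. -/
theorem IsComplexification.exists_isCanonicalIdentification [Nonempty N] [SecondCountableTopology N]
    [RegularSpace N] [SecondCountableTopology M] [RegularSpace M] {f : N → M}
    (hf : IsComplexification E E' f) :
    ∃ (U : Set M) (φ : M → N × N), IsCanonicalIdentification E E' f U φ := by
  obtain ⟨σ⟩ := exists_conjugation E
  choose Ψ hΨ using hf.exists_isDiagonalChart σ
  have : Inhabited N := Classical.inhabited_of_nonempty inferInstance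
  have : Nonempty M := ⟨f default⟩
  obtain ⟨U, φ, hU, hfU, hφ, hφf⟩ := exists_glue_extension (Y := fun _ : M => N × N) f
    (IsIdentificationAt E E') (fun s y => s (f y) = (y, y))
    (fun s t x hst hs => hs.congr hst) (fun s t y hst hs => hst.trans hs)
    (fun a => ⟨σ.localIdentification a (Ψ a), (σ.localIdentification a (Ψ a)).source,
      (σ.localIdentification a (Ψ a)).open_source.mem_nhds (hΨ a).mem_localIdentification_source,
      fun x hx => (hΨ a).isIdentificationAt_localIdentification hx,
      fun y hy => (hΨ a).localIdentification_apply hy.1.1⟩)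
    fun a s t W hW hs hsf ht htf => (hΨ a).identification_eventually_eq hW hs hsf ht htf
  choose Φ hΦ hφΦ using fun a => (hφ (f a) (hfU (mem_range_self a))).localDiffeo
  -- The map p ↦ f p₁ is a continuous left inverse of φ along `f(N)`, because φ ∘ f is the diagonal.
  obtain ⟨U', hU', hfU', hinj⟩ := exists_injOn_of_local_homeomorph (r := fun p : N × N => f p.1)
    (fun a => (hf.contMDiff.continuous.comp continuous_fst).continuousAt)
    (fun a => by rw [hφf]) (fun a => (Φ a).toOpenPartialHomeomorph) hΦ hφΦ
  exact ⟨U ∩ U', φ, isCanonicalIdentification_of_forall (hU.inter hU') (subset_inter hfU hfU') hφf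
    (hinj.mono inter_subset_right) fun x hx => hφ x hx.1⟩

end

end

/-! ### Canonical foliations and assembly of the local results -/

section

section

variable {E : Type*} [NormedAddCommGroup E] [NormedSpace ℂ E] [FiniteDimensional ℂ E]
  {N : Type*} [TopologicalSpace N] [ChartedSpace E N] [IsManifold 𝓘(ℂ, E) ω N]
  {E' : Type*} [NormedAddCommGroup E'] [NormedSpace ℂ E'] [FiniteDimensional ℂ E']
  {M : Type*} [TopologicalSpace M] [ChartedSpace E' M] [IsManifold 𝓘(ℂ, E') ω M]

/-- The identification `φ` is expressed by the chart `κ` of `N` in the chart `Ψ` of `M`. -/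
def IsProductChartAt (σ : Conjugation E) (κ : OpenPartialHomeomorph N E)
    (Ψ : OpenPartialHomeomorph M (E × E)) (φ : M → N × N) (q : E × E) : Prop :=
  (φ (Ψ.symm q)).1 ∈ κ.source ∧ (φ (Ψ.symm q)).2 ∈ κ.source ∧ κ (φ (Ψ.symm q)).1 = q.1 ∧
    σ.map (κ (φ (Ψ.symm q)).2) = q.2

variable {σ : Conjugation E} {κ : OpenPartialHomeomorph N E} {Ψ : OpenPartialHomeomorph M (E × E)}
  {φ : M → N × N} {q : E × E}

/-- Near the point, the chart κ and its inverse convert the first component of φ and the first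
coordinate of Ψ into one another, so their differentials have the same kernel. -/
theorem mem_canonicalFoliation₁_iff (hκ : IsModelChart ℂ (E := E) κ)
    (hΨ : IsModelChart ℂ (E := E') Ψ) (hq : q ∈ Ψ.target)
    (h : ∀ᶠ q' in 𝓝 q, IsProductChartAt σ κ Ψ φ q')
    (hφ : IsIdentificationAt E E' φ (Ψ.symm q)) (u : TangentSpace 𝓘(ℝ, E') (Ψ.symm q)) :
    u ∈ canonicalFoliation₁ E E' φ (Ψ.symm q) ↔ (chartD ℂ (E := E') Ψ q (toHol u)).1 = 0 := by
  have hκℝ : IsModelChart ℝ (E := E) κ := hκ.restrictScalars_real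
  have hΨr : MDifferentiableAt 𝓘(ℝ, E') 𝓘(ℝ, E × E) Ψ (Ψ.symm q) :=
    (hΨ.mdifferentiableAt hq).restrictScalars_real
  have hr : HasMFDerivAt 𝓘(ℝ, E') 𝓘(ℝ, E) (fun y => (Ψ y).1) (Ψ.symm q) _ :=
    (ContinuousLinearMap.fst ℝ E E).hasMFDerivAt.comp _ hΨr.hasMFDerivAt
  have hev : ∀ᶠ y in 𝓝 (Ψ.symm q), IsProductChartAt σ κ Ψ φ (Ψ y) ∧ Ψ.symm (Ψ y) = y := by
    refine Filter.Eventually.and ?_ (hΨ.eventually_left_inv hq)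
    refine (Ψ.continuousAt (Ψ.map_target hq)).eventually ?_
    rwa [Ψ.right_inv hq]
  have h0 := h.self_of_nhds
  obtain ⟨L, hL, -⟩ := hφ.fst
  have key := mfderiv_eq_zero_iff_of_factor (p := fun y => (φ y).1) (r := fun y => (Ψ y).1)
    (k := κ) (l := κ.symm) hL.mdifferentiableAt hr.mdifferentiableAt
    ((hκℝ.contMDiffOn.contMDiffAt (κ.open_source.mem_nhds h0.1)).mdifferentiableAt (by simp))
    (hκℝ.mdifferentiableAt_symm (by
      rw [Ψ.right_inv hq, ← h0.2.2.1]
      exact κ.map_source h0.1))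
    (hev.mono fun y hy => by
      have := hy.1.2.2.1
      rwa [hy.2] at this)
    (hev.mono fun y hy => by
      rw [← hy.1.2.2.1, hy.2, κ.left_inv (by have := hy.1.1; rwa [hy.2] at this)]) u
  rw [hr.mfderiv] at key
  refine key.trans ?_
  rw [← hΨ.chartD_real hq]
  rfl

theorem mem_canonicalFoliation₂_iff (hκ : IsModelChart ℂ (E := E) κ)
    (hΨ : IsModelChart ℂ (E := E') Ψ) (hq : q ∈ Ψ.target)
    (h : ∀ᶠ q' in 𝓝 q, IsProductChartAt σ κ Ψ φ q')
    (hφ : IsIdentificationAt E E' φ (Ψ.symm q)) (u : TangentSpace 𝓘(ℝ, E') (Ψ.symm q)) :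
    u ∈ canonicalFoliation₂ E E' φ (Ψ.symm q) ↔ (chartD ℂ (E := E') Ψ q (toHol u)).2 = 0 := by
  have hκℝ : IsModelChart ℝ (E := E) κ := hκ.restrictScalars_real
  have hΨr : MDifferentiableAt 𝓘(ℝ, E') 𝓘(ℝ, E × E) Ψ (Ψ.symm q) :=
    (hΨ.mdifferentiableAt hq).restrictScalars_real
  have hr : HasMFDerivAt 𝓘(ℝ, E') 𝓘(ℝ, E) (fun y => (Ψ y).2) (Ψ.symm q) _ :=
    (ContinuousLinearMap.snd ℝ E E).hasMFDerivAt.comp _ hΨr.hasMFDerivAt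
  have hev : ∀ᶠ y in 𝓝 (Ψ.symm q), IsProductChartAt σ κ Ψ φ (Ψ y) ∧ Ψ.symm (Ψ y) = y := by
    refine Filter.Eventually.and ?_ (hΨ.eventually_left_inv hq)
    refine (Ψ.continuousAt (Ψ.map_target hq)).eventually ?_
    rwa [Ψ.right_inv hq]
  have h0 := h.self_of_nhds
  have h0' : σ.map q.2 = κ (φ (Ψ.symm q)).2 := by rw [← h0.2.2.2, σ.map_map]
  obtain ⟨L, hL, -⟩ := hφ.snd
  have hκd := (hκℝ.contMDiffOn.contMDiffAt (κ.open_source.mem_nhds h0.2.1)).mdifferentiableAt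
    (by simp)
  have hκs : MDifferentiableAt 𝓘(ℝ, E) 𝓘(ℝ, E) κ.symm (σ.map (Ψ (Ψ.symm q)).2) :=
    hκℝ.mdifferentiableAt_symm (by
      rw [Ψ.right_inv hq, h0']
      exact κ.map_source h0.2.1)
  have key := mfderiv_eq_zero_iff_of_factor (p := fun y => (φ y).2) (r := fun y => (Ψ y).2)
    (k := fun y => σ.map (κ y)) (l := fun z => κ.symm (σ.map z)) hL.mdifferentiableAt
    hr.mdifferentiableAt
    (MDifferentiableAt.comp (g := σ.map) (f := κ) (φ (Ψ.symm q)).2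
      σ.map.hasMFDerivAt.mdifferentiableAt hκd)
    (MDifferentiableAt.comp (g := κ.symm) (f := σ.map) (Ψ (Ψ.symm q)).2 hκs
      σ.map.hasMFDerivAt.mdifferentiableAt)
    (hev.mono fun y hy => by
      have := hy.1.2.2.2
      rwa [hy.2] at this)
    (hev.mono fun y hy => by
      rw [← hy.1.2.2.2, hy.2, σ.map_map, κ.left_inv (by have := hy.1.2.1; rwa [hy.2] at this)]) u
  rw [hr.mfderiv] at key
  refine key.trans ?_
  rw [← hΨ.chartD_real hq]
  rfl

/-- The holomorphic extension of a Kähler structure to a complexification is a bicomplex Kähler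
structure, whose bi-Lagrangian structure is given by the canonical foliations. -/
theorem IsComplexification.exists_isBicomplexKahlerOn {f : N → M} (hf : IsComplexification E E' f)
    {g₀ ω₀ : BilinField ℝ E N} (hg₀ : ∀ x, g₀.AnalyticAt x) (hg₀s : ∀ x u v, g₀ x u v = g₀ x v u)
    (hg₀d : ∀ x u, g₀ x u u = 0 → u = 0) (hK : IsKahler g₀ ω₀) {U : Set M} {g₀c : BilinField ℂ E' M}
    {I₀c : EndField ℂ E' M} {ω₀c : BilinField ℂ E' M} (hU : IsOpen U) (hfU : range f ⊆ U)
    (hg : IsHolomorphicExtensionBilin f g₀ U g₀c)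
    (hI : IsHolomorphicExtensionEnd f (complexStructure E N) U I₀c)
    (hω : IsHolomorphicExtensionBilin f ω₀ U ω₀c) {U' : Set M}
    (hφ : IsCanonicalIdentification E E' f U' φ) {g : BilinField ℂ E' M} {F : EndField ℂ E' M}
    (hgg : ∀ x, Complex.I • g x = g₀c x)
    (hF : ∀ x, F x = (I₀c x).comp (complexStructureHol E' M x)) :
    ∃ V : Set M, IsOpen V ∧ range f ⊆ V ∧ V ⊆ U ∩ U' ∧
      IsBicomplexKahlerOn V g F ω₀c ∧
      IsComplexBiLagrangianOn V ω₀c (canonicalFoliation₁ E E' φ) (canonicalFoliation₂ E E' φ) ∧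
      ∀ x ∈ V,
        eigendistribution F.toReal 1 x = canonicalFoliation₁ E E' φ x ∧
        eigendistribution F.toReal (-1) x = canonicalFoliation₂ E E' φ x := by
  obtain ⟨σ⟩ := exists_conjugation E
  choose Ψ hΨ using hf.exists_isDiagonalChart σ
  have key : ∀ a, ∃ S, σ.diag (chartAt E a a) ∈ S ∧ IsAdaptedOn (Ψ a) S g F ω₀c ∧
      ∀ q ∈ S, IsProductChartAt σ (chartAt E a) (Ψ a) φ q ∧ (Ψ a).symm q ∈ U ∩ U' := by
    intro a
    obtain ⟨S, haS, hS⟩ := (hΨ a).exists_isAdaptedOn hf hg₀ hg₀s hg₀d hK hU hfU hg hI hω hgg hF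
    have hW : U ∩ U' ∈ 𝓝 (f a) := (hU.inter hφ.isOpen).mem_nhds
      ⟨hfU (mem_range_self a), hφ.range_subset (mem_range_self a)⟩
    obtain ⟨T, hT, hTo, haT⟩ := eventually_nhds_iff.1 (((hΨ a).eventually_identification_eq hW
      (fun x hx => hφ.isIdentificationAt hx.2) fun y _ => hφ.diagonal y).and
        ((hΨ a).inter_preimage_mem_nhds hW))
    exact ⟨S ∩ T, ⟨haS, haT⟩, hS.mono (hS.isOpen.inter hTo) inter_subset_left,
      fun q hq => ⟨(hT q hq.2).1, (hT q hq.2).2.2⟩⟩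
  choose S haS hS hSφ using key
  -- The union of the chart domains on which the tensor identities and the product form of φ both
  -- hold; all remaining claims are pointwise or local on it.
  let V : Set M := ⋃ a, (Ψ a).symm '' S a
  have hVo : IsOpen V := isOpen_iUnion fun a =>
    (Ψ a).symm.isOpen_image_of_subset_source (hS a).isOpen (hS a).subset
  have hV : ∀ {p : M → Prop}, (∀ a, ∀ q ∈ S a, p ((Ψ a).symm q)) → ∀ x ∈ V, p x := by
    intro p hp x hx
    obtain ⟨a, q, hq, rfl⟩ := mem_iUnion.1 hx
    exact hp a q hq
  have hA : HasAdaptedCharts E V g F ω₀c := hV fun a q hq => ⟨Ψ a, S a, hS a, q, hq, rfl⟩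
  have hfV : range f ⊆ V := by
    rintro _ ⟨a, rfl⟩
    exact mem_iUnion.2 ⟨a, σ.diag (chartAt E a a), haS a, by
      rw [← ((hΨ a).apply_eq a (hΨ a).mem_source).2, (Ψ a).left_inv (hΨ a).mem_source]⟩
  have hκ : ∀ a : N, IsModelChart ℂ (E := E) (chartAt E a) := isModelChart_chartAt
  have h₁ : ∀ x ∈ V, eigendistribution F.toReal 1 x = canonicalFoliation₁ E E' φ x :=
    hV fun a q hq => Submodule.ext fun u => ((hS a).mem_eigendistribution_one_iff hq u).trans
      (mem_canonicalFoliation₁_iff (hκ a) (hΨ a).chart ((hS a).subset hq)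
        (Filter.eventually_of_mem ((hS a).isOpen.mem_nhds hq) fun q' hq' => (hSφ a q' hq').1)
        (hφ.isIdentificationAt (hSφ a q hq).2.2) u).symm
  have h₂ : ∀ x ∈ V, eigendistribution F.toReal (-1) x = canonicalFoliation₂ E E' φ x :=
    hV fun a q hq => Submodule.ext fun u => ((hS a).mem_eigendistribution_neg_one_iff hq u).trans
      (mem_canonicalFoliation₂_iff (hκ a) (hΨ a).chart ((hS a).subset hq)
        (Filter.eventually_of_mem ((hS a).isOpen.mem_nhds hq) fun q' hq' => (hSφ a q' hq').1)
        (hφ.isIdentificationAt (hSφ a q hq).2.2) u).symm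
  exact ⟨V, hVo, hfV, hV fun a q hq => (hSφ a q hq).2, hA.isBicomplexKahlerOn,
    hA.isComplexBiLagrangianOn hVo h₁ h₂, fun x hx => ⟨h₁ x hx, h₂ x hx⟩⟩

end

end

end

theorem mainTheorem8
    {E : Type*} [NormedAddCommGroup E] [NormedSpace ℂ E] [FiniteDimensional ℂ E]
    {N : Type*} [Nonempty N] [TopologicalSpace N] [T2Space N] [SecondCountableTopology N]
    [ChartedSpace E N] [IsManifold 𝓘(ℂ, E) ω N]
    {E' : Type*} [NormedAddCommGroup E'] [NormedSpace ℂ E'] [FiniteDimensional ℂ E']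
    {M : Type*} [TopologicalSpace M] [T2Space M] [SecondCountableTopology M]
    [ChartedSpace E' M] [IsManifold 𝓘(ℂ, E') ω M]
    (g₀ : ContMDiffRiemannianMetric 𝓘(ℝ, E) ω E (fun x : N => TangentSpace 𝓘(ℝ, E) x))
    (ω₀ : BilinField ℝ E N) (hK : IsKahler g₀.inner ω₀)
    (f : N → M) (hf : IsComplexification E E' f) :
    -- the holomorphic extensions `g₀ᶜ`, `I₀ᶜ`, `ω₀ᶜ` exist near `f(N)`
    (∃ (U : Set M) (g₀c : BilinField ℂ E' M) (I₀c : EndField ℂ E' M) (ω₀c : BilinField ℂ E' M),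
      IsOpen U ∧ range f ⊆ U ∧
      IsHolomorphicExtensionBilin f g₀.inner U g₀c ∧
      IsHolomorphicExtensionEnd f (complexStructure E N) U I₀c ∧
      IsHolomorphicExtensionBilin f ω₀ U ω₀c) ∧
    -- the identification with `N × N̄` defining the canonical foliations exists near `f(N)`
    (∃ (U : Set M) (φ : M → N × N), IsCanonicalIdentification E E' f U φ) ∧
    -- whichever representatives of these germs are used, the conclusion holds near `f(N)`
    ∀ (U : Set M) (g₀c : BilinField ℂ E' M) (I₀c : EndField ℂ E' M) (ω₀c : BilinField ℂ E' M)
      (U' : Set M) (φ : M → N × N),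
      IsOpen U → range f ⊆ U →
      IsHolomorphicExtensionBilin f g₀.inner U g₀c →
      IsHolomorphicExtensionEnd f (complexStructure E N) U I₀c →
      IsHolomorphicExtensionBilin f ω₀ U ω₀c →
      IsCanonicalIdentification E E' f U' φ →
      ∀ (g : BilinField ℂ E' M) (F : EndField ℂ E' M),
      (∀ x, Complex.I • g x = g₀c x) →
      (∀ x, F x = (I₀c x).comp (complexStructureHol E' M x)) →
      ∃ V : Set M, IsOpen V ∧ range f ⊆ V ∧ V ⊆ U ∩ U' ∧
        IsBicomplexKahlerOn V g F ω₀c ∧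
        IsComplexBiLagrangianOn V ω₀c
          (canonicalFoliation₁ E E' φ)
          (canonicalFoliation₂ E E' φ) ∧
        ∀ x ∈ V,
          eigendistribution F.toReal 1 x = canonicalFoliation₁ E E' φ x ∧
          eigendistribution F.toReal (-1) x = canonicalFoliation₂ E E' φ x := by
  have : CompleteSpace E := FiniteDimensional.complete ℂ E
  have : FiniteDimensional ℝ E := FiniteDimensional.complexToReal E
  -- Finite-dimensional models make `N` and `M` locally compact. Being Hausdorff, they are then
  -- regular, as gluing requires.
  have : ProperSpace E := FiniteDimensional.proper ℂ E
  have : ProperSpace E' := FiniteDimensional.proper ℂ E'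
  have : LocallyCompactSpace N := ChartedSpace.locallyCompactSpace E N
  have : LocallyCompactSpace M := ChartedSpace.locallyCompactSpace E' M
  have hg₀ : ∀ x, BilinField.AnalyticAt g₀.inner x := fun x => g₀.contMDiff x
  have hg₀d : ∀ x u, g₀.inner x u u = 0 → u = 0 := fun x u hu => by
    by_contra hne
    exact (g₀.pos x u hne).ne' hu
  have hκ : ∀ a : N, IsModelChart ℝ (E := E) (chartAt E a) := isModelChart_chartAt
  have hκℂ : ∀ a : N, IsModelChart ℂ (E := E) (chartAt E a) := isModelChart_chartAt
  have ha : ∀ a : N, chartAt E a a ∈ (chartAt E a).target := fun a =>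
    (chartAt E a).map_source (mem_chart_source E a)
  refine ⟨?_, hf.exists_isCanonicalIdentification, ?_⟩
  · obtain ⟨U₁, g₀c, hU₁, hfU₁, hg⟩ := hf.exists_bilin_extension (b := g₀.inner) fun a =>
      (hκ a).contDiffAt_bilin_inChart (ha a) (hg₀ _)
    obtain ⟨U₂, I₀c, hU₂, hfU₂, hI⟩ := hf.exists_complexStructure_extension
    obtain ⟨U₃, ω₀c, hU₃, hfU₃, hω⟩ := hf.exists_bilin_extension (b := ω₀) fun a =>
      hK.contDiffAt_inChart (hκℂ a) (ha a) (hg₀ _)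
    refine ⟨U₁ ∩ U₂ ∩ U₃, g₀c, I₀c, ω₀c, (hU₁.inter hU₂).inter hU₃,
      subset_inter (subset_inter hfU₁ hfU₂) hfU₃, ⟨?_, hg.pullback⟩, ⟨?_, hI.pullback⟩,
      ⟨?_, hω.pullback⟩⟩
    · exact ContMDiffOn.mono hg.holomorphic fun x hx => hx.1.1
    · exact ContMDiffOn.mono hI.holomorphic fun x hx => hx.1.2
    · exact ContMDiffOn.mono hω.holomorphic fun x hx => hx.2
  · intro U g₀c I₀c ω₀c U' φ hU hfU hg hI hω hφ g F hgg hF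
    exact hf.exists_isBicomplexKahlerOn hg₀ g₀.symm hg₀d hK hU hfU hg hI hω hφ hgg hF
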